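/- **Theorem 1.3.** Let $l,d,n\ge 1$ be integers. Write $\xi=(\xi_{i,j})_{1\le i\le l,\,1\le j\le d}$ with $\xi_{i,j}\in\mathbb R^n$ for a point of $(\mathbb R^{dn})^l$, and put $\xi_i=(\xi_{i,1},\dots,\xi_{i,d})\in\mathbb R^{dn}$ and $\xi^j=(\xi_{1,j},\dots,\xi_{l,j})\in\mathbb R^{ln}$. With $\widehat f(\xi)=\int f(x)e^{-2\pi i\langle x,\xi\rangle}dx$, define for $m\in L^\infty((\mathbb R^{dn})^l)$ and Schwartz functions $f_1,\dots,f_l$ on $\mathbb R^{dn}$ $$T_m(f_1,\dots,f_l)(x)=\int_{(\mathbb R^{dn})^l} m(\xi)\,\widehat f_1(\xi_1)\cdots\widehat f_l(\xi_l)\,e^{2\pi i\langle x,\xi_1+\cdots+\xi_l\rangle}\,d\xi,\qquad x\in\mathbb R^{dn}.$$ Let $1<p_1,\dots,p_l<\infty$, $\frac1p=\frac1{p_1}+\cdots+\frac1{p_l}$, $1<u<\infty$, $\frac1u+\frac1{u'}=1$, and $0<s_1,\dots,s_d<\infty$. For $j=1,\dots,d$ let $\Theta_j$ be a Schwartz function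 on $\mathbb R^{ln}$ whose Fourier transform is supported in $\{\eta\in\mathbb R^{ln}:\frac12\le|\eta|\le2\}$, and set $$\mathcal A^u_{s_1,\dots,s_d}[m]=\sup_{k_1,\dots,k_d\in\mathbb Z}\Big\|m(2^{k_1}\xi^1,\dots,2^{k_d}\xi^d)\,\widehat{\Theta_1}(\xi^1)\cdots\widehat{\Theta_d}(\xi^d)\Big\|_{L^u_{s_1,\dots,s_d}},$$ where $$\|F\|_{L^u_{s_1,\dots,s_d}}=\Big\|\Big[\prod_{j=1}^d(1+4\pi^2|\xi^j|^2)^{s_j/2}\,\widehat F\Big]^\vee\Big\|_{L^u(\mathbb R^{ln}\times\cdots\times\mathbb R^{ln})}$$ in the sense of tempered distributions (the norm is $\infty$ if the distribution in brackets is not a function in $L^u$). Suppose that there is a finite constant $C$ such that $$\|T_m(f_1,\dots,f_l)\|_{L^p(\mathbb R^{dn})}\le C\,\mathcal A^u_{s_1,\dots,s_d}[m]\prod_{i=1}^l\|f_i\|_{L^{p_i}(\mathbb R^{dn})}$$ for all $m\in L^\infty((\mathbb R^{dn})^l)$ with $\mathcal A^u_{s_1,\dots,s_d}[m]<\infty$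 and all Schwartz functions $f_1,\dots,f_l$ on $\mathbb R^{dn}$. Then $$\min_{1\le j\le d}\frac{s_j}n\ \ge\ \max\Big\{\max_{I}\Big(\frac1p-\frac12-\sum_{i\in I}\Big(\frac1{p_i}-\frac12\Big)\Big),\ \max_{I}\Big(\frac1p-\frac1{u'}-\sum_{i\in I}\Big(\frac1{p_i}-\frac1u\Big)\Big)\Big\},$$ where $I$ runs over all subsets of $\{1,\dots,l\}$ (including $\emptyset$), and $$\min_{1\le j\le d}\frac{s_j}n\ >\ \max\Big\{\frac lu,\ \frac1p-\frac1{u'}\Big\}.$$ -/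

import Mathlib

open MeasureTheory
open scoped SchwartzMap FourierTransform ENNReal NNReal

namespace MultiParam

/-- `ℝ^{dn}`, the domain of the input functions: `x (j, r)` is the `r`-th coordinate of the `j`-th
component `x_j ∈ ℝⁿ`. -/
abbrev Phys (d n : ℕ) : Type := EuclideanSpace ℝ (Fin d × Fin n)

/-- `ℝ^{ln}`, the space of the vectors `(ξ_{1,j}, …, ξ_{l,j})` that belong to one parameter `j`. -/
abbrev Block (l n : ℕ) : Type := EuclideanSpace ℝ (Fin l × Fin n)

/-- The frequency space `(ℝ^{dn})^l = (ℝ^{ln})^d`: `ξ (i, j, r)` is the `r`-th coordinate of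
`ξ_{i,j} ∈ ℝⁿ`. -/
abbrev Freq (l d n : ℕ) : Type := EuclideanSpace ℝ (Fin l × Fin d × Fin n)

/-- `ξ_i = (ξ_{i,1}, …, ξ_{i,d}) ∈ ℝ^{dn}`. -/
def slot {l d n : ℕ} (i : Fin l) (ξ : Freq l d n) : Phys d n :=
  WithLp.toLp 2 (fun a => ξ (i, a.1, a.2))

/-- `(ξ_{1,j}, …, ξ_{l,j}) ∈ ℝ^{ln}`. -/
def param {l d n : ℕ} (j : Fin d) (ξ : Freq l d n) : Block l n :=
  WithLp.toLp 2 (fun a => ξ (a.1, j, a.2))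

/-- The point whose `j`-th block is `2 ^ k_j` times the `j`-th block of `ξ`. -/
noncomputable def dilate {l d n : ℕ} (k : Fin d → ℤ) (ξ : Freq l d n) : Freq l d n :=
  WithLp.toLp 2 (fun a => (2 : ℝ) ^ k a.2.1 * ξ a)

/-- The `l`-linear `d`-parameter Fourier multiplier operator
`T_m(f_1, …, f_l)(x) = ∫ m(ξ) f̂_1(ξ_1) ⋯ f̂_l(ξ_l) e^{2πi⟨x, ξ_1 + ⋯ + ξ_l⟩} dξ`. -/
noncomputable def multiplierOp {l d n : ℕ} (m : Freq l d n → ℂ)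
    (f : Fin l → 𝓢(Phys d n, ℂ)) (x : Phys d n) : ℂ :=
  ∫ ξ : Freq l d n, m ξ * (∏ i, 𝓕 (f i) (slot i ξ)) *
    Complex.exp (2 * (Real.pi : ℂ) * Complex.I * ((inner ℝ x (∑ i, slot i ξ) : ℝ) : ℂ))

/-- The symbol `∏_j (1 + 4π²|ξ^j|²)^{s_j/2}`. -/
noncomputable def besselSymbol {l d n : ℕ} (s : Fin d → ℝ) (ξ : Freq l d n) : ℝ :=
  ∏ j, (1 + 4 * Real.pi ^ 2 * ‖param j ξ‖ ^ 2) ^ (s j / 2)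

/-- `param` as a linear map. -/
noncomputable def paramL {l d n : ℕ} (j : Fin d) : Freq l d n →ₗ[ℝ] Block l n where
  toFun := param j
  map_add' x y := by ext a; simp [param]
  map_smul' c x := by ext a; simp [param]

/-- `besselLift` is therefore the genuine Fourier multiplier. -/
theorem besselSymbol_hasTemperateGrowth {l d n : ℕ} (s : Fin d → ℝ) :
    (fun ξ : Freq l d n => (besselSymbol s ξ : ℂ)).HasTemperateGrowth := by
  have h1 : ∀ j : Fin d, (fun ξ : Freq l d n =>
      (1 + 4 * Real.pi ^ 2 * ‖param j ξ‖ ^ 2) ^ (s j / 2)).HasTemperateGrowth := by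
    intro j
    have hL := (((2 * Real.pi) • paramL (l := l) (n := n) j).toContinuousLinearMap).hasTemperateGrowth
    have := (Function.hasTemperateGrowth_one_add_norm_sq_rpow (H := Block l n) (s j / 2)).comp hL
    have e : (fun ξ : Freq l d n => (1 + 4 * Real.pi ^ 2 * ‖param j ξ‖ ^ 2) ^ (s j / 2)) =
        (fun x : Block l n => (1 + ‖x‖ ^ 2) ^ (s j / 2)) ∘
          ⇑(((2 * Real.pi) • paramL (l := l) (n := n) j).toContinuousLinearMap) := by
      funext ξ
      have e1 : ((2 * Real.pi) • paramL (l := l) (n := n) j).toContinuousLinearMap ξ =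
        (2 * Real.pi) • param j ξ := rfl
      simp only [Function.comp_apply, e1, norm_smul, Real.norm_eq_abs,
        abs_of_pos Real.two_pi_pos]
      ring_nf
    rw [e]
    exact this
  have h2 : ∀ t : Finset (Fin d), (fun ξ : Freq l d n =>
      ∏ j ∈ t, (1 + 4 * Real.pi ^ 2 * ‖param j ξ‖ ^ 2) ^ (s j / 2)).HasTemperateGrowth := by
    classical
    intro t
    induction t using Finset.induction_on with
    | empty => simp only [Finset.prod_empty]; exact Function.HasTemperateGrowth.const (1 : ℝ)
    | insert a t ha ih =>
      simp only [Finset.prod_insert ha]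
      exact (h1 a).mul ih
  exact Function.HasTemperateGrowth.comp (Complex.ofRealCLM).hasTemperateGrowth (h2 Finset.univ)

/-- The tempered distribution `T` is the function `F`. -/
def Represents {l d n : ℕ} (T : 𝓢'(Freq l d n, ℂ)) (F : Freq l d n → ℂ) : Prop :=
  ∀ φ : 𝓢(Freq l d n, ℂ), Integrable (fun ξ => φ ξ * F ξ) ∧ T φ = ∫ ξ, φ ξ * F ξ

/-- A function in some `L^u` that represents a tempered distribution is unique up to null sets. -/
theorem Represents.ae_eq {l d n : ℕ} {T : 𝓢'(Freq l d n, ℂ)} {F G : Freq l d n → ℂ} {u v : ℝ≥0∞}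
    (hu : 1 ≤ u) (hv : 1 ≤ v)
    (hF : MemLp F u) (hG : MemLp G v) (h1 : Represents T F) (h2 : Represents T G) :
    F =ᵐ[volume] G := by
  have : ∀ᵐ x, F x - G x = 0 := by
    apply ae_eq_zero_of_integral_contDiff_smul_eq_zero
    · exact (hF.locallyIntegrable hu).sub (hG.locallyIntegrable hv)
    · intro g hg hc
      have hg₁ : HasCompactSupport (Complex.ofRealCLM ∘ g) := hc.comp_left rfl
      have hg₂ : ContDiff ℝ (⊤:ℕ∞) (Complex.ofRealCLM ∘ g) := by fun_prop
      have a := h1 (hg₁.toSchwartzMap hg₂)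
      have b := h2 (hg₁.toSchwartzMap hg₂)
      have e := a.2.symm.trans b.2
      have := integral_sub a.1 b.1
      rw [e, sub_self] at this
      simpa [mul_sub] using this
  filter_upwards [this] with x hx using sub_eq_zero.1 hx

/-- The tempered distribution `[∏_j (1 + 4π²|·|²)^{s_j/2} T̂]^∨`. -/
noncomputable def besselLift {l d n : ℕ} (s : Fin d → ℝ) (T : 𝓢'(Freq l d n, ℂ)) :
    𝓢'(Freq l d n, ℂ) :=
  TemperedDistribution.fourierMultiplierCLM ℂ (fun ξ => (besselSymbol s ξ : ℂ)) T

/-- The `d`-parameter Sobolev norm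
`‖F‖_{L^u_{s_1,…,s_d}} = ‖[∏_j (1 + 4π²|ξ^j|²)^{s_j/2} F̂]^∨‖_{L^u}`, with the Fourier transforms in
the sense of tempered distributions; it is `∞` unless that distribution is a function in `L^u`
(which is then unique up to null sets). -/
noncomputable def sobolevNorm {l d n : ℕ} (u : ℝ) (s : Fin d → ℝ) (F : Freq l d n → ℂ) : ℝ≥0∞ :=
  ⨅ (g : Freq l d n → ℂ) (_ : MemLp g (ENNReal.ofReal u) volume)
    (_ : ∃ T : 𝓢'(Freq l d n, ℂ), Represents T F ∧ Represents (besselLift s T) g),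
    eLpNorm g (ENNReal.ofReal u) volume

/-- `𝒜^u_{s_1,…,s_d}[m] = sup_{k_1,…,k_d ∈ ℤ}
‖m(2^{k_1} ξ^1, …, 2^{k_d} ξ^d) Θ̂_1(ξ^1) ⋯ Θ̂_d(ξ^d)‖_{L^u_{s_1,…,s_d}}`. -/
noncomputable def hormanderNorm {l d n : ℕ} (u : ℝ) (s : Fin d → ℝ)
    (Θ : Fin d → 𝓢(Block l n, ℂ)) (m : Freq l d n → ℂ) : ℝ≥0∞ :=
  ⨆ k : Fin d → ℤ, sobolevNorm u s (fun ξ => m (dilate k ξ) * ∏ j, 𝓕 (Θ j) (param j ξ))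

end MultiParam

/-!
The multiplier inequality is tested on symbols and functions that live at a large scale `N` in one
parameter `j₀` and at unit scale in all the others; comparing powers of `N` gives the lower bounds
for `s_{j₀}`.

**Reduction.** A symbol supported near a point `ξ₀` all of whose blocks have norm `1` meets the
supports of the `Θ̂_j` after finitely many of the dyadic dilations only, and translating a symbol
amounts to modulating the input functions. So the inequality may be tested on smooth symbols `m`
supported in a small ball around the origin, with the Hörmander norm replaced by the Sobolev norms of
finitely many localized dilates `view hΘ ξ₀ κ m` (`eLpNorm_multiplierOp_le`, `LocalBound`). No
property of the `Θ_j` besides the support condition is needed.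

**Sobolev norms.** If each derivative in the block `j₀` costs at most a factor `N` and the other
derivatives cost nothing, then the Sobolev norm costs at most `N ^ s_{j₀}` (`ScaledFamily.lift`). This
holds on every `L^v` with `1 ≤ v < ∞`: even powers of `(1 - Δ_j)^{1/2}` are differential operators, and
a fractional power of `1 - Δ_j` is, by splitting its Laplace representation at a free time `τ`, a
combination of averages of translates of `(1 - Δ_j) F` and of `F` (`eLpNorm_fractional_le`), to be
used with `τ = N⁻²`.

**Tests.** If the symbol depends on the sum of the frequencies only, the operator convolves the
pointwise product of its inputs with a kernel (`multiplierOp_eq_convolution`). The inputs are built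
from a nonnegative band-limited function (`exists_kernel`).

* `LocalBound.exponent_le`: a kernel at scale `N`, and inputs with index in `I` spread out to scale
  `N`, give `1/p - 1/u' - ∑_{i ∈ I} (1/q_i - 1/u) ≤ s_j / n` for `I` not the full index set.
* `LocalBound.card_mul_lt`: plateau symbols at scale `N` in all `l` slots give `s_j / n ≥ l / u`. The
  inequality is strict: at the endpoint, symbols at sparse scales behave in `L^u` like functions with
  disjoint supports (`exists_sparse`), whereas the operator acts on suitable inputs as the sum of
  `k` identical terms, and `k ≤ C k ^ (1 / u)` fails for large `k`. The full index set in the bound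
  before follows from this one.
* `LocalBound.lt_of_lt_one`: strictness of `1/p - 1/u' < s_j / n`. For `p ≥ 1` it follows from
  `l / u < s_j / n`. For `p < 1` the target is only quasi-normed: a sum of `K` normalized kernels at
  lacunary scales has a symbol of norm of order at most `K` and an output of size at least
  `K ^ (1 / p)`.
* `LocalBound.chirp_le`: a chirp `e^{iπN|ξ_{i,j}|²}` on the inputs with `q_i ≥ 2` lowers their norms by
  the factor `N ^ (n/q_i - n/2)` (`eLpNorm_chirped_le`). The symbol removes these chirps and puts a
  chirp on the output instead, which is then of size `N ^ (-n/2)` on a ball of radius `N` in the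
  parameter `j` (`exists_le_norm_integral_chirpKernel`). This gives
  `1/p - 1/2 - ∑_{i ∈ I} (1/q_i - 1/2) ≤ s_j / n` if `q_i ≥ 2` for `i ∈ I`; other indices only lower
  the left side.
-/

set_option linter.unusedSectionVars false
set_option linter.style.haveILetI false

namespace MultiParam

/-! ### Averages of translates -/

/-- The character `r ↦ e^{2πir}`. -/
noncomputable def wave (r : ℝ) : ℂ := Complex.exp (2 * (Real.pi : ℂ) * Complex.I * (r : ℂ))

theorem wave_eq (r : ℝ) : wave r = Complex.exp (((2 * Real.pi * r : ℝ) : ℂ) * Complex.I) := by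
  rw [wave]; congr 1; push_cast; ring

@[simp] theorem norm_wave (r : ℝ) : ‖wave r‖ = 1 := by
  rw [wave_eq, Complex.norm_exp_ofReal_mul_I]

theorem wave_add (r t : ℝ) : wave (r + t) = wave r * wave t := by
  rw [wave, wave, wave, ← Complex.exp_add]; congr 1; push_cast; ring

@[simp] theorem wave_zero : wave 0 = 1 := by simp [wave]

theorem continuous_wave : Continuous wave := by unfold wave; fun_prop

section Averages

variable {V : Type*} [NormedAddCommGroup V] [InnerProductSpace ℝ V] [FiniteDimensional ℝ V]
  [MeasurableSpace V] [BorelSpace V]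

/-- Minkowski's inequality: an average of translates has at most the mass of the measure as operator
norm on `L^v`. -/
theorem eLpNorm_integral_translate_le {Ω : Type*} [MeasurableSpace Ω] (ν : Measure Ω)
    [IsFiniteMeasure ν] {z : Ω → V} (hz : Measurable z) {v : ℝ≥0∞} (hv : 1 ≤ v) (hv' : v ≠ ∞)
    (F : 𝓢(V, ℂ)) :
    eLpNorm (fun x => ∫ ω, F (x + z ω) ∂ν) v volume ≤ ν Set.univ * eLpNorm F v volume := by
  have hv0 : v ≠ 0 := (zero_lt_one.trans_le hv).ne'
  have hr : 0 < v.toReal := ENNReal.toReal_pos hv0 hv'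
  have hr1 : 1 ≤ v.toReal := by
    rw [← ENNReal.toReal_one]; exact (ENNReal.toReal_le_toReal (by simp) hv').2 hv
  rw [eLpNorm_eq_lintegral_rpow_enorm_toReal hv0 hv', eLpNorm_eq_lintegral_rpow_enorm_toReal hv0 hv']
  have hF : Measurable (fun q : V × Ω => ‖F (q.1 + z q.2)‖ₑ ^ v.toReal) := by
    have : Measurable (fun q : V × Ω => F (q.1 + z q.2)) :=
      F.continuous.measurable.comp (measurable_fst.add (hz.comp measurable_snd))
    exact this.enorm.pow_const _
  have key : ∀ x, ‖∫ ω, F (x + z ω) ∂ν‖ₑ ^ v.toReal ≤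
      ν Set.univ ^ (v.toReal - 1) * ∫⁻ ω, ‖F (x + z ω)‖ₑ ^ v.toReal ∂ν := by
    intro x
    have hm : AEStronglyMeasurable (fun ω => F (x + z ω)) ν :=
      (F.continuous.measurable.comp (measurable_const.add hz)).aestronglyMeasurable
    have h1 : ‖∫ ω, F (x + z ω) ∂ν‖ₑ ≤ eLpNorm (fun ω => F (x + z ω)) v ν *
        ν Set.univ ^ (1 - 1 / v.toReal) := by
      refine (enorm_integral_le_lintegral_enorm _).trans ?_
      have := eLpNorm_le_eLpNorm_mul_rpow_measure_univ hv hm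
      simpa [eLpNorm_one_eq_lintegral_enorm] using this
    refine (ENNReal.rpow_le_rpow h1 hr.le).trans (le_of_eq ?_)
    rw [ENNReal.mul_rpow_of_nonneg _ _ hr.le, eLpNorm_eq_lintegral_rpow_enorm_toReal hv0 hv',
      ← ENNReal.rpow_mul, ← ENNReal.rpow_mul, mul_comm]
    congr 2
    · field_simp
    · rw [one_div, inv_mul_cancel₀ hr.ne', ENNReal.rpow_one]
  have h2 : ∫⁻ x, ‖∫ ω, F (x + z ω) ∂ν‖ₑ ^ v.toReal ≤
      ν Set.univ ^ v.toReal * ∫⁻ x, ‖F x‖ₑ ^ v.toReal := by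
    refine (lintegral_mono key).trans (le_of_eq ?_)
    rw [lintegral_const_mul' _ _ (ENNReal.rpow_ne_top_of_nonneg (by linarith) (measure_ne_top _ _)),
      lintegral_lintegral_swap hF.aemeasurable]
    have : ∀ ω, ∫⁻ x, ‖F (x + z ω)‖ₑ ^ v.toReal = ∫⁻ x, ‖F x‖ₑ ^ v.toReal := fun ω =>
      lintegral_add_right_eq_self (fun x => ‖F x‖ₑ ^ v.toReal) (z ω)
    simp_rw [this]
    rw [lintegral_const, mul_comm (∫⁻ x, _), ← mul_assoc]
    congr 1
    have hadd := ENNReal.rpow_add_of_nonneg (x := ν Set.univ) (v.toReal - 1) 1 (by linarith) zero_le_one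
    rw [ENNReal.rpow_one, sub_add_cancel] at hadd
    exact hadd.symm
  refine (ENNReal.rpow_le_rpow h2 (by positivity)).trans (le_of_eq ?_)
  rw [ENNReal.mul_rpow_of_nonneg _ _ (by positivity), ← ENNReal.rpow_mul]
  congr 1
  rw [mul_one_div_cancel hr.ne', ENNReal.rpow_one]

theorem schwartz_eq_integral_fourier (F : 𝓢(V, ℂ)) (x : V) :
    F x = ∫ η, wave (inner ℝ η x) * 𝓕 F η := by
  have h : F x = 𝓕⁻ (𝓕 F) x := by simp
  rw [h, SchwartzMap.fourierInv_coe, Real.fourierInv_eq']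
  refine integral_congr_ae (Filter.Eventually.of_forall fun η => ?_)
  simp only [smul_eq_mul, wave_eq]

/-- An average of translates is the Fourier multiplier whose symbol is the corresponding average of
characters. -/
theorem integral_translate_eq {Ω : Type*} [MeasurableSpace Ω] (ν : Measure Ω)
    [IsFiniteMeasure ν] {z : Ω → V} (hz : Measurable z) (F : 𝓢(V, ℂ)) (x : V) :
    Integrable (fun η => wave (inner ℝ η x) * ((∫ ω, wave (inner ℝ η (z ω)) ∂ν) * 𝓕 F η)) ∧
    ∫ ω, F (x + z ω) ∂ν =
      ∫ η, wave (inner ℝ η x) * ((∫ ω, wave (inner ℝ η (z ω)) ∂ν) * 𝓕 F η) := by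
  have hint : Integrable (fun q : Ω × V => wave (inner ℝ q.2 (x + z q.1)) * 𝓕 F q.2)
      (ν.prod volume) := by
    have h1 : Integrable (fun q : Ω × V => (1 : ℂ) * 𝓕 F q.2) (ν.prod volume) :=
      Integrable.mul_prod (f := fun _ : Ω => (1 : ℂ)) (g := fun η => 𝓕 F η)
        (integrable_const _) ((𝓕 F).integrable)
    refine h1.norm.mono' ?_ (Filter.Eventually.of_forall fun q => ?_)
    · have h2 : Measurable (fun q : Ω × V => inner ℝ q.2 (x + z q.1)) :=
        Measurable.inner measurable_snd (measurable_const.add (hz.comp measurable_fst))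
      exact ((continuous_wave.measurable.comp h2).mul
        ((𝓕 F).continuous.measurable.comp measurable_snd)).aestronglyMeasurable
    · simp
  have hsplit : ∀ η, ∫ ω, wave (inner ℝ η (x + z ω)) * 𝓕 F η ∂ν =
      wave (inner ℝ η x) * ((∫ ω, wave (inner ℝ η (z ω)) ∂ν) * 𝓕 F η) := by
    intro η
    simp_rw [inner_add_right, wave_add]
    rw [integral_mul_const, integral_const_mul, mul_assoc]
  constructor
  · have := hint.integral_prod_right
    simpa only [hsplit] using this
  · simp_rw [schwartz_eq_integral_fourier F (x + _)]
    rw [integral_integral_swap hint]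
    simp_rw [hsplit]

end Averages

/-! ### Fractional powers of `1 - Δ` as averages of translates -/

section Heat

variable {V W : Type*} [NormedAddCommGroup V] [InnerProductSpace ℝ V] [FiniteDimensional ℝ V]
  [MeasurableSpace V] [BorelSpace V] [NormedAddCommGroup W] [InnerProductSpace ℝ W]
  [FiniteDimensional ℝ W] [MeasurableSpace W] [BorelSpace W]

/-- Mixtures of the Gaussian symbols `e^{-4π²t|Pη|²}` are symbols of averages of translates, so they
act on `L^v` with norm at most the mass of the mixing measure. -/
theorem eLpNorm_gaussian_mixture_le (P : V →L[ℝ] W) (ρ : Measure ℝ) [IsFiniteMeasure ρ]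
    (hρ : ∀ᵐ t ∂ρ, 0 ≤ t) {v : ℝ≥0∞} (hv : 1 ≤ v) (hv' : v ≠ ∞) (F : 𝓢(V, ℂ)) :
    (∀ x, Integrable (fun η => wave (inner ℝ η x) *
      (((∫ t, Real.exp (-(4 * Real.pi ^ 2 * t * ‖P η‖ ^ 2)) ∂ρ : ℝ) : ℂ) * 𝓕 F η))) ∧
    eLpNorm (fun x => ∫ η, wave (inner ℝ η x) *
      (((∫ t, Real.exp (-(4 * Real.pi ^ 2 * t * ‖P η‖ ^ 2)) ∂ρ : ℝ) : ℂ) * 𝓕 F η)) v volume ≤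
      ρ Set.univ * eLpNorm F v volume := by
  let γ : Measure W := ProbabilityTheory.stdGaussian W
  let z : ℝ × W → V := fun q => √(2 * q.1) • (ContinuousLinearMap.adjoint P q.2)
  have hz : Measurable z := by
    have h1 : Measurable (fun q : ℝ × W => √(2 * q.1)) := by fun_prop
    have h2 : Measurable (fun q : ℝ × W => ContinuousLinearMap.adjoint P q.2) :=
      (ContinuousLinearMap.continuous _).measurable.comp measurable_snd
    exact h1.smul h2
  have hsym : ∀ η, ∫ q, wave (inner ℝ η (z q)) ∂(ρ.prod γ) =
      ((∫ t, Real.exp (-(4 * Real.pi ^ 2 * t * ‖P η‖ ^ 2)) ∂ρ : ℝ) : ℂ) := by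
    intro η
    have hi : Integrable (fun q => wave (inner ℝ η (z q))) (ρ.prod γ) := by
      refine (integrable_const (1 : ℝ)).mono' ?_ (Filter.Eventually.of_forall fun q => by simp)
      exact (continuous_wave.measurable.comp
        (Measurable.inner measurable_const hz)).aestronglyMeasurable
    rw [integral_prod _ hi, ← integral_complex_ofReal]
    refine integral_congr_ae ?_
    filter_upwards [hρ] with t ht
    have h1 := ProbabilityTheory.charFun_stdGaussian (E := W) ((2 * Real.pi * √(2 * t)) • P η)
    rw [charFun_apply] at h1
    have h2 : ∀ y : W, wave (inner ℝ η (z (t, y))) =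
        Complex.exp ((inner ℝ y ((2 * Real.pi * √(2 * t)) • P η) : ℝ) * Complex.I) := by
      intro y
      rw [wave_eq]
      congr 3
      simp only [z, inner_smul_right, ContinuousLinearMap.adjoint_inner_right]
      rw [real_inner_comm]; ring
    simp_rw [h2]
    rw [h1, Complex.ofReal_exp]
    congr 1
    have h3 : ‖(2 * Real.pi * √(2 * t)) • P η‖ ^ 2 = 8 * Real.pi ^ 2 * t * ‖P η‖ ^ 2 := by
      rw [norm_smul, Real.norm_of_nonneg (by positivity), mul_pow, mul_pow,
        Real.sq_sqrt (by linarith)]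
      ring
    rw [← Complex.ofReal_pow, h3]
    push_cast; ring
  have hA := integral_translate_eq (ρ.prod γ) hz F
  have hB := eLpNorm_integral_translate_le (ρ.prod γ) hz hv hv' F
  simp_rw [hsym] at hA
  refine ⟨fun x => (hA x).1, ?_⟩
  simp_rw [fun x => (hA x).2] at hB
  have hmass : (ρ.prod γ) Set.univ = ρ Set.univ := by
    rw [← Set.univ_prod_univ, Measure.prod_prod]; simp [γ]
  rwa [hmass] at hB

/-- Splitting the Laplace representation of `λ ^ (a - 1)` at `τ`, with an integration by parts in the
tail, writes `λ ^ a` through Laplace transforms of finite measures only. -/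
theorem Gamma_mul_rpow_eq {a τ lam : ℝ} (ha : 0 < a) (ha1 : a < 1) (hτ : 0 < τ) (hl : 0 < lam) :
    Real.Gamma (1 - a) * lam ^ a = lam * (∫ t in Set.Ioc 0 τ, t ^ (-a) * Real.exp (-(lam * t))) +
      τ ^ (-a) * Real.exp (-(lam * τ)) -
      ∫ t in Set.Ioi τ, a * t ^ (-a - 1) * Real.exp (-(lam * t)) := by
  have h0 := Real.integral_rpow_mul_exp_neg_mul_Ioi (a := 1 - a) (r := lam) (by linarith) hl
  have hI : IntegrableOn (fun t : ℝ => t ^ (-a) * Real.exp (-(lam * t))) (Set.Ioi 0) := by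
    have h := integrableOn_rpow_mul_exp_neg_mul_rpow (p := 1) (s := -a) (b := lam)
      (by linarith) one_pos hl
    simpa using h
  have hsub : 1 - a - 1 = -a := by ring
  rw [hsub] at h0
  have hIτ := hI.mono_set (Set.Ioi_subset_Ioi hτ.le)
  have hJ : IntegrableOn (fun t : ℝ => a * t ^ (-a - 1) * Real.exp (-(lam * t))) (Set.Ioi τ) := by
    have hb := (hIτ.const_mul (a / τ))
    refine hb.mono' ?_ ?_
    · refine ContinuousOn.aestronglyMeasurable ?_ measurableSet_Ioi
      intro t ht
      have : t ≠ 0 := (hτ.trans ht).ne'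
      exact ((continuousAt_const.mul (Real.continuousAt_rpow_const t _ (Or.inl this))).mul
        (by fun_prop)).continuousWithinAt
    · refine (ae_restrict_iff' measurableSet_Ioi).2 (Filter.Eventually.of_forall fun t ht => ?_)
      have ht0 : 0 < t := hτ.trans ht
      rw [Real.norm_of_nonneg (by positivity), Real.rpow_sub_one ht0.ne']
      have : t⁻¹ ≤ τ⁻¹ := inv_anti₀ hτ ht.le
      calc a * (t ^ (-a) / t) * Real.exp (-(lam * t))
          = a * t⁻¹ * (t ^ (-a) * Real.exp (-(lam * t))) := by ring
        _ ≤ a * τ⁻¹ * (t ^ (-a) * Real.exp (-(lam * t))) := by gcongr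
        _ = _ := by ring
  have hbyparts : ∫ t in Set.Ioi τ, (a * t ^ (-a - 1) * Real.exp (-(lam * t)) +
      lam * (t ^ (-a) * Real.exp (-(lam * t)))) = 0 - (-(τ ^ (-a) * Real.exp (-(lam * τ)))) := by
    refine integral_Ioi_of_hasDerivAt_of_tendsto (f := fun t => -(t ^ (-a) * Real.exp (-(lam * t))))
      ?_ ?_ (hJ.add (hIτ.const_mul lam)) ?_
    · exact ((Real.continuousAt_rpow_const τ _ (Or.inl hτ.ne')).mul
        (by fun_prop)).neg.continuousWithinAt
    · intro t ht
      have ht0 : t ≠ 0 := (hτ.trans ht).ne'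
      have h1 := Real.hasDerivAt_rpow_const (x := t) (p := -a) (Or.inl ht0)
      have h2 : HasDerivAt (fun t : ℝ => Real.exp (-(lam * t)))
          (Real.exp (-(lam * t)) * (-(lam * 1))) t := ((hasDerivAt_id t).const_mul lam).neg.exp
      refine (h1.mul h2).neg.congr_deriv ?_
      ring
    · have h1 := (tendsto_rpow_neg_atTop ha)
      have h2 : Filter.Tendsto (fun t : ℝ => Real.exp (-(lam * t))) Filter.atTop (nhds 0) :=
        Real.tendsto_exp_neg_atTop_nhds_zero.comp (Filter.tendsto_id.const_mul_atTop hl)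
      simpa using (h1.mul h2).neg
  rw [integral_add hJ (hIτ.const_mul lam), integral_const_mul] at hbyparts
  have hsplit : ∫ t in Set.Ioi 0, t ^ (-a) * Real.exp (-(lam * t)) =
      (∫ t in Set.Ioc 0 τ, t ^ (-a) * Real.exp (-(lam * t))) +
      ∫ t in Set.Ioi τ, t ^ (-a) * Real.exp (-(lam * t)) := by
    rw [← Set.Ioc_union_Ioi_eq_Ioi hτ.le]
    exact setIntegral_union (by
      rw [Set.disjoint_left]; intro t h1 h2; exact absurd h1.2 (not_le.2 h2)) measurableSet_Ioi
      (hI.mono_set Set.Ioc_subset_Ioi_self) hIτ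
  have hpow : lam * (1 / lam) ^ (1 - a) = lam ^ a := by
    rw [one_div, Real.inv_rpow hl.le, ← Real.rpow_neg hl.le]
    nth_rewrite 1 [← Real.rpow_one lam]
    rw [← Real.rpow_add hl]; congr 1; ring
  have h3 : Real.Gamma (1 - a) * lam ^ a =
      lam * ∫ t in Set.Ioi 0, t ^ (-a) * Real.exp (-(lam * t)) := by
    rw [h0, ← hpow]; ring
  rw [h3, hsplit]
  linarith

/-- The symbol `λ = 1 + 4π²|Pη|²` of `1 - Δ` in the variables selected by `P`. -/
noncomputable def lamSymbol (P : V →L[ℝ] W) (η : V) : ℝ := 1 + 4 * Real.pi ^ 2 * ‖P η‖ ^ 2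

theorem one_le_lamSymbol (P : V →L[ℝ] W) (η : V) : 1 ≤ lamSymbol P η := by
  unfold lamSymbol; nlinarith [sq_nonneg (Real.pi * ‖P η‖)]

/-- `eLpNorm_gaussian_mixture_le` for a mixture with a density `g(t) e^{-t}`. -/
theorem eLpNorm_laplace_density_le (P : V →L[ℝ] W) {S : Set ℝ} (hS : MeasurableSet S)
    (hS0 : S ⊆ Set.Ioi 0) {g : ℝ → ℝ} (hg0 : ∀ t ∈ S, 0 ≤ g t) (hg : IntegrableOn g S)
    {v : ℝ≥0∞} (hv : 1 ≤ v) (hv' : v ≠ ∞) (F : 𝓢(V, ℂ)) :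
    (∀ x, Integrable (fun η => wave (inner ℝ η x) *
      (((∫ t in S, g t * Real.exp (-(lamSymbol P η * t)) : ℝ) : ℂ) * 𝓕 F η))) ∧
    eLpNorm (fun x => ∫ η, wave (inner ℝ η x) *
      (((∫ t in S, g t * Real.exp (-(lamSymbol P η * t)) : ℝ) : ℂ) * 𝓕 F η)) v volume ≤
      ENNReal.ofReal (∫ t in S, g t) * eLpNorm F v volume := by
  let h : ℝ → ℝ := fun t => g t * Real.exp (-t)
  have hle : ∀ t ∈ S, h t ≤ g t := fun t ht => by
    have : Real.exp (-t) ≤ 1 := Real.exp_le_one_iff.2 (by have := hS0 ht; simp at this; linarith)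
    exact mul_le_of_le_one_right (hg0 t ht) this
  have hh0 : ∀ t ∈ S, 0 ≤ h t := fun t ht => mul_nonneg (hg0 t ht) (Real.exp_pos _).le
  have hhm : AEStronglyMeasurable h (volume.restrict S) :=
    hg.aestronglyMeasurable.mul (by fun_prop)
  have hhi : IntegrableOn h S := by
    refine hg.mono' hhm ((ae_restrict_iff' hS).2 (Filter.Eventually.of_forall fun t ht => ?_))
    rw [Real.norm_of_nonneg (hh0 t ht)]; exact hle t ht
  let ρ : Measure ℝ := (volume.restrict S).withDensity (fun t => ENNReal.ofReal (h t))
  have hmass : ρ Set.univ = ENNReal.ofReal (∫ t in S, h t) := by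
    rw [withDensity_apply _ MeasurableSet.univ, Measure.restrict_univ,
      ofReal_integral_eq_lintegral_ofReal hhi
        ((ae_restrict_iff' hS).2 (Filter.Eventually.of_forall hh0))]
  haveI : IsFiniteMeasure ρ := ⟨by rw [hmass]; exact ENNReal.ofReal_lt_top⟩
  have hρ0 : ∀ᵐ t ∂ρ, 0 ≤ t := by
    refine (withDensity_absolutelyContinuous _ _).ae_le ?_
    exact (ae_restrict_iff' hS).2 (Filter.Eventually.of_forall fun t ht => (hS0 ht).le)
  have hint : ∀ η, ∫ t, Real.exp (-(4 * Real.pi ^ 2 * t * ‖P η‖ ^ 2)) ∂ρ =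
      ∫ t in S, g t * Real.exp (-(lamSymbol P η * t)) := by
    intro η
    rw [integral_withDensity_eq_integral_toReal_smul₀ hhm.aemeasurable.ennreal_ofReal
      (Filter.Eventually.of_forall fun _ => ENNReal.ofReal_lt_top)]
    refine setIntegral_congr_fun hS fun t ht => ?_
    simp only [smul_eq_mul, ENNReal.toReal_ofReal (hh0 t ht), h, lamSymbol]
    rw [mul_assoc, ← Real.exp_add]
    congr 2; ring
  have := eLpNorm_gaussian_mixture_le P ρ hρ0 hv hv' F
  simp_rw [hint] at this
  refine ⟨this.1, this.2.trans ?_⟩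
  rw [hmass]
  exact mul_le_mul_left (ENNReal.ofReal_le_ofReal (setIntegral_mono_on hhi hg hS hle)) _

theorem lamSymbol_rpow_hasTemperateGrowth (P : V →L[ℝ] W) (a : ℝ) :
    (fun η => ((lamSymbol P η ^ a : ℝ) : ℂ)).HasTemperateGrowth := by
  have hL := ((2 * Real.pi) • P).hasTemperateGrowth
  have := (Function.hasTemperateGrowth_one_add_norm_sq_rpow (H := W) a).comp hL
  have e : (fun η => lamSymbol P η ^ a) =
      (fun x : W => (1 + ‖x‖ ^ 2) ^ a) ∘ ⇑((2 * Real.pi) • P) := by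
    funext η
    simp only [Function.comp_apply, smul_apply, norm_smul, Real.norm_eq_abs,
      abs_of_pos Real.two_pi_pos, lamSymbol]
    ring_nf
  rw [← e] at this
  exact Function.HasTemperateGrowth.comp (Complex.ofRealCLM).hasTemperateGrowth this

theorem continuous_integral_wave_mul {H : V → ℂ} (hH : Integrable H) :
    Continuous (fun x => ∫ η, wave (inner ℝ η x) * H η) := by
  refine continuous_of_dominated (bound := fun η => ‖H η‖) (fun x => ?_) (fun x => ?_) hH.norm ?_
  · exact (continuous_wave.comp (by fun_prop)).aestronglyMeasurable.mul hH.aestronglyMeasurable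
  · exact Filter.Eventually.of_forall fun η => by simp
  · exact Filter.Eventually.of_forall fun η =>
      (continuous_wave.comp (by fun_prop)).mul continuous_const

theorem fourierMultiplier_eq_integral {g : V → ℂ} (hg : g.HasTemperateGrowth) (F : 𝓢(V, ℂ))
    (x : V) : SchwartzMap.fourierMultiplierCLM ℂ g F x =
      ∫ η, wave (inner ℝ η x) * (g η * 𝓕 F η) := by
  rw [schwartz_eq_integral_fourier, SchwartzMap.fourierMultiplierCLM_apply]
  simp [SchwartzMap.smulLeftCLM_apply_apply hg]

/-- Interpolation for fractional powers of `λ`: the scale `τ` is free, so that a function living at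
frequency `N` can be estimated with `τ = N⁻²`. -/
theorem eLpNorm_fractional_le (P : V →L[ℝ] W) {a : ℝ} (ha : 0 < a) (ha1 : a < 1) :
    ∃ C : ℝ≥0, ∀ (v : ℝ≥0∞), 1 ≤ v → v ≠ ∞ → ∀ τ : ℝ, 0 < τ → ∀ F : 𝓢(V, ℂ),
      eLpNorm (SchwartzMap.fourierMultiplierCLM ℂ
          (fun η => ((lamSymbol P η ^ a : ℝ) : ℂ)) F) v volume ≤
        C * (ENNReal.ofReal (τ ^ (1 - a)) * eLpNorm (SchwartzMap.fourierMultiplierCLM ℂ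
          (fun η => ((lamSymbol P η ^ (1 : ℝ) : ℝ) : ℂ)) F) v volume +
          ENNReal.ofReal (τ ^ (-a)) * eLpNorm F v volume) := by
  set c := (Real.Gamma (1 - a))⁻¹ with hc
  have hc0 : 0 < c := inv_pos.2 (Real.Gamma_pos_of_pos (by linarith))
  refine ⟨Real.toNNReal (c * ((1 - a)⁻¹ + 2)), fun v hv hv' τ hτ F => ?_⟩
  set G := SchwartzMap.fourierMultiplierCLM ℂ (fun η => ((lamSymbol P η ^ (1 : ℝ) : ℝ) : ℂ)) F
    with hG
  have hGF : ∀ η, 𝓕 G η = (lamSymbol P η : ℂ) * 𝓕 F η := by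
    intro η
    have := lamSymbol_rpow_hasTemperateGrowth P 1
    simp only [hG, SchwartzMap.fourierMultiplierCLM_apply, FourierTransform.fourier_fourierInv_eq]
    rw [SchwartzMap.smulLeftCLM_apply_apply this]; simp
  -- the three terms of `Gamma_mul_rpow_eq`: the first acts on `λ F`, the other two on `F`
  have hgi1 : IntegrableOn (fun t : ℝ => t ^ (-a)) (Set.Ioc 0 τ) :=
    (intervalIntegrable_iff_integrableOn_Ioc_of_le hτ.le).1
      (intervalIntegral.intervalIntegrable_rpow' (by linarith))
  have hgi3 : IntegrableOn (fun t : ℝ => a * t ^ (-a - 1)) (Set.Ioi τ) :=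
    (integrableOn_Ioi_rpow_of_lt (by linarith) hτ).const_mul a
  have h1 := eLpNorm_laplace_density_le P measurableSet_Ioc Set.Ioc_subset_Ioi_self
    (g := fun t : ℝ => t ^ (-a)) (fun t ht => Real.rpow_nonneg ht.1.le _) hgi1 hv hv' G
  have h3 := eLpNorm_laplace_density_le P measurableSet_Ioi (Set.Ioi_subset_Ioi hτ.le)
    (g := fun t : ℝ => a * t ^ (-a - 1))
    (fun t ht => mul_nonneg ha.le (Real.rpow_nonneg (hτ.trans ht).le _)) hgi3 hv hv' F
  have hfin : IsFiniteMeasure (ENNReal.ofReal (τ ^ (-a) * Real.exp (-τ)) • Measure.dirac τ) :=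
    ⟨by simp [ENNReal.ofReal_lt_top]⟩
  have h2 := eLpNorm_gaussian_mixture_le P
    (ENNReal.ofReal (τ ^ (-a) * Real.exp (-τ)) • Measure.dirac τ) (by
      refine Measure.ae_smul_measure ?_ _
      rw [ae_dirac_iff (measurableSet_Ici)]; exact hτ.le) hv hv' F
  have hd : ∀ η, ∫ t, Real.exp (-(4 * Real.pi ^ 2 * t * ‖P η‖ ^ 2))
      ∂(ENNReal.ofReal (τ ^ (-a) * Real.exp (-τ)) • Measure.dirac τ) =
      τ ^ (-a) * Real.exp (-(lamSymbol P η * τ)) := by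
    intro η
    rw [integral_smul_measure, integral_dirac, ENNReal.toReal_ofReal (by positivity), smul_eq_mul,
      mul_assoc, ← Real.exp_add, lamSymbol]
    congr 2; ring
  simp_rw [hd] at h2
  have hm1 : ∫ t in Set.Ioc 0 τ, t ^ (-a) = τ ^ (1 - a) * (1 - a)⁻¹ := by
    rw [← intervalIntegral.integral_of_le hτ.le, integral_rpow (Or.inl (by linarith))]
    rw [Real.zero_rpow (by linarith), sub_zero, neg_add_eq_sub]; rfl
  have hm3 : ∫ t in Set.Ioi τ, a * t ^ (-a - 1) = τ ^ (-a) := by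
    rw [integral_const_mul, integral_Ioi_rpow_of_lt (by linarith) hτ]
    have : -a - 1 + 1 = -a := by ring
    rw [this]; field_simp
  rw [hm1] at h1
  rw [hm3] at h3
  have hm2 : (ENNReal.ofReal (τ ^ (-a) * Real.exp (-τ)) • Measure.dirac τ) Set.univ ≤
      ENNReal.ofReal (τ ^ (-a)) := by
    simp only [Measure.smul_apply, measure_univ, smul_eq_mul, mul_one]
    refine ENNReal.ofReal_le_ofReal (mul_le_of_le_one_right (by positivity) ?_)
    exact Real.exp_le_one_iff.2 (by linarith)
  have h2' := h2.2.trans (mul_le_mul_left hm2 _)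
  have hint : ∀ H : V → ℂ, (∀ x, Integrable (fun η => wave (inner ℝ η x) * H η)) →
      AEStronglyMeasurable (fun x => ∫ η, wave (inner ℝ η x) * H η) volume := fun H hH =>
    (continuous_integral_wave_mul (by simpa using hH 0)).aestronglyMeasurable
  have hm1' := hint _ h1.1
  have hm2' := hint _ h2.1
  have hm3' := hint _ h3.1
  have hrep : (⇑(SchwartzMap.fourierMultiplierCLM ℂ (fun η => ((lamSymbol P η ^ a : ℝ) : ℂ)) F)) =
      (c : ℂ) • (((fun x => ∫ η, wave (inner ℝ η x) *
        (((∫ t in Set.Ioc 0 τ, t ^ (-a) * Real.exp (-(lamSymbol P η * t)) : ℝ) : ℂ) * 𝓕 G η)) +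
        fun x => ∫ η, wave (inner ℝ η x) *
          (((τ ^ (-a) * Real.exp (-(lamSymbol P η * τ)) : ℝ) : ℂ) * 𝓕 F η)) -
        fun x => ∫ η, wave (inner ℝ η x) *
          (((∫ t in Set.Ioi τ, a * t ^ (-a - 1) * Real.exp (-(lamSymbol P η * t)) : ℝ) : ℂ) *
            𝓕 F η)) := by
    funext x
    simp only [Pi.smul_apply, Pi.sub_apply, Pi.add_apply, smul_eq_mul]
    have hadd := (h1.1 x).add (h2.1 x)
    simp only [Pi.add_def] at hadd
    rw [← integral_add (h1.1 x) (h2.1 x), ← integral_sub hadd (h3.1 x),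
      ← integral_const_mul, fourierMultiplier_eq_integral (lamSymbol_rpow_hasTemperateGrowth P a)]
    refine integral_congr_ae (Filter.Eventually.of_forall fun η => ?_)
    have hid := Gamma_mul_rpow_eq ha ha1 hτ (zero_lt_one.trans_le (one_le_lamSymbol P η))
    have hpow : lamSymbol P η ^ a = c * (lamSymbol P η *
        (∫ t in Set.Ioc 0 τ, t ^ (-a) * Real.exp (-(lamSymbol P η * t))) +
        τ ^ (-a) * Real.exp (-(lamSymbol P η * τ)) -
        ∫ t in Set.Ioi τ, a * t ^ (-a - 1) * Real.exp (-(lamSymbol P η * t))) := by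
      rw [← hid, hc, inv_mul_cancel_left₀ (Real.Gamma_pos_of_pos (by linarith)).ne']
    simp only [hGF]
    rw [hpow]
    push_cast
    ring
  rw [hrep, eLpNorm_const_smul]
  have hsum := (eLpNorm_sub_le (hm1'.add hm2') hm3' hv).trans
    (add_le_add_left (eLpNorm_add_le hm1' hm2' hv) _)
  refine (mul_le_mul_right hsum _).trans ?_
  have hcn : ‖(c : ℂ)‖ₑ = ENNReal.ofReal c := by
    rw [← ofReal_norm, Complex.norm_real, Real.norm_of_nonneg hc0.le]
  rw [hcn]
  refine (mul_le_mul_right (add_le_add (add_le_add h1.2 h2') h3.2) _).trans ?_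
  have h1a : 0 ≤ (1 - a)⁻¹ := inv_nonneg.2 (by linarith)
  rw [ENNReal.ofReal_mul (by positivity)]
  have hC : (↑(Real.toNNReal (c * ((1 - a)⁻¹ + 2))) : ℝ≥0∞) =
      ENNReal.ofReal c * (ENNReal.ofReal (1 - a)⁻¹ + 2) := by
    change ENNReal.ofReal (c * ((1 - a)⁻¹ + 2)) = _
    rw [ENNReal.ofReal_mul hc0.le, ENNReal.ofReal_add h1a (by norm_num)]
    simp
  rw [hC, mul_assoc (ENNReal.ofReal c)]
  refine mul_le_mul_right ?_ (ENNReal.ofReal c)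
  set A := ENNReal.ofReal (τ ^ (1 - a)) * eLpNorm G v volume with hA
  set B := ENNReal.ofReal (τ ^ (-a)) * eLpNorm F v volume with hB
  have e1 : ENNReal.ofReal (τ ^ (1 - a)) * ENNReal.ofReal (1 - a)⁻¹ * eLpNorm G v volume =
      ENNReal.ofReal (1 - a)⁻¹ * A := by rw [hA]; ring
  rw [e1]
  calc ENNReal.ofReal (1 - a)⁻¹ * A + B + B = ENNReal.ofReal (1 - a)⁻¹ * A + 2 * B := by ring
    _ ≤ (ENNReal.ofReal (1 - a)⁻¹ + 2) * A + (ENNReal.ofReal (1 - a)⁻¹ + 2) * B := by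
        gcongr
        · exact le_self_add
        · exact le_add_self
    _ = _ := by ring

end Heat

/-! ### Sobolev norms of families at scale `1 / N` in one parameter -/

section Families

open LineDeriv

variable {l d n : ℕ}

/-- `param j` as a continuous linear map. -/
noncomputable def paramC (j : Fin d) : Freq l d n →L[ℝ] Block l n :=
  LinearMap.toContinuousLinearMap (paramL j)

@[simp] theorem paramC_apply (j : Fin d) (ξ : Freq l d n) : paramC j ξ = param j ξ := rfl

/-- The standard basis vectors of frequency space. -/
noncomputable def basisVec (a : Fin l × Fin d × Fin n) : Freq l d n := EuclideanSpace.single a 1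

/-- Iterated partial derivative along a list of coordinates. -/
noncomputable def dList : List (Fin l × Fin d × Fin n) → 𝓢(Freq l d n, ℂ) → 𝓢(Freq l d n, ℂ)
  | [], F => F
  | a :: L, F => dList L (∂_{basisVec a} F)

/-- The number of derivatives in a list that fall on the block `j₀`. -/
def blockCount (j₀ : Fin d) (L : List (Fin l × Fin d × Fin n)) : ℕ :=
  L.countP (fun a => a.2.1 = j₀)

/-- A sequence of functions whose `j₀`-th block lives at scale `1 / N`: every derivative in the block
`j₀` costs a factor `N`, all other derivatives are free, and `β` is the size of the functions
themselves, everything being measured in `L^v`. -/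
def ScaledFamily (j₀ : Fin d) (v : ℝ≥0∞) (F : ℕ → 𝓢(Freq l d n, ℂ)) (β : ℕ → ℝ≥0∞) : Prop :=
  ∀ L, ∃ C : ℝ≥0, ∀ N : ℕ, 1 ≤ N →
    eLpNorm (dList L (F N)) v volume ≤ C * β N * ENNReal.ofReal ((N : ℝ) ^ blockCount j₀ L)

/-- The Fourier multiplier with symbol `(1 + 4π²|ξ^j|²)^σ`. -/
noncomputable def lamMul (j : Fin d) (σ : ℝ) : 𝓢(Freq l d n, ℂ) →L[ℂ] 𝓢(Freq l d n, ℂ) :=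
  SchwartzMap.fourierMultiplierCLM ℂ (fun η => ((lamSymbol (paramC j) η ^ σ : ℝ) : ℂ))

theorem multiplier_comm_lineDeriv {g : Freq l d n → ℂ} (hg : g.HasTemperateGrowth)
    (m : Freq l d n) (F : 𝓢(Freq l d n, ℂ)) :
    ∂_{m} (SchwartzMap.fourierMultiplierCLM ℂ g F) =
      SchwartzMap.fourierMultiplierCLM ℂ g (∂_{m} F) := by
  apply (FourierTransform.fourierEquiv ℂ 𝓢(Freq l d n, ℂ)).injective
  simp only [FourierTransform.fourierEquiv_apply, SchwartzMap.fourier_lineDerivOp_eq,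
    SchwartzMap.fourierMultiplierCLM_apply, FourierTransform.fourier_fourierInv_eq]
  ext η
  have hm : (fun x : Freq l d n => inner ℝ x m).HasTemperateGrowth := by fun_prop
  simp only [smul_apply, SchwartzMap.smulLeftCLM_apply_apply hg,
    SchwartzMap.smulLeftCLM_apply_apply hm]
  simp only [smul_eq_mul, Complex.real_smul]
  ring

theorem dList_multiplier {g : Freq l d n → ℂ} (hg : g.HasTemperateGrowth)
    (L : List (Fin l × Fin d × Fin n)) (F : 𝓢(Freq l d n, ℂ)) :
    dList L (SchwartzMap.fourierMultiplierCLM ℂ g F) =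
      SchwartzMap.fourierMultiplierCLM ℂ g (dList L F) := by
  induction L generalizing F with
  | nil => rfl
  | cons a L ih => rw [dList, multiplier_comm_lineDeriv hg, ih, dList]

theorem dList_add (L : List (Fin l × Fin d × Fin n)) (F G : 𝓢(Freq l d n, ℂ)) :
    dList L (F + G) = dList L F + dList L G := by
  induction L generalizing F G with
  | nil => rfl
  | cons a L ih => simp only [dList, lineDerivOp_add, ih]

theorem dList_neg (L : List (Fin l × Fin d × Fin n)) (F : 𝓢(Freq l d n, ℂ)) :
    dList L (-F) = -dList L F := by
  induction L generalizing F with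
  | nil => rfl
  | cons a L ih => simp only [dList, lineDerivOp_neg, ih]

theorem dList_zero (L : List (Fin l × Fin d × Fin n)) :
    dList L (0 : 𝓢(Freq l d n, ℂ)) = 0 := by
  induction L with
  | nil => rfl
  | cons a L ih => simp only [dList, lineDerivOp_zero, ih]

theorem dList_sum {ι : Type*} (t : Finset ι) (L : List (Fin l × Fin d × Fin n))
    (F : ι → 𝓢(Freq l d n, ℂ)) : dList L (∑ i ∈ t, F i) = ∑ i ∈ t, dList L (F i) := by
  classical
  induction t using Finset.induction_on with
  | empty => simp [dList_zero]
  | insert a t ha ih => rw [Finset.sum_insert ha, Finset.sum_insert ha, dList_add, ih]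

theorem param_norm_sq (j : Fin d) (η : Freq l d n) :
    ‖param j η‖ ^ 2 = ∑ a : Fin l × Fin n, η (a.1, j, a.2) ^ 2 := by
  rw [EuclideanSpace.norm_sq_eq]
  simp [param]

/-- On the block `j`, the operator with symbol `1 + 4π²|ξ^j|²` is `1 - Δ_j`. -/
theorem lamMul_one (j : Fin d) (F : 𝓢(Freq l d n, ℂ)) :
    lamMul j 1 F = F + -∑ a : Fin l × Fin n,
      ∂_{basisVec (a.1, j, a.2)} (∂_{basisVec (a.1, j, a.2)} F) := by
  have hFT : ∀ a : Fin l × Fin d × Fin n, ∀ η : Freq l d n,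
      𝓕 (∂_{basisVec a} (∂_{basisVec a} F)) η = -(4 * Real.pi ^ 2 * (η a) ^ 2 : ℝ) * 𝓕 F η := by
    intro a η
    have hm : (fun x : Freq l d n => inner ℝ x (basisVec a)).HasTemperateGrowth := by fun_prop
    have hi : inner ℝ η (basisVec a) = η a := by
      simp [basisVec, EuclideanSpace.inner_single_right]
    simp only [SchwartzMap.fourier_lineDerivOp_eq, smul_apply,
      SchwartzMap.smulLeftCLM_apply_apply hm, hi, smul_eq_mul, Complex.real_smul]
    push_cast
    linear_combination (4 * Real.pi ^ 2 * (η a) ^ 2 * 𝓕 F η : ℂ) * Complex.I_sq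
  apply (FourierTransform.fourierEquiv ℂ 𝓢(Freq l d n, ℂ)).injective
  ext η
  have hg := lamSymbol_rpow_hasTemperateGrowth (paramC (l := l) (n := n) j) 1
  rw [map_add, map_neg, map_sum]
  simp only [FourierTransform.fourierEquiv_apply, lamMul, SchwartzMap.fourierMultiplierCLM_apply,
    FourierTransform.fourier_fourierInv_eq, SchwartzMap.smulLeftCLM_apply_apply hg,
    add_apply, neg_apply, sum_apply, hFT]
  rw [← Finset.sum_mul, Real.rpow_one, lamSymbol, paramC_apply, param_norm_sq]
  simp only [smul_eq_mul]
  push_cast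
  rw [Finset.sum_neg_distrib, Finset.mul_sum]
  ring

/-- The scale of the block `j`: `N` on the distinguished block and `1` elsewhere. -/
def blockScale (j₀ j : Fin d) (N : ℕ) : ℝ := if j = j₀ then N else 1

theorem blockScale_pos {j₀ j : Fin d} {N : ℕ} (hN : 1 ≤ N) : 0 < blockScale j₀ j N := by
  unfold blockScale; split_ifs
  · exact_mod_cast hN
  · exact one_pos

theorem one_le_blockScale {j₀ j : Fin d} {N : ℕ} (hN : 1 ≤ N) : 1 ≤ blockScale j₀ j N := by
  unfold blockScale; split_ifs
  · exact_mod_cast hN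
  · exact le_rfl

theorem pow_blockCount_cons_cons (j₀ : Fin d) (N : ℕ) (a : Fin l × Fin d × Fin n)
    (L : List (Fin l × Fin d × Fin n)) :
    (N : ℝ) ^ blockCount j₀ (a :: a :: L) =
      blockScale j₀ a.2.1 N ^ (2 : ℝ) * (N : ℝ) ^ blockCount j₀ L := by
  unfold blockCount blockScale
  by_cases h : a.2.1 = j₀
  · simp only [List.countP_cons, h, decide_true, if_true, Real.rpow_two]; ring
  · simp [h]

theorem ScaledFamily.congr_weight {j₀ : Fin d} {v : ℝ≥0∞} {F : ℕ → 𝓢(Freq l d n, ℂ)}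
    {β β' : ℕ → ℝ≥0∞} (hF : ScaledFamily j₀ v F β) (h : ∀ N, 1 ≤ N → β N ≤ β' N) :
    ScaledFamily j₀ v F β' := by
  intro L
  obtain ⟨C, hC⟩ := hF L
  refine ⟨C, fun N hN => (hC N hN).trans ?_⟩
  gcongr
  exact h N hN

theorem ScaledFamily.lamMul_one {j₀ : Fin d} {v : ℝ≥0∞} (hv : 1 ≤ v)
    {F : ℕ → 𝓢(Freq l d n, ℂ)} {β : ℕ → ℝ≥0∞} (hF : ScaledFamily j₀ v F β) (j : Fin d) :
    ScaledFamily j₀ v (fun N => lamMul j 1 (F N))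
      (fun N => β N * ENNReal.ofReal (blockScale j₀ j N ^ (2 : ℝ))) := by
  intro L
  obtain ⟨C, hC⟩ := hF L
  choose D hD using fun a : Fin l × Fin n => hF ((a.1, j, a.2) :: (a.1, j, a.2) :: L)
  refine ⟨C + ∑ a, D a, fun N hN => ?_⟩
  dsimp only
  rw [MultiParam.lamMul_one, dList_add, dList_neg, dList_sum]
  set X := β N * ENNReal.ofReal (blockScale j₀ j N ^ (2 : ℝ)) *
    ENNReal.ofReal ((N : ℝ) ^ blockCount j₀ L) with hX
  have h1 : eLpNorm (dList L (F N)) v volume ≤ C * X := by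
    refine (hC N hN).trans ?_
    have : (1 : ℝ≥0∞) ≤ ENNReal.ofReal (blockScale j₀ j N ^ (2 : ℝ)) := by
      rw [ENNReal.one_le_ofReal]
      exact Real.one_le_rpow (one_le_blockScale hN) (by norm_num)
    rw [hX, mul_assoc]
    gcongr
    exact le_mul_of_one_le_right' this
  have h2 : ∀ a : Fin l × Fin n, eLpNorm (dList L (∂_{basisVec (a.1, j, a.2)}
      (∂_{basisVec (a.1, j, a.2)} (F N)))) v volume ≤ D a * X := by
    intro a
    refine (hD a N hN).trans (le_of_eq ?_)
    rw [pow_blockCount_cons_cons, ENNReal.ofReal_mul (by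
      exact Real.rpow_nonneg (blockScale_pos hN).le _), hX]
    ring
  have h3 : eLpNorm (⇑(∑ a : Fin l × Fin n, dList L (∂_{basisVec (a.1, j, a.2)}
      (∂_{basisVec (a.1, j, a.2)} (F N))))) v volume ≤ ∑ a, D a * X := by
    have e : (⇑(∑ a : Fin l × Fin n, dList L (∂_{basisVec (a.1, j, a.2)}
      (∂_{basisVec (a.1, j, a.2)} (F N))))) = ∑ a : Fin l × Fin n,
        ⇑(dList L (∂_{basisVec (a.1, j, a.2)} (∂_{basisVec (a.1, j, a.2)} (F N)))) := by
      ext x; simp [sum_apply]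
    rw [e]
    refine (eLpNorm_sum_le (fun a _ => SchwartzMap.continuous _ |>.aestronglyMeasurable) hv).trans ?_
    exact Finset.sum_le_sum fun a _ => h2 a
  have e : ∀ A B : 𝓢(Freq l d n, ℂ), ⇑(A + -B) = ⇑A - ⇑B := by
    intro A B; ext x; simp [sub_eq_add_neg]
  rw [e]
  refine (eLpNorm_sub_le (SchwartzMap.continuous _).aestronglyMeasurable
    (SchwartzMap.continuous _).aestronglyMeasurable hv).trans ?_
  refine (add_le_add h1 h3).trans (le_of_eq ?_)
  rw [← Finset.sum_mul]
  push_cast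
  rw [mul_assoc, ← hX]
  ring

theorem lamMul_hasTemperateGrowth (j : Fin d) (σ : ℝ) :
    (fun η : Freq l d n => ((lamSymbol (paramC j) η ^ σ : ℝ) : ℂ)).HasTemperateGrowth :=
  lamSymbol_rpow_hasTemperateGrowth _ _

/-- `eLpNorm_fractional_le` with `τ = N⁻²`, which balances its two terms. -/
theorem ScaledFamily.lamMul_frac {j₀ : Fin d} {v : ℝ≥0∞} (hv : 1 ≤ v) (hv' : v ≠ ∞)
    {F : ℕ → 𝓢(Freq l d n, ℂ)} {β : ℕ → ℝ≥0∞} (hF : ScaledFamily j₀ v F β) (j : Fin d)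
    {a : ℝ} (ha : 0 < a) (ha1 : a < 1) :
    ScaledFamily j₀ v (fun N => lamMul j a (F N))
      (fun N => β N * ENNReal.ofReal (blockScale j₀ j N ^ (2 * a))) := by
  intro L
  obtain ⟨C, hC⟩ := hF L
  obtain ⟨D, hD⟩ := hF.lamMul_one hv j L
  obtain ⟨K, hK⟩ := eLpNorm_fractional_le (V := Freq l d n) (paramC j) ha ha1
  refine ⟨K * (D + C), fun N hN => ?_⟩
  have hb := blockScale_pos (j₀ := j₀) (j := j) hN
  have h1 := hK v hv hv' (blockScale j₀ j N ^ (-2 : ℝ)) (Real.rpow_pos_of_pos hb _) (dList L (F N))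
  have hD' := hD N hN
  have hC' := hC N hN
  simp only [lamMul] at hD' ⊢
  rw [dList_multiplier (lamMul_hasTemperateGrowth j 1)] at hD'
  rw [dList_multiplier (lamMul_hasTemperateGrowth j a)]
  refine h1.trans ?_
  rw [← Real.rpow_mul hb.le, ← Real.rpow_mul hb.le]
  refine (mul_le_mul_right (add_le_add (mul_le_mul_right hD' _) (mul_le_mul_right hC' _)) _).trans
    (le_of_eq ?_)
  have e1 : ENNReal.ofReal (blockScale j₀ j N ^ (-2 * (1 - a))) *
      ENNReal.ofReal (blockScale j₀ j N ^ (2 : ℝ)) =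
      ENNReal.ofReal (blockScale j₀ j N ^ (2 * a)) := by
    rw [← ENNReal.ofReal_mul (Real.rpow_nonneg hb.le _), ← Real.rpow_add hb]
    congr 2; ring
  have e2 : -2 * -a = 2 * a := by ring
  rw [e2]
  push_cast
  rw [mul_assoc (K : ℝ≥0∞), mul_assoc (K : ℝ≥0∞)]
  congr 1
  rw [← e1]
  ring

theorem lamMul_lamMul (j : Fin d) (σ τ : ℝ) (F : 𝓢(Freq l d n, ℂ)) :
    lamMul j σ (lamMul j τ F) = lamMul j (σ + τ) F := by
  rw [lamMul, lamMul, SchwartzMap.fourierMultiplierCLM_fourierMultiplierCLM_apply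
    (lamMul_hasTemperateGrowth j σ) (lamMul_hasTemperateGrowth j τ), lamMul]
  congr 2
  funext η
  rw [Pi.mul_apply, Real.rpow_add (zero_lt_one.trans_le (one_le_lamSymbol _ _))]
  push_cast; rfl

theorem lamMul_zero (j : Fin d) (F : 𝓢(Freq l d n, ℂ)) : lamMul j 0 F = F := by
  simp [lamMul]

/-- Every power of `1 - Δ_j` costs the corresponding power of the scale: the integer part of `σ` is
iterated through `ScaledFamily.lamMul_one`, the fractional part is interpolated. -/
theorem ScaledFamily.lamMul {j₀ : Fin d} {v : ℝ≥0∞} (hv : 1 ≤ v) (hv' : v ≠ ∞)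
    {F : ℕ → 𝓢(Freq l d n, ℂ)} {β : ℕ → ℝ≥0∞} (hF : ScaledFamily j₀ v F β) (j : Fin d)
    {σ : ℝ} (hσ : 0 ≤ σ) :
    ScaledFamily j₀ v (fun N => lamMul j σ (F N))
      (fun N => β N * ENNReal.ofReal (blockScale j₀ j N ^ (2 * σ))) := by
  have main : ∀ (k : ℕ) (a : ℝ), 0 ≤ a → a < 1 →
      ScaledFamily j₀ v (fun N => MultiParam.lamMul j (k + a) (F N))
      (fun N => β N * ENNReal.ofReal (blockScale j₀ j N ^ (2 * (k + a)))) := by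
    intro k a ha ha1
    induction k with
    | zero =>
      rcases ha.eq_or_lt with rfl | ha
      · simpa [lamMul_zero] using hF
      · simpa using hF.lamMul_frac hv hv' j ha ha1
    | succ k ih =>
      have h := ih.lamMul_one hv j
      simp_rw [lamMul_lamMul] at h
      have e : (1 : ℝ) + (k + a) = ((k + 1 : ℕ) : ℝ) + a := by push_cast; ring
      rw [e] at h
      refine h.congr_weight fun N hN => le_of_eq ?_
      rw [mul_assoc, ← ENNReal.ofReal_mul (Real.rpow_nonneg (blockScale_pos hN).le _),
        ← Real.rpow_add (blockScale_pos hN)]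
      congr 3; push_cast; ring
  have := main ⌊σ⌋₊ (σ - ⌊σ⌋₊) (sub_nonneg.2 (Nat.floor_le hσ))
    (by linarith [Nat.lt_floor_add_one σ])
  simpa using this

/-- The operator `∏_j (1 + 4π²|·|²)^{s_j/2}` on Schwartz functions. -/
noncomputable def lift (s : Fin d → ℝ) : 𝓢(Freq l d n, ℂ) →L[ℂ] 𝓢(Freq l d n, ℂ) :=
  SchwartzMap.fourierMultiplierCLM ℂ (fun ξ => (besselSymbol s ξ : ℂ))

/-- A family with `j₀`-th block at scale `1 / N` loses at most `N ^ s_{j₀}` in the `d`-parameter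
Sobolev norm: the other parameters contribute bounded factors. -/
theorem ScaledFamily.lift {j₀ : Fin d} {v : ℝ≥0∞} (hv : 1 ≤ v) (hv' : v ≠ ∞)
    {F : ℕ → 𝓢(Freq l d n, ℂ)} {β : ℕ → ℝ≥0∞} (hF : ScaledFamily j₀ v F β) {s : Fin d → ℝ}
    (hs : ∀ j, 0 ≤ s j) :
    ∃ C : ℝ≥0, ∀ N : ℕ, 1 ≤ N → eLpNorm (lift s (F N)) v volume ≤
      C * β N * ENNReal.ofReal ((N : ℝ) ^ s j₀) := by
  classical
  have hg : ∀ t : Finset (Fin d), (fun η : Freq l d n =>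
      ((∏ j ∈ t, lamSymbol (paramC j) η ^ (s j / 2) : ℝ) : ℂ)).HasTemperateGrowth := by
    intro t
    induction t using Finset.induction_on with
    | empty => simp only [Finset.prod_empty]; exact Function.HasTemperateGrowth.const _
    | insert j t ha ih =>
      simp only [Finset.prod_insert ha, Complex.ofReal_mul]
      exact (lamMul_hasTemperateGrowth j (s j / 2)).mul ih
  have main : ∀ t : Finset (Fin d), ScaledFamily j₀ v
      (fun N => SchwartzMap.fourierMultiplierCLM ℂ (fun η : Freq l d n =>
        ((∏ j ∈ t, lamSymbol (paramC j) η ^ (s j / 2) : ℝ) : ℂ)) (F N))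
      (fun N => β N * ENNReal.ofReal (∏ j ∈ t, blockScale j₀ j N ^ s j)) := by
    intro t
    induction t using Finset.induction_on with
    | empty => simpa using hF
    | insert j t ha ih =>
      have h := ih.lamMul hv hv' j (σ := s j / 2) (by linarith [hs j])
      have e : ∀ G : 𝓢(Freq l d n, ℂ), MultiParam.lamMul j (s j / 2)
          (SchwartzMap.fourierMultiplierCLM ℂ (fun η : Freq l d n =>
        ((∏ j ∈ t, lamSymbol (paramC j) η ^ (s j / 2) : ℝ) : ℂ)) G) =
          SchwartzMap.fourierMultiplierCLM ℂ (fun η : Freq l d n =>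
        ((∏ j ∈ insert j t, lamSymbol (paramC j) η ^ (s j / 2) : ℝ) : ℂ)) G := by
        intro G
        rw [MultiParam.lamMul, SchwartzMap.fourierMultiplierCLM_fourierMultiplierCLM_apply
          (lamMul_hasTemperateGrowth j _) (hg t)]
        congr 2
        funext η
        rw [Pi.mul_apply, Finset.prod_insert ha]
        push_cast; rfl
      simp_rw [e] at h
      refine h.congr_weight fun N hN => le_of_eq ?_
      rw [Finset.prod_insert ha, mul_assoc, ← ENNReal.ofReal_mul
        (Finset.prod_nonneg fun j _ => Real.rpow_nonneg (blockScale_pos hN).le _), mul_comm (∏ _ ∈ _, _)]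
      congr 4; ring
  obtain ⟨C, hC⟩ := main Finset.univ []
  refine ⟨C, fun N hN => ?_⟩
  have h := hC N hN
  have hprod : ∏ j, blockScale j₀ j N ^ s j = (N : ℝ) ^ s j₀ := by
    rw [Finset.prod_eq_single j₀]
    · simp [blockScale]
    · intro j _ hj; simp [blockScale, hj]
    · simp
  dsimp only at h
  rw [hprod] at h
  simp only [dList, blockCount, List.countP_nil, pow_zero, ENNReal.ofReal_one, mul_one] at h
  rw [mul_assoc]
  exact h

end Families

/-! ### Chirped and dilated families -/

section Stable

open LineDeriv
open scoped ContDiff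

variable {l d n : ℕ}

/-- A class of families that is closed under partial derivatives up to the expected powers of the
scale, and satisfies the size bound, consists of scaled families. -/
theorem scaledFamily_of_stable {j₀ : Fin d} {v : ℝ≥0∞} (hv : 1 ≤ v)
    (S : Set (ℕ → 𝓢(Freq l d n, ℂ))) (β : ℕ → ℝ≥0∞)
    (hbase : ∀ F ∈ S, ∃ C : ℝ≥0, ∀ N : ℕ, 1 ≤ N → eLpNorm (F N) v volume ≤ C * β N)
    (hstep : ∀ F ∈ S, ∀ a : Fin l × Fin d × Fin n, ∃ G₁ ∈ S, ∃ G₂ ∈ S, ∃ G₃ ∈ S,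
      ∀ N : ℕ, 1 ≤ N → ∂_{basisVec a} (F N) =
        G₁ N + G₂ N + ((if a.2.1 = j₀ then N else 1 : ℝ) : ℂ) • G₃ N) :
    ∀ F ∈ S, ScaledFamily j₀ v F β := by
  have hcs : ∀ (L : List (Fin l × Fin d × Fin n)) (c : ℂ) (F : 𝓢(Freq l d n, ℂ)),
      dList L (c • F) = c • dList L F := by
    intro L
    induction L with
    | nil => intros; rfl
    | cons a L ih => intro c F; simp only [dList, lineDerivOp_smul, ih]
  intro F hF L
  induction L generalizing F with
  | nil =>
    obtain ⟨C, hC⟩ := hbase F hF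
    exact ⟨C, fun N hN => by simpa [dList, blockCount] using hC N hN⟩
  | cons a L ih =>
    obtain ⟨G₁, h₁, G₂, h₂, G₃, h₃, hG⟩ := hstep F hF a
    obtain ⟨C₁, hC₁⟩ := ih G₁ h₁
    obtain ⟨C₂, hC₂⟩ := ih G₂ h₂
    obtain ⟨C₃, hC₃⟩ := ih G₃ h₃
    refine ⟨C₁ + C₂ + C₃, fun N hN => ?_⟩
    have hN1 : (1 : ℝ) ≤ N := by exact_mod_cast hN
    set c : ℝ := if a.2.1 = j₀ then N else 1 with hc
    have hc1 : 1 ≤ c := by rw [hc]; split_ifs; exacts [hN1, le_rfl]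
    have hcount : (N : ℝ) ^ blockCount j₀ (a :: L) = c * (N : ℝ) ^ blockCount j₀ L := by
      rw [hc]
      by_cases h : a.2.1 = j₀
      · simp only [blockCount, List.countP_cons, h, decide_true, if_true]; ring
      · simp [blockCount, h]
    rw [dList, hG N hN, dList_add, dList_add, hcs, hcount, ENNReal.ofReal_mul (by linarith)]
    set X := β N * ENNReal.ofReal ((N : ℝ) ^ blockCount j₀ L) with hX
    have hle : X ≤ ENNReal.ofReal c * X :=
      le_mul_of_one_le_left' (by rwa [ENNReal.one_le_ofReal])
    have e : ⇑(dList L (G₁ N) + dList L (G₂ N) + (c : ℂ) • dList L (G₃ N)) =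
        (⇑(dList L (G₁ N)) + ⇑(dList L (G₂ N))) + (c : ℂ) • ⇑(dList L (G₃ N)) := by
      ext x; simp
    rw [e]
    have hm : ∀ G : 𝓢(Freq l d n, ℂ), AEStronglyMeasurable (⇑G) volume :=
      fun G => G.continuous.aestronglyMeasurable
    refine (eLpNorm_add_le ((hm _).add (hm _)) ((hm _).const_smul _) hv).trans ?_
    refine (add_le_add (eLpNorm_add_le (hm _) (hm _) hv) le_rfl).trans ?_
    rw [eLpNorm_const_smul]
    have hcn : ‖(c : ℂ)‖ₑ = ENNReal.ofReal c := by
      rw [← ofReal_norm, Complex.norm_real, Real.norm_of_nonneg (by linarith)]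
    rw [hcn]
    have b₁ := hC₁ N hN
    have b₂ := hC₂ N hN
    have b₃ := hC₃ N hN
    rw [mul_assoc, ← hX] at b₁ b₂ b₃
    calc _ ≤ C₁ * X + C₂ * X + ENNReal.ofReal c * (C₃ * X) :=
          add_le_add (add_le_add b₁ b₂) (mul_le_mul_right b₃ _)
      _ ≤ C₁ * (ENNReal.ofReal c * X) + C₂ * (ENNReal.ofReal c * X) +
          ENNReal.ofReal c * (C₃ * X) := by gcongr
      _ = _ := by rw [hX]; push_cast; ring

/-- The product of a smooth function and a compactly supported Schwartz function. -/
noncomputable def mulCS {V : Type*} [NormedAddCommGroup V] [NormedSpace ℝ V] (g : V → ℂ)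
    (hg : ContDiff ℝ ∞ g) (X : 𝓢(V, ℂ)) (hX : HasCompactSupport X) : 𝓢(V, ℂ) :=
  (hX.mul_left (f := g)).toSchwartzMap (hg.mul (X.smooth _))

@[simp] theorem mulCS_apply {V : Type*} [NormedAddCommGroup V] [NormedSpace ℝ V] {g : V → ℂ}
    (hg : ContDiff ℝ ∞ g) (X : 𝓢(V, ℂ)) (hX : HasCompactSupport X) (x : V) :
    mulCS g hg X hX x = g x * X x := rfl

theorem hasCompactSupport_mulCS {V : Type*} [NormedAddCommGroup V] [NormedSpace ℝ V] {g : V → ℂ}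
    (hg : ContDiff ℝ ∞ g) (X : 𝓢(V, ℂ)) (hX : HasCompactSupport X) :
    HasCompactSupport (mulCS g hg X hX) := hX.mul_left (f := g)

theorem hasCompactSupport_lineDeriv {X : 𝓢(Freq l d n, ℂ)} (hX : HasCompactSupport X)
    (m : Freq l d n) : HasCompactSupport (∂_{m} X : 𝓢(Freq l d n, ℂ)) :=
  hX.mono' ((subset_tsupport _).trans (SchwartzMap.tsupport_lineDerivOp_subset m X))

/-- Families `e^{iNθ} X` with a phase `θ` that depends on the block `j₀` only: no other derivative produces
a factor `N`. -/
theorem scaledFamily_chirp {j₀ : Fin d} {v : ℝ≥0∞} (hv : 1 ≤ v) {θ : Freq l d n → ℝ}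
    (hθ : ContDiff ℝ ∞ θ)
    (hθ0 : ∀ a : Fin l × Fin d × Fin n, a.2.1 ≠ j₀ → ∀ ξ, fderiv ℝ θ ξ (basisVec a) = 0)
    {F : ℕ → 𝓢(Freq l d n, ℂ)} {X : 𝓢(Freq l d n, ℂ)} (hX : HasCompactSupport X)
    (hF : ∀ N ξ, F N ξ = Complex.exp (((N * θ ξ : ℝ) : ℂ) * Complex.I) * X ξ) :
    ScaledFamily j₀ v F (fun _ => 1) := by
  have hsm : ∀ N : ℕ, ContDiff ℝ ∞ (fun ξ => Complex.exp (((N * θ ξ : ℝ) : ℂ) * Complex.I)) := by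
    intro N
    exact ((Complex.ofRealCLM.contDiff.comp (contDiff_const.mul hθ)).mul contDiff_const).cexp
  refine scaledFamily_of_stable hv {F | ∃ X : 𝓢(Freq l d n, ℂ), HasCompactSupport X ∧
    ∀ N ξ, F N ξ = Complex.exp (((N * θ ξ : ℝ) : ℂ) * Complex.I) * X ξ} _ ?_ ?_ F ⟨X, hX, hF⟩
  · rintro F ⟨X, hX, hF⟩
    refine ⟨(eLpNorm X v volume).toNNReal, fun N _ => ?_⟩
    rw [ENNReal.coe_toNNReal (X.memLp v volume).2.ne, mul_one]
    refine le_of_eq (eLpNorm_congr_norm_ae (Filter.Eventually.of_forall fun ξ => ?_))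
    rw [hF, norm_mul, Complex.norm_exp_ofReal_mul_I, one_mul]
  · rintro F ⟨X, hX, hF⟩ a
    have hmem : ∀ Y : 𝓢(Freq l d n, ℂ), ∀ hY : HasCompactSupport Y,
        (fun N : ℕ => mulCS _ (hsm N) Y hY) ∈ {F : ℕ → 𝓢(Freq l d n, ℂ) | ∃ X : 𝓢(Freq l d n, ℂ),
          HasCompactSupport X ∧
          ∀ N ξ, F N ξ = Complex.exp (((N * θ ξ : ℝ) : ℂ) * Complex.I) * X ξ} :=
      fun Y hY => ⟨Y, hY, fun N ξ => rfl⟩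
    have hθ' : ContDiff ℝ ∞ (fun ξ => ((fderiv ℝ θ ξ (basisVec a) : ℝ) : ℂ) * Complex.I) :=
      (Complex.ofRealCLM.contDiff.comp
        ((hθ.fderiv_right (m := ∞) (by simp)).clm_apply contDiff_const)).mul contDiff_const
    have hX' := hasCompactSupport_lineDeriv hX (basisVec a)
    have hY := hasCompactSupport_mulCS hθ' X hX
    have h0 : HasCompactSupport (0 : 𝓢(Freq l d n, ℂ)) := HasCompactSupport.zero
    -- `∂_a (e^{iNθ} X) = e^{iNθ} ∂_a X + N e^{iNθ} (i ∂_a θ) X`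
    refine ⟨_, hmem _ hX', _, hmem _ h0, _, hmem _ hY, fun N hN => ?_⟩
    ext ξ
    have hFN : ⇑(F N) = fun ξ => Complex.exp (((N * θ ξ : ℝ) : ℂ) * Complex.I) * X ξ :=
      funext (hF N)
    rw [SchwartzMap.lineDerivOp_apply_eq_fderiv, hFN]
    have d1 : HasFDerivAt θ (fderiv ℝ θ ξ) ξ :=
      (hθ.differentiable (by simp)).differentiableAt.hasFDerivAt
    have d2 := ((Complex.ofRealCLM.hasFDerivAt (x := N * θ ξ)).comp ξ
      (d1.const_mul (N : ℝ))).mul_const Complex.I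
    have d3 := d2.cexp.mul (X.differentiableAt (x := ξ)).hasFDerivAt
    have d4 := d3.fderiv
    simp only [Function.comp_def, Complex.ofRealCLM_apply] at d4
    rw [show (fun ξ => Complex.exp (((N * θ ξ : ℝ) : ℂ) * Complex.I) * X ξ) =
      ((fun ξ => Complex.exp (((N * θ ξ : ℝ) : ℂ) * Complex.I)) * fun ξ => X ξ) from rfl]
    rw [d4]
    simp only [add_apply, smul_apply, mulCS_apply, SchwartzMap.lineDerivOp_apply_eq_fderiv,
      ContinuousLinearMap.comp_apply, Complex.ofRealCLM_apply, smul_eq_mul, zero_apply]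
    by_cases ha : a.2.1 = j₀
    · simp only [ha, if_true]; push_cast
      ring
    · simp only [ha, if_false, hθ0 a ha]; push_cast
      ring

theorem eLpNorm_comp_linear_sub {V : Type*} [NormedAddCommGroup V] [InnerProductSpace ℝ V]
    [FiniteDimensional ℝ V] [MeasurableSpace V] [BorelSpace V] (L : V →L[ℝ] V)
    (hL : LinearMap.det (L : V →ₗ[ℝ] V) ≠ 0) (b : V) {w : V → ℂ}
    (hw : Continuous w) {v : ℝ≥0∞} (hv' : v ≠ ⊤) :
    eLpNorm (fun ξ => w (L ξ - b)) v volume =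
      ENNReal.ofReal (|LinearMap.det (L : V →ₗ[ℝ] V)| ^ (-(1 / v.toReal))) *
        eLpNorm w v volume := by
  have h1 : eLpNorm (fun ξ => w (L ξ - b)) v volume =
      eLpNorm (fun ξ => w (ξ - b)) v (Measure.map L volume) := by
    rw [eLpNorm_map_measure _ L.continuous.aemeasurable]
    · rfl
    · exact (hw.comp (continuous_id.sub continuous_const)).aestronglyMeasurable
  have h2 : Measure.map L (volume : Measure V) =
      ENNReal.ofReal |(LinearMap.det (L : V →ₗ[ℝ] V))⁻¹| • volume :=
    Measure.map_linearMap_addHaar_eq_smul_addHaar volume hL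
  have h3 : eLpNorm (fun ξ => w (ξ - b)) v volume = eLpNorm w v volume :=
    eLpNorm_comp_measurePreserving hw.aestronglyMeasurable (measurePreserving_sub_right volume b)
  rw [h1, h2, eLpNorm_smul_measure_of_ne_top hv', h3, smul_eq_mul, abs_inv,
    ENNReal.ofReal_rpow_of_nonneg (by positivity) (by positivity), Real.rpow_neg (abs_nonneg _),
    Real.inv_rpow (abs_nonneg _)]
  simp

/-- Families `w(L_N ξ - b_N) X(ξ)`, where `L_N` expands `k` directions inside the block `j₀` by a
factor `N`: the volume of the region where they live is of order `N ^ (-k)`. -/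
theorem scaledFamily_dilate {j₀ : Fin d} {v : ℝ≥0∞} (hv : 1 ≤ v) (hv' : v ≠ ⊤)
    {L : ℕ → Freq l d n →L[ℝ] Freq l d n} (b : ℕ → Freq l d n) {c : ℝ} (hc : 0 < c) (k : ℕ)
    (hdet : ∀ N : ℕ, 1 ≤ N →
      |LinearMap.det (L N : Freq l d n →ₗ[ℝ] Freq l d n)| = c * (N : ℝ) ^ k)
    (hL : ∀ a : Fin l × Fin d × Fin n, ∃ y z : Freq l d n, (a.2.1 ≠ j₀ → z = 0) ∧
      ∀ N : ℕ, 1 ≤ N → L N (basisVec a) = y + (N : ℝ) • z)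
    {F : ℕ → 𝓢(Freq l d n, ℂ)} {w X : 𝓢(Freq l d n, ℂ)} (hX : HasCompactSupport X)
    (hF : ∀ N ξ, F N ξ = w (L N ξ - b N) * X ξ) :
    ScaledFamily j₀ v F (fun N => ENNReal.ofReal ((N : ℝ) ^ (-(k / v.toReal)))) := by
  have hsm : ∀ (w : 𝓢(Freq l d n, ℂ)) (N : ℕ), ContDiff ℝ ∞ (fun ξ => w (L N ξ - b N)) := by
    intro w N
    exact (w.smooth ⊤).comp ((L N).contDiff.sub contDiff_const)
  refine scaledFamily_of_stable hv {F | ∃ w X : 𝓢(Freq l d n, ℂ), HasCompactSupport X ∧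
    ∀ N ξ, F N ξ = w (L N ξ - b N) * X ξ} _ ?_ ?_ F ⟨w, X, hX, hF⟩
  · rintro F ⟨w, X, hX, hF⟩
    obtain ⟨M, hM⟩ : ∃ M : ℝ≥0, ∀ ξ, ‖X ξ‖ ≤ M :=
      ⟨Real.toNNReal (SchwartzMap.seminorm ℝ 0 0 X), fun ξ =>
        (SchwartzMap.norm_le_seminorm ℝ X ξ).trans (Real.le_coe_toNNReal _)⟩
    refine ⟨M * (Real.toNNReal (c ^ (-(1 / v.toReal))) * (eLpNorm w v volume).toNNReal),
      fun N hN => ?_⟩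
    have hN0 : (0 : ℝ) < N := by exact_mod_cast hN
    have h1 := eLpNorm_comp_linear_sub (L N) (by
      rw [← abs_pos, hdet N hN]; positivity) (b N) w.continuous hv'
    have h2 : eLpNorm (F N) v volume ≤
        M * eLpNorm (fun ξ => w (L N ξ - b N)) v volume := by
      refine (eLpNorm_le_nnreal_smul_eLpNorm_of_ae_le_mul (Filter.Eventually.of_forall fun ξ => ?_) v)
      rw [hF, ← NNReal.coe_le_coe]
      push_cast
      rw [norm_mul, mul_comm]
      exact mul_le_mul_of_nonneg_right (hM ξ) (norm_nonneg _)
    refine h2.trans (le_of_eq ?_)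
    rw [h1, hdet N hN, Real.mul_rpow hc.le (by positivity), ← Real.rpow_natCast_mul hN0.le,
      ENNReal.ofReal_mul (by positivity)]
    push_cast
    rw [ENNReal.coe_toNNReal (w.memLp v volume).2.ne]
    have e : (k : ℝ) * -(1 / v.toReal) = -(k / v.toReal) := by ring
    rw [e]
    simp only [ENNReal.ofReal]
    ring
  · rintro F ⟨w, X, hX, hF⟩ a
    have hmem : ∀ w Y : 𝓢(Freq l d n, ℂ), ∀ hY : HasCompactSupport Y,
        (fun N : ℕ => mulCS _ (hsm w N) Y hY) ∈ {F : ℕ → 𝓢(Freq l d n, ℂ) |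
          ∃ w X : 𝓢(Freq l d n, ℂ), HasCompactSupport X ∧
            ∀ N ξ, F N ξ = w (L N ξ - b N) * X ξ} :=
      fun w Y hY => ⟨w, Y, hY, fun N ξ => rfl⟩
    -- the chain rule gives `∂_y w + N ∂_z w` for `L_N e_a = y + N z`
    obtain ⟨y, z, hz, hyz⟩ := hL a
    refine ⟨_, hmem w _ (hasCompactSupport_lineDeriv hX (basisVec a)), _, hmem (∂_{y} w) X hX,
      _, hmem (∂_{z} w) X hX, fun N hN => ?_⟩
    ext ξ
    have hFN : ⇑(F N) = fun ξ => w (L N ξ - b N) * X ξ := funext (hF N)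
    rw [SchwartzMap.lineDerivOp_apply_eq_fderiv, hFN]
    have d1 : HasFDerivAt (fun ξ => L N ξ - b N) (L N) ξ := (L N).hasFDerivAt.sub_const _
    have d2 := ((w.differentiableAt (x := L N ξ - b N)).hasFDerivAt).comp ξ d1
    have d4 := (d2.mul (X.differentiableAt (x := ξ)).hasFDerivAt).fderiv
    rw [show (fun ξ => w (L N ξ - b N) * X ξ) = ((⇑w ∘ fun ξ => L N ξ - b N) * ⇑X) from rfl, d4]
    simp only [add_apply, smul_apply, mulCS_apply, SchwartzMap.lineDerivOp_apply_eq_fderiv,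
      ContinuousLinearMap.comp_apply, smul_eq_mul, hyz N hN, map_add, map_smul, Function.comp_apply,
      Complex.real_smul]
    by_cases ha : a.2.1 = j₀
    · simp only [ha, if_true]; push_cast
      ring
    · simp only [ha, if_false, hz ha, map_zero]; push_cast
      ring

end Stable

/-! ### Reduction to smooth symbols supported near one point -/

section Reduction

open scoped ContDiff

variable {l d n : ℕ}

theorem freq_norm_sq (ξ : Freq l d n) : ‖ξ‖ ^ 2 = ∑ j, ‖param j ξ‖ ^ 2 := by
  simp_rw [param_norm_sq]
  rw [EuclideanSpace.norm_sq_eq, Finset.sum_comm]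
  simp_rw [Real.norm_eq_abs, sq_abs]
  rw [Fintype.sum_prod_type, Fintype.sum_prod_type]
  refine Finset.sum_congr rfl fun i _ => ?_
  rw [Fintype.sum_prod_type, Finset.sum_comm]

theorem norm_param_le (j : Fin d) (ξ : Freq l d n) : ‖param j ξ‖ ≤ ‖ξ‖ := by
  refine le_of_sq_le_sq ?_ (norm_nonneg _)
  rw [freq_norm_sq]
  exact Finset.single_le_sum (f := fun j => ‖param j ξ‖ ^ 2) (fun _ _ => sq_nonneg _)
    (Finset.mem_univ j)

/-- `dilate` as a continuous linear map. -/
noncomputable def dilC (κ : Fin d → ℤ) : Freq l d n →L[ℝ] Freq l d n :=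
  LinearMap.toContinuousLinearMap
    { toFun := dilate κ
      map_add' := fun x y => by ext a; simp [dilate, mul_add]
      map_smul' := fun c x => by ext a; simp [dilate]; ring }

@[simp] theorem dilC_apply (κ : Fin d → ℤ) (ξ : Freq l d n) : dilC κ ξ = dilate κ ξ := rfl

theorem param_dilate (κ : Fin d → ℤ) (j : Fin d) (ξ : Freq l d n) :
    param j (dilate κ ξ) = (2 : ℝ) ^ κ j • param j ξ := by
  ext a; simp [param, dilate]

/-- A point whose blocks all have norm `1`. -/
noncomputable def basePoint (hl : 1 ≤ l) (hn : 1 ≤ n) : Freq l d n :=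
  WithLp.toLp 2 (fun a => if a.1 = ⟨0, hl⟩ ∧ a.2.2 = ⟨0, hn⟩ then 1 else 0)

theorem norm_param_basePoint (hl : 1 ≤ l) (hn : 1 ≤ n) (j : Fin d) :
    ‖param j (basePoint (l := l) (d := d) hl hn)‖ = 1 := by
  have h : ‖param j (basePoint (l := l) (d := d) hl hn)‖ ^ 2 = 1 := by
    rw [param_norm_sq, Finset.sum_eq_single (⟨0, hl⟩, ⟨0, hn⟩)]
    · simp [basePoint]
    · rintro ⟨i, r⟩ - h
      have : ¬ (i = ⟨0, hl⟩ ∧ r = ⟨0, hn⟩) := fun h' => h (Prod.ext h'.1 h'.2)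
      simp [basePoint, this]
    · simp
  nlinarith [norm_nonneg (param j (basePoint (l := l) (d := d) hl hn))]

/-- The localizing factor `∏_j Θ̂_j(ξ^j)` of `hormanderNorm`. -/
noncomputable def cutoff (Θ : Fin d → 𝓢(Block l n, ℂ)) (ξ : Freq l d n) : ℂ :=
  ∏ j, 𝓕 (Θ j) (param j ξ)

theorem contDiff_cutoff (Θ : Fin d → 𝓢(Block l n, ℂ)) :
    ContDiff ℝ ∞ (cutoff Θ : Freq l d n → ℂ) :=
  contDiff_prod fun j _ => ((𝓕 (Θ j)).smooth ⊤).comp (paramC j).contDiff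

theorem hasCompactSupport_cutoff {Θ : Fin d → 𝓢(Block l n, ℂ)}
    (hΘ : ∀ j ξ, 𝓕 (Θ j) ξ ≠ 0 → 1 / 2 ≤ ‖ξ‖ ∧ ‖ξ‖ ≤ 2) :
    HasCompactSupport (cutoff Θ : Freq l d n → ℂ) := by
  refine HasCompactSupport.intro (isCompact_closedBall 0 (2 * d)) fun ξ hξ => ?_
  by_contra hne
  refine hξ ?_
  rw [mem_closedBall_zero_iff]
  have hj : ∀ j, ‖param j ξ‖ ≤ 2 := fun j =>
    (hΘ j _ (fun h => hne (Finset.prod_eq_zero (Finset.mem_univ j) h))).2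
  refine le_of_sq_le_sq ?_ (by positivity)
  rw [freq_norm_sq]
  calc ∑ j, ‖param j ξ‖ ^ 2 ≤ ∑ _j : Fin d, (2 : ℝ) ^ 2 :=
        Finset.sum_le_sum fun j _ => pow_le_pow_left₀ (norm_nonneg _) (hj j) 2
    _ = d * 4 := by simp; norm_num
    _ ≤ (2 * d) ^ 2 := by
      have : (d : ℝ) ≤ (d : ℝ) ^ 2 := by exact_mod_cast Nat.le_self_pow two_ne_zero d
      nlinarith

/-- The localizing factor as a Schwartz function. -/
noncomputable def cutoffS {Θ : Fin d → 𝓢(Block l n, ℂ)}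
    (hΘ : ∀ j ξ, 𝓕 (Θ j) ξ ≠ 0 → 1 / 2 ≤ ‖ξ‖ ∧ ‖ξ‖ ≤ 2) : 𝓢(Freq l d n, ℂ) :=
  (hasCompactSupport_cutoff hΘ).toSchwartzMap (contDiff_cutoff Θ)

theorem contDiff_comp_dilC (m : 𝓢(Freq l d n, ℂ)) (κ : Fin d → ℤ) (ξ₀ : Freq l d n) :
    ContDiff ℝ ∞ (fun ξ => m (dilC κ ξ - ξ₀)) :=
  (m.smooth ⊤).comp ((dilC κ).contDiff.sub contDiff_const)

/-- The localized dilate `m(2^{κ_1}ξ^1 - ξ_0^1, …) ∏_j Θ̂_j(ξ^j)` of the translate of `m` to `ξ₀`. -/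
noncomputable def view {Θ : Fin d → 𝓢(Block l n, ℂ)}
    (hΘ : ∀ j ξ, 𝓕 (Θ j) ξ ≠ 0 → 1 / 2 ≤ ‖ξ‖ ∧ ‖ξ‖ ≤ 2) (ξ₀ : Freq l d n) (κ : Fin d → ℤ)
    (m : 𝓢(Freq l d n, ℂ)) : 𝓢(Freq l d n, ℂ) :=
  mulCS (fun ξ => m (dilC κ ξ - ξ₀)) (contDiff_comp_dilC m κ ξ₀) (cutoffS hΘ)
    (hasCompactSupport_cutoff hΘ)

theorem view_apply {Θ : Fin d → 𝓢(Block l n, ℂ)}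
    (hΘ : ∀ j ξ, 𝓕 (Θ j) ξ ≠ 0 → 1 / 2 ≤ ‖ξ‖ ∧ ‖ξ‖ ≤ 2) (ξ₀ : Freq l d n) (κ : Fin d → ℤ)
    (m : 𝓢(Freq l d n, ℂ)) (ξ : Freq l d n) :
    view hΘ ξ₀ κ m ξ = m (dilate κ ξ - ξ₀) * ∏ j, 𝓕 (Θ j) (param j ξ) := rfl

/-- The dyadic dilations that can move a neighbourhood of the base point into the supports of the
`Θ̂_j`. -/
noncomputable def nearScales (d : ℕ) : Finset (Fin d → ℤ) := Fintype.piFinset fun _ => Finset.Icc (-3) 3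

theorem view_eq_zero {Θ : Fin d → 𝓢(Block l n, ℂ)}
    (hΘ : ∀ j ξ, 𝓕 (Θ j) ξ ≠ 0 → 1 / 2 ≤ ‖ξ‖ ∧ ‖ξ‖ ≤ 2) {ξ₀ : Freq l d n}
    (hξ₀ : ∀ j, ‖param j ξ₀‖ = 1) {κ : Fin d → ℤ} (hκ : κ ∉ nearScales d)
    {m : 𝓢(Freq l d n, ℂ)} (hm : ∀ ξ, m ξ ≠ 0 → ‖ξ‖ ≤ 1 / 2) : view hΘ ξ₀ κ m = 0 := by
  ext ξ
  rw [view_apply, zero_apply]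
  by_contra hne
  rw [mul_eq_zero, not_or] at hne
  obtain ⟨h1, h2⟩ := hne
  refine hκ (Fintype.mem_piFinset.2 fun j => ?_)
  have h3 := hΘ j _ (fun h => h2 (Finset.prod_eq_zero (Finset.mem_univ j) h))
  have h4 : ‖param j (dilate κ ξ) - param j ξ₀‖ ≤ 1 / 2 := by
    have := (norm_param_le j (dilate κ ξ - ξ₀)).trans (hm _ h1)
    rwa [← paramC_apply, map_sub] at this
  have h5 : ‖param j (dilate κ ξ)‖ = (2 : ℝ) ^ κ j * ‖param j ξ‖ := by
    rw [param_dilate, norm_smul, Real.norm_of_nonneg (by positivity)]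
  have h6 := abs_le.1 ((abs_norm_sub_norm_le (param j (dilate κ ξ)) (param j ξ₀)).trans h4)
  rw [h5, hξ₀ j] at h6
  have hpos : (0 : ℝ) < 2 ^ κ j := by positivity
  rw [Finset.mem_Icc]
  constructor
  · by_contra hlt
    have : (2 : ℝ) ^ κ j ≤ 2 ^ (-4 : ℤ) := zpow_le_zpow_right₀ (by norm_num) (by omega)
    norm_num at this
    nlinarith
  · by_contra hlt
    have : (2 : ℝ) ^ (4 : ℤ) ≤ 2 ^ κ j := zpow_le_zpow_right₀ (by norm_num) (by omega)
    norm_num at this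
    nlinarith

/-- For a Schwartz function the distributional definition reduces to the operator `lift`. -/
theorem sobolevNorm_le (u : ℝ) (s : Fin d → ℝ) (G : 𝓢(Freq l d n, ℂ)) :
    sobolevNorm u s (G : Freq l d n → ℂ) ≤ eLpNorm (lift s G) (ENNReal.ofReal u) volume := by
  refine iInf_le_of_le (⇑(lift s G)) (iInf_le_of_le ((lift s G).memLp _ volume) (iInf_le _ ?_))
  have hrep : ∀ G : 𝓢(Freq l d n, ℂ),
      Represents (SchwartzMap.toTemperedDistributionCLM (Freq l d n) ℂ volume G) G := by
    intro G φ
    refine ⟨?_, by simp [SchwartzMap.toTemperedDistributionCLM_apply_apply]⟩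
    have e : (fun ξ => φ ξ * G ξ) = ⇑(SchwartzMap.pairing (ContinuousLinearMap.mul ℂ ℂ) φ G) := by
      ext ξ; simp [SchwartzMap.pairing_apply_apply]
    rw [e]
    exact SchwartzMap.integrable _
  refine ⟨_, hrep G, ?_⟩
  rw [besselLift, TemperedDistribution.fourierMultiplierCLM_toTemperedDistributionCLM_eq
    (besselSymbol_hasTemperateGrowth s)]
  exact hrep _

theorem slot_add (i : Fin l) (ξ η : Freq l d n) : slot i (ξ + η) = slot i ξ + slot i η := by
  ext a; simp [slot]

theorem slot_smul (i : Fin l) (c : ℝ) (ξ : Freq l d n) : slot i (c • ξ) = c • slot i ξ := by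
  ext a; simp [slot]

theorem multiplierOp_eq (m : Freq l d n → ℂ) (f : Fin l → 𝓢(Phys d n, ℂ)) (x : Phys d n) :
    multiplierOp m f x =
      ∫ ξ, m ξ * (∏ i, 𝓕 (f i) (slot i ξ)) * wave (inner ℝ x (∑ i, slot i ξ)) := rfl

/-- The function `x ↦ e^{2πi⟨x,a⟩} f(x)`. -/
noncomputable def modulate (a : Phys d n) (f : 𝓢(Phys d n, ℂ)) : 𝓢(Phys d n, ℂ) :=
  𝓕⁻ (SchwartzMap.compSubConstCLM ℂ a (𝓕 f))

theorem fourier_modulate (a : Phys d n) (f : 𝓢(Phys d n, ℂ)) (ξ : Phys d n) :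
    𝓕 (modulate a f) ξ = 𝓕 f (ξ - a) := by
  simp [modulate]

theorem modulate_apply (a : Phys d n) (f : 𝓢(Phys d n, ℂ)) (x : Phys d n) :
    modulate a f x = wave (inner ℝ a x) * f x := by
  rw [schwartz_eq_integral_fourier, schwartz_eq_integral_fourier f]
  simp_rw [fourier_modulate]
  rw [← integral_add_right_eq_self _ a, ← integral_const_mul]
  refine integral_congr_ae (Filter.Eventually.of_forall fun η => ?_)
  simp only [add_sub_cancel_right, inner_add_left, wave_add]
  ring

theorem eLpNorm_modulate (a : Phys d n) (f : 𝓢(Phys d n, ℂ)) (q : ℝ≥0∞) :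
    eLpNorm (modulate a f) q volume = eLpNorm f q volume :=
  eLpNorm_congr_norm_ae (Filter.Eventually.of_forall fun x => by rw [modulate_apply]; simp)

/-- Translating the symbol and modulating the inputs accordingly multiplies the output by a
character. -/
theorem multiplierOp_translate (m : Freq l d n → ℂ) (ξ₀ : Freq l d n)
    (f : Fin l → 𝓢(Phys d n, ℂ)) (x : Phys d n) :
    multiplierOp (fun ξ => m (ξ - ξ₀)) (fun i => modulate (slot i ξ₀) (f i)) x =
      wave (inner ℝ x (∑ i, slot i ξ₀)) * multiplierOp m f x := by
  rw [multiplierOp_eq, multiplierOp_eq, ← integral_add_right_eq_self _ ξ₀, ← integral_const_mul]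
  refine integral_congr_ae (Filter.Eventually.of_forall fun η => ?_)
  simp only [add_sub_cancel_right, fourier_modulate, slot_add, Finset.sum_add_distrib,
    inner_add_right, wave_add]
  ring

/-- The assumed inequality, tested on symbols supported near the base point: only finitely many
localized dilates matter, and translating the symbol amounts to modulating the input functions. -/
theorem eLpNorm_multiplierOp_le {p u : ℝ} {q : Fin l → ℝ} {s : Fin d → ℝ}
    {Θ : Fin d → 𝓢(Block l n, ℂ)}
    (hΘ : ∀ j ξ, 𝓕 (Θ j) ξ ≠ 0 → 1 / 2 ≤ ‖ξ‖ ∧ ‖ξ‖ ≤ 2) {C : ℝ≥0}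
    (hC : ∀ m : Freq l d n → ℂ, MemLp m ⊤ volume → hormanderNorm u s Θ m < ⊤ →
      ∀ f : Fin l → 𝓢(Phys d n, ℂ), eLpNorm (multiplierOp m f) (ENNReal.ofReal p) volume ≤
          C * hormanderNorm u s Θ m * ∏ i, eLpNorm (f i) (ENNReal.ofReal (q i)) volume)
    {ξ₀ : Freq l d n} (hξ₀ : ∀ j, ‖param j ξ₀‖ = 1) (m : 𝓢(Freq l d n, ℂ))
    (hm : ∀ ξ, m ξ ≠ 0 → ‖ξ‖ ≤ 1 / 2) {B : ℝ≥0∞} (hB : B < ⊤)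
    (hmB : ∀ κ ∈ nearScales d, eLpNorm (lift s (view hΘ ξ₀ κ m)) (ENNReal.ofReal u) volume ≤ B)
    (f : Fin l → 𝓢(Phys d n, ℂ)) :
    eLpNorm (multiplierOp m f) (ENNReal.ofReal p) volume ≤
      C * B * ∏ i, eLpNorm (f i) (ENNReal.ofReal (q i)) volume := by
  have hn : hormanderNorm u s Θ (fun ξ => m (ξ - ξ₀)) ≤ B := by
    refine iSup_le fun κ => ?_
    refine (sobolevNorm_le u s (view hΘ ξ₀ κ m)).trans ?_
    by_cases hκ : κ ∈ nearScales d
    · exact hmB κ hκ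
    · rw [view_eq_zero hΘ hξ₀ hκ hm, map_zero]
      simp
  have hmem : MemLp (fun ξ => m (ξ - ξ₀)) ⊤ volume :=
    (SchwartzMap.compSubConstCLM ℂ ξ₀ m).memLp_top volume
  have h := hC _ hmem (hn.trans_lt hB) (fun i => modulate (slot i ξ₀) (f i))
  simp_rw [eLpNorm_modulate] at h
  have e : eLpNorm (multiplierOp (fun ξ => m (ξ - ξ₀)) fun i => modulate (slot i ξ₀) (f i))
      (ENNReal.ofReal p) volume = eLpNorm (multiplierOp m f) (ENNReal.ofReal p) volume :=
    eLpNorm_congr_norm_ae (Filter.Eventually.of_forall fun x => by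
      rw [multiplierOp_translate]; simp)
  rw [e] at h
  exact h.trans (mul_le_mul_left (mul_le_mul_right hn _) _)

end Reduction

/-! ### Symbols that depend on the sum of the frequencies -/

section Slots

variable {l d n : ℕ}

theorem measurePreserving_uncurry_pi (ι K : Type*) [Fintype ι] [Fintype K] :
    MeasurePreserving (fun (g : ι → K → ℝ) (q : ι × K) => g q.1 q.2) volume volume := by
  refine ⟨by fun_prop, ?_⟩
  refine (Measure.pi_eq fun s hs => ?_).symm
  rw [Measure.map_apply (by fun_prop) (MeasurableSet.univ_pi hs)]
  have e : (fun (g : ι → K → ℝ) (q : ι × K) => g q.1 q.2) ⁻¹' Set.univ.pi s =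
      Set.univ.pi fun i => Set.univ.pi fun k => s (i, k) := by
    ext g; simp [Set.mem_pi]
  rw [e, volume_pi_pi]
  simp_rw [volume_pi_pi]
  rw [Fintype.prod_prod_type]

/-- Splitting a frequency vector into its slots `(ξ_1, …, ξ_l)`. -/
noncomputable def slotEquiv (l d n : ℕ) : Freq l d n ≃ᵐ (Fin l → Phys d n) where
  toFun ξ i := slot i ξ
  invFun g := WithLp.toLp 2 fun a => g a.1 a.2
  left_inv ξ := by ext a; rfl
  right_inv g := by funext i; ext a; rfl
  measurable_toFun := by
    refine measurable_pi_lambda _ fun i => ?_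
    refine (WithLp.measurable_toLp 2 _).comp (measurable_pi_lambda _ fun a => ?_)
    exact (EuclideanSpace.proj (𝕜 := ℝ) (i, a.1, a.2)).continuous.measurable
  measurable_invFun := by
    refine (WithLp.measurable_toLp 2 _).comp (measurable_pi_lambda _ fun a => ?_)
    exact (EuclideanSpace.proj (𝕜 := ℝ) (a.2.1, a.2.2)).continuous.measurable.comp
      (measurable_pi_apply a.1)

theorem measurePreserving_slotEquiv_symm :
    MeasurePreserving (slotEquiv l d n).symm volume volume := by
  have h1 : MeasurePreserving (fun (g : Fin l → Phys d n) i => WithLp.ofLp (g i)) volume volume :=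
    volume_preserving_pi fun _ => PiLp.volume_preserving_ofLp _
  have h2 := measurePreserving_uncurry_pi (Fin l) (Fin d × Fin n)
  have h3 := PiLp.volume_preserving_toLp (Fin l × Fin d × Fin n)
  exact h3.comp (h2.comp h1)

theorem measurePreserving_slotEquiv : MeasurePreserving (slotEquiv l d n) volume volume :=
  measurePreserving_slotEquiv_symm.symm (slotEquiv l d n).symm

theorem integral_prod_slot (g : Fin l → Phys d n → ℂ) :
    ∫ ξ : Freq l d n, ∏ i, g i (slot i ξ) = ∏ i, ∫ η, g i η := by
  rw [← integral_fintype_prod_volume_eq_prod]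
  exact measurePreserving_slotEquiv.integral_comp' (f := slotEquiv l d n)
    (fun h : Fin l → Phys d n => ∏ i, g i (h i))

theorem integrable_prod_slot {g : Fin l → Phys d n → ℂ} (hg : ∀ i, Integrable (g i)) :
    Integrable (fun ξ : Freq l d n => ∏ i, g i (slot i ξ)) := by
  have h : Integrable (fun h : Fin l → Phys d n => ∏ i, g i (h i)) :=
    Integrable.fintype_prod hg
  exact (measurePreserving_slotEquiv.integrable_comp_emb (slotEquiv l d n).measurableEmbedding).2 h

theorem continuous_slot (i : Fin l) : Continuous (slot i : Freq l d n → Phys d n) := by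
  refine (PiLp.continuous_toLp 2 _).comp (continuous_pi fun a => ?_)
  exact (EuclideanSpace.proj (𝕜 := ℝ) (i, a.1, a.2)).continuous

theorem wave_inner_sum (x : Phys d n) (ξ : Freq l d n) :
    wave (inner ℝ x (∑ i, slot i ξ)) = ∏ i, wave (inner ℝ (slot i ξ) x) := by
  classical
  have h : ∀ t : Finset (Fin l), wave (inner ℝ x (∑ i ∈ t, slot i ξ)) =
      ∏ i ∈ t, wave (inner ℝ (slot i ξ) x) := by
    intro t
    induction t using Finset.induction_on with
    | empty => simp
    | insert i t hi ih =>
      rw [Finset.sum_insert hi, Finset.prod_insert hi, inner_add_right, wave_add, ih,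
        real_inner_comm]
  exact h _

/-- The symbol `1` gives the pointwise product. -/
theorem integral_prod_fourier_slot (h : Fin l → 𝓢(Phys d n, ℂ)) (x : Phys d n) :
    ∫ ξ : Freq l d n, (∏ i, 𝓕 (h i) (slot i ξ)) * wave (inner ℝ x (∑ i, slot i ξ)) =
      ∏ i, h i x := by
  simp_rw [wave_inner_sum, ← Finset.prod_mul_distrib]
  rw [integral_prod_slot (fun i η => 𝓕 (h i) η * wave (inner ℝ η x))]
  refine Finset.prod_congr rfl fun i _ => ?_
  rw [schwartz_eq_integral_fourier (h i) x]
  simp_rw [mul_comm]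

/-- The Fourier transform of an integrable function, pulled back by `σ` and integrated against `H`. -/
theorem integral_fourier_comp_mul {V E : Type*} [NormedAddCommGroup V] [InnerProductSpace ℝ V]
    [FiniteDimensional ℝ V] [MeasurableSpace V] [BorelSpace V] [NormedAddCommGroup E]
    [InnerProductSpace ℝ E] [FiniteDimensional ℝ E] [MeasurableSpace E] [BorelSpace E]
    {σ : V → E} (hσ : Continuous σ) {Γ : E → ℂ} (hΓ : Integrable Γ) {H : V → ℂ}
    (hH : Integrable H) :
    ∫ ξ, (∫ y, wave (-inner ℝ y (σ ξ)) * Γ y) * H ξ =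
      ∫ y, Γ y * ∫ ξ, wave (-inner ℝ y (σ ξ)) * H ξ := by
  have hint : Integrable (fun q : V × E => wave (-inner ℝ q.2 (σ q.1)) * (H q.1 * Γ q.2))
      (volume.prod volume) := by
    refine (hH.mul_prod hΓ).bdd_mul (c := 1) ?_ (Filter.Eventually.of_forall fun q => by simp)
    exact (continuous_wave.comp (by fun_prop)).aestronglyMeasurable
  calc ∫ ξ, (∫ y, wave (-inner ℝ y (σ ξ)) * Γ y) * H ξ
      = ∫ ξ, ∫ y, wave (-inner ℝ y (σ ξ)) * (H ξ * Γ y) := by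
        refine integral_congr_ae (Filter.Eventually.of_forall fun ξ => ?_)
        simp only
        rw [← integral_mul_const]
        refine integral_congr_ae (Filter.Eventually.of_forall fun y => ?_)
        simp only; ring
    _ = ∫ y, ∫ ξ, wave (-inner ℝ y (σ ξ)) * (H ξ * Γ y) := integral_integral_swap hint
    _ = _ := by
        refine integral_congr_ae (Filter.Eventually.of_forall fun y => ?_)
        simp only
        rw [← integral_const_mul]
        refine integral_congr_ae (Filter.Eventually.of_forall fun ξ => ?_)
        simp only; ring

theorem fourier_eq_integral_wave {E : Type*} [NormedAddCommGroup E]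
    [InnerProductSpace ℝ E] [FiniteDimensional ℝ E] [MeasurableSpace E] [BorelSpace E]
    (Γ : E → ℂ) (η : E) : 𝓕 Γ η = ∫ y, wave (-inner ℝ y η) * Γ y := by
  rw [Real.fourier_eq']
  refine integral_congr_ae (Filter.Eventually.of_forall fun y => ?_)
  simp only [smul_eq_mul, wave_eq]
  congr 3; push_cast; ring

/-- A multiplier that depends only on `ξ_1 + ⋯ + ξ_l` convolves the pointwise product. -/
theorem integral_fourier_sum_slot {Γ : Phys d n → ℂ} (hΓ : Integrable Γ)
    (h : Fin l → 𝓢(Phys d n, ℂ)) (x : Phys d n) :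
    ∫ ξ : Freq l d n, 𝓕 Γ (∑ i, slot i ξ) * (∏ i, 𝓕 (h i) (slot i ξ)) *
      wave (inner ℝ x (∑ i, slot i ξ)) = ∫ y, Γ (x - y) * ∏ i, h i y := by
  have hH : Integrable (fun ξ : Freq l d n => (∏ i, 𝓕 (h i) (slot i ξ)) *
      wave (inner ℝ x (∑ i, slot i ξ))) := by
    simp_rw [wave_inner_sum, ← Finset.prod_mul_distrib]
    refine integrable_prod_slot (g := fun i η => 𝓕 (h i) η * wave (inner ℝ η x)) fun i => ?_
    refine (𝓕 (h i)).integrable.norm.mono' ?_ (Filter.Eventually.of_forall fun η => by simp)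
    exact ((𝓕 (h i)).continuous.mul (continuous_wave.comp (by fun_prop))).aestronglyMeasurable
  have hσ : Continuous (fun ξ : Freq l d n => ∑ i, slot i ξ) :=
    continuous_finsetSum _ fun i _ => continuous_slot i
  have h1 := integral_fourier_comp_mul hσ hΓ hH
  simp_rw [fourier_eq_integral_wave Γ, mul_assoc]
  rw [h1]
  have h2 : ∀ y, ∫ ξ : Freq l d n, wave (-inner ℝ y (∑ i, slot i ξ)) *
      ((∏ i, 𝓕 (h i) (slot i ξ)) * wave (inner ℝ x (∑ i, slot i ξ))) = ∏ i, h i (x - y) := by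
    intro y
    rw [← integral_prod_fourier_slot h (x - y)]
    refine integral_congr_ae (Filter.Eventually.of_forall fun ξ => ?_)
    simp only [inner_sub_left]
    rw [sub_eq_add_neg, wave_add]; ring
  simp_rw [h2]
  rw [← integral_sub_left_eq_self _ volume x]
  simp

/-- The Fourier multiplier `𝓕 Γ` is the convolution with `Γ`. -/
theorem integral_fourier_mul {E : Type*} [NormedAddCommGroup E]
    [InnerProductSpace ℝ E] [FiniteDimensional ℝ E] [MeasurableSpace E] [BorelSpace E]
    {Γ : E → ℂ} (hΓ : Integrable Γ) (h : 𝓢(E, ℂ)) (x : E) :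
    ∫ ξ, wave (inner ℝ ξ x) * (𝓕 Γ ξ * 𝓕 h ξ) = ∫ y, Γ (x - y) * h y := by
  have hH : Integrable (fun ξ => 𝓕 h ξ * wave (inner ℝ ξ x)) := by
    refine (𝓕 h).integrable.norm.mono' ?_ (Filter.Eventually.of_forall fun η => by simp)
    exact ((𝓕 h).continuous.mul (continuous_wave.comp (by fun_prop))).aestronglyMeasurable
  have h1 := integral_fourier_comp_mul continuous_id hΓ hH
  have h2 : ∀ y, ∫ ξ, wave (-inner ℝ y (id ξ)) * (𝓕 h ξ * wave (inner ℝ ξ x)) = h (x - y) := by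
    intro y
    rw [schwartz_eq_integral_fourier h (x - y)]
    refine integral_congr_ae (Filter.Eventually.of_forall fun ξ => ?_)
    simp only [inner_sub_right, id]
    rw [sub_eq_add_neg, wave_add, real_inner_comm]; ring
  simp_rw [h2] at h1
  simp_rw [fourier_eq_integral_wave Γ]
  rw [← integral_sub_left_eq_self (fun y => Γ (x - y) * h y) volume x]
  simp only [sub_sub_cancel]
  rw [← h1]
  refine integral_congr_ae (Filter.Eventually.of_forall fun ξ => ?_)
  simp only [id]; ring

end Slots

/-! ### Bumps and nonnegative band-limited functions -/

section Bumps

open scoped ContDiff Convolution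

variable {E : Type*} [NormedAddCommGroup E] [InnerProductSpace ℝ E] [FiniteDimensional ℝ E]
  [MeasurableSpace E] [BorelSpace E]

/-- A smooth plateau function as a complex-valued Schwartz function. -/
noncomputable def bumpS (b : ContDiffBump (0 : E)) : 𝓢(E, ℂ) :=
  HasCompactSupport.toSchwartzMap (f := fun x => ((b x : ℝ) : ℂ))
    (b.hasCompactSupport.comp_left (g := fun r : ℝ => (r : ℂ)) Complex.ofReal_zero)
    (Complex.ofRealCLM.contDiff.comp b.contDiff)

@[simp] theorem bumpS_apply (b : ContDiffBump (0 : E)) (x : E) : bumpS b x = ((b x : ℝ) : ℂ) := rfl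

/-- There is a nonnegative band-limited Schwartz function that does not vanish at the origin: the
square of the Fourier transform of an even real bump. -/
theorem exists_nonneg_bandlimited {r : ℝ} (hr : 0 < r) :
    ∃ (Γ : 𝓢(E, ℂ)) (ρ : E → ℝ), (∀ x, Γ x = ρ x) ∧ (∀ x, 0 ≤ ρ x) ∧ 0 < ρ 0 ∧
      ∀ ξ, 𝓕 Γ ξ ≠ 0 → ‖ξ‖ ≤ r := by
  let b : ContDiffBump (0 : E) := ⟨r / 4, r / 2, by positivity, by linarith⟩
  have hreal : ∀ y, ((𝓕 (bumpS b) y).re : ℂ) = 𝓕 (bumpS b) y := by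
    intro y
    rw [← Complex.conj_eq_iff_re, SchwartzMap.fourier_coe, fourier_eq_integral_wave,
      ← integral_conj, ← integral_neg_eq_self]
    refine integral_congr_ae (Filter.Eventually.of_forall fun v => ?_)
    simp only [map_mul, bumpS_apply, Complex.conj_ofReal, b.neg]
    congr 1
    rw [wave_eq, wave_eq, ← Complex.exp_conj]
    congr 1
    simp only [map_mul, Complex.conj_I, Complex.conj_ofReal, inner_neg_left]
    push_cast
    ring
  refine ⟨𝓕⁻ (SchwartzMap.convolution (ContinuousLinearMap.mul ℂ ℂ) (bumpS b) (bumpS b)),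
    fun x => (𝓕 (bumpS b) (-x)).re ^ 2, fun x => ?_, fun x => sq_nonneg _, ?_, fun ξ hξ => ?_⟩
  · rw [SchwartzMap.fourierInv_apply_eq]
    simp only [SchwartzMap.compCLMOfContinuousLinearEquiv_apply, Function.comp_apply,
      SchwartzMap.fourier_convolution, SchwartzMap.pairing_apply_apply,
      ContinuousLinearMap.mul_apply']
    push_cast
    rw [hreal, sq]
    rfl
  · have h0 : (𝓕 (bumpS b) (-0)).re = ∫ v, b v := by
      rw [neg_zero, SchwartzMap.fourier_coe, fourier_eq_integral_wave]
      simp only [inner_zero_right, neg_zero, wave_zero, one_mul, bumpS_apply]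
      rw [integral_complex_ofReal, Complex.ofReal_re]
    change 0 < (𝓕 (bumpS b) (-0)).re ^ 2
    rw [h0]
    exact pow_pos b.integral_pos 2
  · rw [FourierTransform.fourier_fourierInv_eq, SchwartzMap.convolution_apply] at hξ
    by_contra hlt
    refine hξ ?_
    rw [convolution_def]
    refine integral_eq_zero_of_ae (Filter.Eventually.of_forall fun t => ?_)
    simp only [ContinuousLinearMap.mul_apply', Pi.zero_apply, bumpS_apply]
    by_contra hne
    rw [mul_eq_zero, not_or] at hne
    have h1 : t ∈ Metric.ball (0 : E) b.rOut := by
      rw [← b.support_eq]; exact fun h => hne.1 (by simp [h])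
    have h2 : ξ - t ∈ Metric.ball (0 : E) b.rOut := by
      rw [← b.support_eq]; exact fun h => hne.2 (by simp [h])
    rw [mem_ball_zero_iff] at h1 h2
    have h3 := norm_add_le t (ξ - t)
    rw [add_sub_cancel] at h3
    have : b.rOut = r / 2 := rfl
    linarith

end Bumps

/-! ### Anisotropic scaling -/

section Scaling

variable {ι : Type*} [Fintype ι]

/-- The diagonal linear map with diagonal entries `c`. -/
noncomputable def diagE (c : ι → ℝ) (hc : ∀ a, c a ≠ 0) :
    EuclideanSpace ℝ ι ≃L[ℝ] EuclideanSpace ℝ ι :=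
  LinearEquiv.toContinuousLinearEquiv
    { toFun := fun x => WithLp.toLp 2 fun a => c a * x a
      invFun := fun x => WithLp.toLp 2 fun a => (c a)⁻¹ * x a
      left_inv := fun x => by ext a; simp [hc a]
      right_inv := fun x => by ext a; simp [hc a]
      map_add' := fun x y => by ext a; simp [mul_add]
      map_smul' := fun t x => by ext a; simp; ring }

@[simp] theorem diagE_apply (c : ι → ℝ) (hc : ∀ a, c a ≠ 0) (x : EuclideanSpace ℝ ι) (a : ι) :
    diagE c hc x a = c a * x a := rfl

@[simp] theorem diagE_symm_apply (c : ι → ℝ) (hc : ∀ a, c a ≠ 0) (x : EuclideanSpace ℝ ι) (a : ι) :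
    (diagE c hc).symm x a = (c a)⁻¹ * x a := rfl

theorem det_diagE (c : ι → ℝ) (hc : ∀ a, c a ≠ 0) :
    LinearMap.det ((diagE c hc : EuclideanSpace ℝ ι →L[ℝ] EuclideanSpace ℝ ι) :
      EuclideanSpace ℝ ι →ₗ[ℝ] EuclideanSpace ℝ ι) = ∏ a, c a := by
  classical
  rw [← Matrix.det_diagonal, ← LinearMap.det_toLpLin 2]
  congr 1
  ext x a
  simp [Matrix.mulVec_diagonal]

theorem inner_diagE (c : ι → ℝ) (hc : ∀ a, c a ≠ 0) (x y : EuclideanSpace ℝ ι) :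
    inner ℝ (diagE c hc x) y = inner ℝ x (diagE c hc y) := by
  simp only [PiLp.inner_apply, diagE_apply]
  refine Finset.sum_congr rfl fun a _ => ?_
  simp; ring

theorem map_equiv_volume {V : Type*} [NormedAddCommGroup V] [InnerProductSpace ℝ V]
    [FiniteDimensional ℝ V] [MeasurableSpace V] [BorelSpace V] (L : V ≃L[ℝ] V) :
    Measure.map L (volume : Measure V) =
      ENNReal.ofReal |(LinearMap.det ((L : V →L[ℝ] V) : V →ₗ[ℝ] V))⁻¹| • volume :=
  Measure.map_linearMap_addHaar_eq_smul_addHaar volume (f := ((L : V →L[ℝ] V) : V →ₗ[ℝ] V))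
    (LinearEquiv.isUnit_det' L.toLinearEquiv).ne_zero

theorem eLpNorm_comp_equiv {V : Type*} [NormedAddCommGroup V] [InnerProductSpace ℝ V]
    [FiniteDimensional ℝ V] [MeasurableSpace V] [BorelSpace V] (L : V ≃L[ℝ] V) (w : V → ℂ)
    {v : ℝ≥0∞} (hv' : v ≠ ∞) :
    eLpNorm (fun ξ => w (L ξ)) v volume =
      ENNReal.ofReal (|LinearMap.det ((L : V →L[ℝ] V) : V →ₗ[ℝ] V)| ^ (-(1 / v.toReal))) *
        eLpNorm w v volume := by
  have h1 : eLpNorm (fun ξ => w (L ξ)) v volume = eLpNorm w v (Measure.map L volume) :=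
    (L.toHomeomorph.measurableEmbedding.eLpNorm_map_measure).symm
  rw [h1, map_equiv_volume, eLpNorm_smul_measure_of_ne_top hv', smul_eq_mul, abs_inv,
    ENNReal.ofReal_rpow_of_nonneg (by positivity) (by positivity), Real.rpow_neg (abs_nonneg _),
    Real.inv_rpow (abs_nonneg _)]
  simp

theorem integral_comp_equiv {V : Type*} [NormedAddCommGroup V] [InnerProductSpace ℝ V]
    [FiniteDimensional ℝ V] [MeasurableSpace V] [BorelSpace V] (L : V ≃L[ℝ] V) (w : V → ℂ) :
    ∫ ξ, w (L ξ) = (|(LinearMap.det ((L : V →L[ℝ] V) : V →ₗ[ℝ] V))⁻¹| : ℝ) * ∫ ξ, w ξ := by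
  have h1 : ∫ ξ, w (L ξ) = ∫ ξ, w ξ ∂(Measure.map L volume) :=
    (L.toHomeomorph.measurableEmbedding.integral_map w).symm
  rw [h1, map_equiv_volume, integral_smul_measure, ENNReal.toReal_ofReal (abs_nonneg _)]
  simp

variable {l d n : ℕ}

/-- The scale `max 1 N`: it equals `N` for `N ≥ 1` and keeps the scalings invertible at `N = 0`. -/
def sc (N : ℕ) : ℝ := max 1 N

theorem sc_eq {N : ℕ} (hN : 1 ≤ N) : sc N = N := max_eq_right (by exact_mod_cast hN)
theorem one_le_sc (N : ℕ) : 1 ≤ sc N := le_max_left _ _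
theorem sc_pos (N : ℕ) : 0 < sc N := zero_lt_one.trans_le (one_le_sc N)

theorem ite_sc_ne_zero (N : ℕ) (P : Prop) [Decidable P] : (if P then sc N else 1) ≠ 0 := by
  split_ifs
  · exact (sc_pos N).ne'
  · exact one_ne_zero

/-- Expansion of the `j₀`-th component of `ℝ^{dn}` by the factor `N`. -/
noncomputable def physScale (j₀ : Fin d) (N : ℕ) : Phys d n ≃L[ℝ] Phys d n :=
  diagE (fun a => if a.1 = j₀ then sc N else 1) fun _ => ite_sc_ne_zero N _

/-- Expansion of the components `ξ_{i,j₀}`, `i ∈ J`, by the factor `N`. -/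
noncomputable def freqScale (j₀ : Fin d) (J : Finset (Fin l)) (N : ℕ) :
    Freq l d n ≃L[ℝ] Freq l d n :=
  diagE (fun a => if a.2.1 = j₀ ∧ a.1 ∈ J then sc N else 1) fun _ => ite_sc_ne_zero N _

theorem det_physScale (j₀ : Fin d) (N : ℕ) :
    LinearMap.det ((physScale (n := n) j₀ N : Phys d n →L[ℝ] Phys d n) :
      Phys d n →ₗ[ℝ] Phys d n) = sc N ^ n := by
  rw [physScale, det_diagE, Fintype.prod_prod_type, Finset.prod_eq_single j₀]
  · simp
  · intro j _ hj; simp [hj]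
  · simp

theorem det_freqScale (j₀ : Fin d) (J : Finset (Fin l)) (N : ℕ) :
    LinearMap.det ((freqScale (n := n) j₀ J N : Freq l d n →L[ℝ] Freq l d n) :
      Freq l d n →ₗ[ℝ] Freq l d n) = sc N ^ (J.card * n) := by
  classical
  rw [freqScale, det_diagE, Fintype.prod_prod_type, mul_comm, pow_mul]
  rw [← Finset.prod_subset (Finset.subset_univ J)]
  · rw [← Finset.prod_const]
    refine Finset.prod_congr rfl fun i hi => ?_
    rw [Fintype.prod_prod_type, Finset.prod_eq_single j₀]
    · simp [hi]
    · intro j _ hj; simp [hj]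
    · simp
  · intro i _ hi; simp [hi]

theorem slot_freqScale (j₀ : Fin d) (J : Finset (Fin l)) (N : ℕ) (i : Fin l) (ξ : Freq l d n) :
    slot i (freqScale j₀ J N ξ) = if i ∈ J then physScale j₀ N (slot i ξ) else slot i ξ := by
  ext a
  split_ifs with h <;> simp [slot, freqScale, physScale, h]

theorem norm_le_norm_physScale (j₀ : Fin d) (N : ℕ) (x : Phys d n) :
    ‖x‖ ≤ ‖physScale j₀ N x‖ := by
  refine le_of_sq_le_sq ?_ (norm_nonneg _)
  rw [EuclideanSpace.norm_sq_eq, EuclideanSpace.norm_sq_eq]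
  refine Finset.sum_le_sum fun a _ => ?_
  have : 1 ≤ (if a.1 = j₀ then sc N else 1) := by split_ifs; exacts [one_le_sc N, le_rfl]
  simp only [physScale, diagE_apply, norm_mul, Real.norm_eq_abs, abs_of_pos (zero_lt_one.trans_le this)]
  gcongr
  exact le_mul_of_one_le_left (abs_nonneg _) this

theorem norm_physScale_le {j₀ : Fin d} {N M : ℕ} (hNM : N ≤ M) (x : Phys d n) :
    ‖physScale j₀ N x‖ ≤ ‖physScale j₀ M x‖ := by
  refine le_of_sq_le_sq ?_ (norm_nonneg _)
  rw [EuclideanSpace.norm_sq_eq, EuclideanSpace.norm_sq_eq]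
  refine Finset.sum_le_sum fun a _ => ?_
  have hsc : sc N ≤ sc M := max_le_max le_rfl (by exact_mod_cast hNM)
  have h1 := sc_pos N
  simp only [physScale, diagE_apply, norm_mul, Real.norm_eq_abs]
  gcongr
  split_ifs
  · exact hsc
  · exact le_rfl

/-- The function `x ↦ g(x_1, …, x_{j₀} / N, …, x_d)`. -/
noncomputable def spread (j₀ : Fin d) (N : ℕ) (g : 𝓢(Phys d n, ℂ)) : 𝓢(Phys d n, ℂ) :=
  SchwartzMap.compCLMOfContinuousLinearEquiv ℂ (physScale j₀ N).symm g

@[simp] theorem spread_apply (j₀ : Fin d) (N : ℕ) (g : 𝓢(Phys d n, ℂ)) (x : Phys d n) :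
    spread j₀ N g x = g ((physScale j₀ N).symm x) := rfl

theorem fourier_spread (j₀ : Fin d) (N : ℕ) (g : 𝓢(Phys d n, ℂ)) (ξ : Phys d n) :
    𝓕 (spread j₀ N g) ξ = (sc N ^ n : ℝ) * 𝓕 g (physScale j₀ N ξ) := by
  rw [SchwartzMap.fourier_coe, SchwartzMap.fourier_coe, fourier_eq_integral_wave,
    fourier_eq_integral_wave]
  have h := integral_comp_equiv (physScale j₀ N) (fun y => wave (-inner ℝ y ξ) * spread j₀ N g y)
  rw [det_physScale, abs_of_pos (inv_pos.2 (pow_pos (sc_pos N) n))] at h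
  have hne : ((sc N ^ n : ℝ) : ℂ) ≠ 0 := by exact_mod_cast (pow_pos (sc_pos N) n).ne'
  have h2 : ∫ y, wave (-inner ℝ y ξ) * spread j₀ N g y =
      (sc N ^ n : ℝ) * ∫ y, wave (-inner ℝ (physScale j₀ N y) ξ) * spread j₀ N g (physScale j₀ N y) := by
    rw [h, ← mul_assoc, ← Complex.ofReal_mul, mul_inv_cancel₀ (pow_pos (sc_pos N) n).ne']
    simp
  rw [h2]
  congr 1
  refine integral_congr_ae (Filter.Eventually.of_forall fun y => ?_)
  simp only [spread_apply, ContinuousLinearEquiv.symm_apply_apply]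
  rw [physScale, inner_diagE]

theorem eLpNorm_comp_physScale (j₀ : Fin d) {N : ℕ} (hN : 1 ≤ N) (w : Phys d n → ℂ) {q : ℝ}
    (hq : 0 < q) : eLpNorm (fun x => w (physScale j₀ N x)) (ENNReal.ofReal q) volume =
      ENNReal.ofReal ((N : ℝ) ^ (-(n / q))) * eLpNorm w (ENNReal.ofReal q) volume := by
  have hN0 : (0 : ℝ) < N := by exact_mod_cast hN
  rw [eLpNorm_comp_equiv _ _ ENNReal.ofReal_ne_top, det_physScale, sc_eq hN,
    abs_of_pos (by positivity), ENNReal.toReal_ofReal hq.le, ← Real.rpow_natCast_mul hN0.le]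
  congr 3; ring

theorem eLpNorm_comp_physScale_symm (j₀ : Fin d) {N : ℕ} (hN : 1 ≤ N) (w : Phys d n → ℂ) {q : ℝ}
    (hq : 0 < q) : eLpNorm (fun x => w ((physScale j₀ N).symm x)) (ENNReal.ofReal q) volume =
      ENNReal.ofReal ((N : ℝ) ^ (n / q)) * eLpNorm w (ENNReal.ofReal q) volume := by
  have hN0 : (0 : ℝ) < N := by exact_mod_cast hN
  have h := eLpNorm_comp_physScale j₀ hN (fun x => w ((physScale j₀ N).symm x)) hq
  simp only [ContinuousLinearEquiv.symm_apply_apply] at h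
  rw [h, ← mul_assoc, ← ENNReal.ofReal_mul (by positivity), ← Real.rpow_add hN0]
  simp

end Scaling

/-! ### Symbols adapted to one large scale -/

section Symbols

open scoped ContDiff

variable {l d n : ℕ}

theorem norm_le_sum_slot (ξ : Freq l d n) : ‖ξ‖ ≤ ∑ i, ‖slot i ξ‖ := by
  refine le_of_sq_le_sq ?_ (by positivity)
  have h : ‖ξ‖ ^ 2 = ∑ i, ‖slot i ξ‖ ^ 2 := by
    simp_rw [EuclideanSpace.norm_sq_eq]
    rw [Fintype.sum_prod_type]
    rfl
  rw [h]
  exact Finset.sum_sq_le_sq_sum_of_nonneg fun i _ => norm_nonneg _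

/-- `slot` as a continuous linear map. -/
noncomputable def slotC (i : Fin l) : Freq l d n →L[ℝ] Phys d n :=
  LinearMap.toContinuousLinearMap
    { toFun := slot i
      map_add' := slot_add i
      map_smul' := slot_smul i }

@[simp] theorem slotC_apply (i : Fin l) (ξ : Freq l d n) : slotC i ξ = slot i ξ := rfl

theorem norm_le_of_prod_slot_ne_zero {Φ : Fin l → 𝓢(Phys d n, ℂ)} {r : ℝ}
    (hΦ : ∀ i x, Φ i x ≠ 0 → ‖x‖ ≤ r) {ξ : Freq l d n} (hξ : ∏ i, Φ i (slot i ξ) ≠ 0) (i : Fin l) :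
    ‖slot i ξ‖ ≤ r :=
  hΦ i _ fun h => hξ (Finset.prod_eq_zero (Finset.mem_univ i) h)

/-- The tensor product `ξ ↦ ∏_i Φ_i(ξ_i)` of compactly supported functions. -/
noncomputable def tensorS (Φ : Fin l → 𝓢(Phys d n, ℂ)) {r : ℝ}
    (hΦ : ∀ i x, Φ i x ≠ 0 → ‖x‖ ≤ r) : 𝓢(Freq l d n, ℂ) :=
  HasCompactSupport.toSchwartzMap (f := fun ξ => ∏ i, Φ i (slot i ξ))
    (HasCompactSupport.intro (isCompact_closedBall 0 (l * r)) fun ξ hξ => by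
      by_contra hne
      refine hξ ?_
      rw [mem_closedBall_zero_iff]
      refine (norm_le_sum_slot ξ).trans
        ((Finset.sum_le_sum fun i _ => norm_le_of_prod_slot_ne_zero hΦ hne i).trans ?_)
      simp)
    (contDiff_prod fun i _ => ((Φ i).smooth ⊤).comp (slotC i).contDiff)

theorem tensorS_apply (Φ : Fin l → 𝓢(Phys d n, ℂ)) {r : ℝ}
    (hΦ : ∀ i x, Φ i x ≠ 0 → ‖x‖ ≤ r) (ξ : Freq l d n) :
    tensorS Φ hΦ ξ = ∏ i, Φ i (slot i ξ) := rfl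

/-- The linear change of variables that replaces `ξ_{i₀}` by `ξ_1 + ⋯ + ξ_l`. -/
noncomputable def shear (i₀ : Fin l) : Freq l d n ≃L[ℝ] Freq l d n :=
  LinearEquiv.toContinuousLinearEquiv
    { toFun := fun ξ => WithLp.toLp 2 fun a =>
        if a.1 = i₀ then ∑ i, ξ (i, a.2) else ξ a
      invFun := fun ξ => WithLp.toLp 2 fun a =>
        if a.1 = i₀ then ξ a - ∑ i ∈ Finset.univ.erase i₀, ξ (i, a.2) else ξ a
      left_inv := fun ξ => by
        ext ⟨i, a⟩
        by_cases h : i = i₀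
        · subst h
          simp only [if_true]
          rw [← Finset.add_sum_erase _ _ (Finset.mem_univ i), add_sub_assoc, sub_eq_zero.2, add_zero]
          exact Finset.sum_congr rfl fun k hk => by simp [Finset.ne_of_mem_erase hk]
        · simp [h]
      right_inv := fun ξ => by
        ext ⟨i, a⟩
        by_cases h : i = i₀
        · subst h
          simp only [if_true]
          rw [← Finset.add_sum_erase _ _ (Finset.mem_univ i), if_pos rfl]
          have : ∑ x ∈ Finset.univ.erase i, (if x = i then
              ξ (x, a) - ∑ k ∈ Finset.univ.erase i, ξ (k, a) else ξ (x, a)) =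
              ∑ k ∈ Finset.univ.erase i, ξ (k, a) :=
            Finset.sum_congr rfl fun k hk => by simp [Finset.ne_of_mem_erase hk]
          rw [this]; ring
        · simp [h]
      map_add' := fun ξ η => by
        ext a
        by_cases h : a.1 = i₀ <;> simp [h, Finset.sum_add_distrib]
      map_smul' := fun t ξ => by
        ext a
        by_cases h : a.1 = i₀ <;> simp [h, Finset.mul_sum] }

theorem shear_apply (i₀ : Fin l) (ξ : Freq l d n) (a : Fin l × Fin d × Fin n) :
    shear i₀ ξ a = if a.1 = i₀ then ∑ i, ξ (i, a.2) else ξ a := rfl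

theorem slot_shear_self (i₀ : Fin l) (ξ : Freq l d n) :
    slot i₀ (shear i₀ ξ) = ∑ i, slot i ξ := by
  ext a
  simp [slot, shear_apply]

theorem slot_shear_of_ne {i₀ i : Fin l} (h : i ≠ i₀) (ξ : Freq l d n) :
    slot i (shear i₀ ξ) = slot i ξ := by
  ext a
  simp [slot, shear_apply, h]

theorem norm_le_of_slot_shear {i₀ : Fin l} {ξ : Freq l d n} {r : ℝ}
    (h : ∀ i, ‖slot i (shear i₀ ξ)‖ ≤ r) : ‖ξ‖ ≤ 2 * l * r := by
  have h1 : ∀ i ∈ Finset.univ.erase i₀, ‖slot i ξ‖ ≤ r := fun i hi => by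
    have := h i
    rwa [slot_shear_of_ne (Finset.ne_of_mem_erase hi)] at this
  have h2 : ∑ i ∈ Finset.univ.erase i₀, ‖slot i ξ‖ ≤ (l - 1) * r := by
    refine (Finset.sum_le_sum h1).trans (le_of_eq ?_)
    have : 1 ≤ l := i₀.pos
    simp [Finset.card_erase_of_mem, Nat.cast_sub this]
  have h3 : ‖slot i₀ ξ‖ ≤ l * r := by
    have h4 := h i₀
    rw [slot_shear_self, ← Finset.add_sum_erase _ _ (Finset.mem_univ i₀)] at h4
    have h5 := norm_le_norm_add_norm_sub' (slot i₀ ξ)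
      (slot i₀ ξ + ∑ i ∈ Finset.univ.erase i₀, slot i ξ)
    rw [sub_add_cancel_left, norm_neg] at h5
    have h6 := (norm_sum_le (Finset.univ.erase i₀) fun i => slot i ξ)
    linarith
  refine (norm_le_sum_slot ξ).trans ?_
  rw [← Finset.add_sum_erase _ _ (Finset.mem_univ i₀)]
  have hr : 0 ≤ r := (norm_nonneg _).trans (h i₀)
  linarith

/-- The symbol `Φ_{i₀}(D(ξ_1 + ⋯ + ξ_l)) ∏_{i ≠ i₀} Φ_i(D ξ_i)`, in which the factors with index in
`J` are compressed by the factor `N` in the parameter `j₀`. -/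
noncomputable def symb (i₀ : Fin l) (j₀ : Fin d) (J : Finset (Fin l)) (Φ : Fin l → 𝓢(Phys d n, ℂ))
    {r : ℝ} (hΦ : ∀ i x, Φ i x ≠ 0 → ‖x‖ ≤ r) (N : ℕ) : 𝓢(Freq l d n, ℂ) :=
  SchwartzMap.compCLMOfContinuousLinearEquiv ℂ ((shear i₀).trans (freqScale j₀ J N)) (tensorS Φ hΦ)

theorem symb_apply (i₀ : Fin l) (j₀ : Fin d) (J : Finset (Fin l)) (Φ : Fin l → 𝓢(Phys d n, ℂ))
    {r : ℝ} (hΦ : ∀ i x, Φ i x ≠ 0 → ‖x‖ ≤ r) (N : ℕ) (ξ : Freq l d n) :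
    symb i₀ j₀ J Φ hΦ N ξ = ∏ i, Φ i (slot i (freqScale j₀ J N (shear i₀ ξ))) := rfl

theorem norm_le_of_symb_ne_zero {i₀ : Fin l} {j₀ : Fin d} {J : Finset (Fin l)}
    {Φ : Fin l → 𝓢(Phys d n, ℂ)} {r : ℝ} (hΦ : ∀ i x, Φ i x ≠ 0 → ‖x‖ ≤ r) {N : ℕ}
    {ξ : Freq l d n} (h : symb i₀ j₀ J Φ hΦ N ξ ≠ 0) : ‖ξ‖ ≤ 2 * l * r := by
  rw [symb_apply] at h
  refine norm_le_of_slot_shear (i₀ := i₀) fun i => ?_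
  have h1 := norm_le_of_prod_slot_ne_zero hΦ h i
  rw [slot_freqScale] at h1
  split_ifs at h1
  · exact (norm_le_norm_physScale j₀ N _).trans h1
  · exact h1

theorem det_dilC_ne_zero (κ : Fin d → ℤ) :
    LinearMap.det ((dilC κ : Freq l d n →L[ℝ] Freq l d n) : Freq l d n →ₗ[ℝ] Freq l d n) ≠ 0 := by
  have e : (dilC κ : Freq l d n →L[ℝ] Freq l d n) =
      (diagE (fun a : Fin l × Fin d × Fin n => (2 : ℝ) ^ κ a.2.1) (fun a => by positivity) :
        Freq l d n →L[ℝ] Freq l d n) := by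
    ext ξ a
    simp [dilate]
  rw [e]
  exact (LinearEquiv.isUnit_det' (diagE (fun a : Fin l × Fin d × Fin n => (2 : ℝ) ^ κ a.2.1)
    (fun a => by positivity)).toLinearEquiv).ne_zero

/-- The localized pieces of `symb` live on sets of volume about `N ^ (-|J| n)`, and each derivative
in the parameter `j₀` costs a factor `N`. -/
theorem eLpNorm_lift_view_symb_le {Θ : Fin d → 𝓢(Block l n, ℂ)}
    (hΘ : ∀ j ξ, 𝓕 (Θ j) ξ ≠ 0 → 1 / 2 ≤ ‖ξ‖ ∧ ‖ξ‖ ≤ 2) (ξ₀ : Freq l d n)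
    {s : Fin d → ℝ} (hs : ∀ j, 0 ≤ s j) {v : ℝ} (hv : 1 ≤ v) (i₀ : Fin l) (j₀ : Fin d)
    (J : Finset (Fin l)) {Φ : Fin l → 𝓢(Phys d n, ℂ)} {r : ℝ} (hΦ : ∀ i x, Φ i x ≠ 0 → ‖x‖ ≤ r) :
    ∃ C : ℝ≥0, ∀ κ ∈ nearScales d, ∀ N : ℕ, 1 ≤ N →
      eLpNorm (lift s (view hΘ ξ₀ κ (symb i₀ j₀ J Φ hΦ N))) (ENNReal.ofReal v) volume ≤
        C * ENNReal.ofReal ((N : ℝ) ^ (s j₀ - J.card * n / v)) := by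
  have hv' : (1 : ℝ≥0∞) ≤ ENNReal.ofReal v := by
    rw [← ENNReal.ofReal_one]; exact ENNReal.ofReal_le_ofReal hv
  have key : ∀ κ : Fin d → ℤ, ∃ C : ℝ≥0, ∀ N : ℕ, 1 ≤ N →
      eLpNorm (lift s (view hΘ ξ₀ κ (symb i₀ j₀ J Φ hΦ N))) (ENNReal.ofReal v) volume ≤
        C * ENNReal.ofReal ((N : ℝ) ^ (s j₀ - J.card * n / v)) := by
    intro κ
    let L : ℕ → Freq l d n →L[ℝ] Freq l d n := fun N =>
      (freqScale (n := n) j₀ J N : Freq l d n →L[ℝ] Freq l d n) ∘L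
        ((shear (d := d) (n := n) i₀ : Freq l d n →L[ℝ] Freq l d n) ∘L dilC κ)
    have hT : LinearMap.det ((shear (d := d) (n := n) i₀ : Freq l d n →L[ℝ] Freq l d n) :
        Freq l d n →ₗ[ℝ] Freq l d n) ≠ 0 :=
      (LinearEquiv.isUnit_det' (shear (d := d) (n := n) i₀).toLinearEquiv).ne_zero
    have hfam := scaledFamily_dilate (j₀ := j₀) hv' ENNReal.ofReal_ne_top (L := L)
      (fun N => freqScale j₀ J N (shear i₀ ξ₀))
      (mul_pos (abs_pos.2 hT) (abs_pos.2 (det_dilC_ne_zero (l := l) (n := n) κ))) (J.card * n) (fun N hN => ?_)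
      (fun a => ?_) (F := fun N => view hΘ ξ₀ κ (symb i₀ j₀ J Φ hΦ N)) (w := tensorS Φ hΦ)
      (X := cutoffS hΘ) (hasCompactSupport_cutoff hΘ) (fun N ξ => ?_)
    · obtain ⟨C, hC⟩ := hfam.lift hv' ENNReal.ofReal_ne_top hs
      refine ⟨C, fun N hN => (hC N hN).trans (le_of_eq ?_)⟩
      have hN0 : (0 : ℝ) < N := by exact_mod_cast hN
      rw [mul_assoc, ← ENNReal.ofReal_mul (by positivity), ← Real.rpow_add hN0,
        ENNReal.toReal_ofReal (by linarith)]
      congr 3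
      push_cast
      ring
    · have e : (L N : Freq l d n →ₗ[ℝ] Freq l d n) =
        ((freqScale (n := n) j₀ J N : Freq l d n →L[ℝ] Freq l d n) : Freq l d n →ₗ[ℝ] Freq l d n) ∘ₗ
          (((shear (d := d) (n := n) i₀ : Freq l d n →L[ℝ] Freq l d n) : Freq l d n →ₗ[ℝ] Freq l d n) ∘ₗ
            ((dilC κ : Freq l d n →L[ℝ] Freq l d n) : Freq l d n →ₗ[ℝ] Freq l d n)) := rfl
      rw [e, LinearMap.det_comp, LinearMap.det_comp, det_freqScale, abs_mul, abs_mul, sc_eq hN,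
        abs_of_nonneg (by positivity : (0 : ℝ) ≤ (N : ℝ) ^ (J.card * n))]
      ring
    · let t : Freq l d n := shear i₀ (dilate κ (basisVec a))
      let z : Freq l d n := WithLp.toLp 2 fun b => if b.2.1 = j₀ ∧ b.1 ∈ J then t b else 0
      refine ⟨t - z, z, fun ha => ?_, fun N hN => ?_⟩
      · ext b
        simp only [z, PiLp.zero_apply, ite_eq_right_iff, and_imp]
        intro hb _
        have hne : ∀ i, (i, b.2) ≠ a := fun i h => ha (by rw [← h]; exact hb)
        simp [t, shear_apply, dilate, basisVec, hne]
      · ext b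
        change freqScale j₀ J N t b = t b - z b + N * z b
        simp only [freqScale, diagE_apply, z]
        split_ifs
        · rw [sc_eq hN]; ring
        · ring
    · rw [view_apply, symb_apply, tensorS_apply, map_sub, map_sub]
      rfl
  choose C hC using key
  refine ⟨∑ κ ∈ nearScales d, C κ, fun κ hκ N hN => (hC κ N hN).trans ?_⟩
  gcongr
  exact Finset.single_le_sum (f := C) (fun _ _ => zero_le) hκ

end Symbols

/-! ### The localized inequality and the test data -/

section Tools

variable {l d n : ℕ}

/-- Comparison of the growth of two powers. -/
theorem exponent_le_of_forall {a b : ℝ} {c C : ℝ≥0∞} (hc : c ≠ 0) (hC : C ≠ ⊤) (N₀ : ℕ)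
    (h : ∀ N : ℕ, N₀ ≤ N → 1 ≤ N →
      c * ENNReal.ofReal ((N : ℝ) ^ a) ≤ C * ENNReal.ofReal ((N : ℝ) ^ b)) : a ≤ b := by
  by_contra hlt
  have h1 : Filter.Tendsto (fun N : ℕ => C * ENNReal.ofReal ((N : ℝ) ^ (-(a - b))))
      Filter.atTop (nhds 0) := by
    have h2 := (tendsto_rpow_neg_atTop (y := a - b) (by linarith)).comp
      (tendsto_natCast_atTop_atTop (R := ℝ))
    have h3 := ENNReal.Tendsto.const_mul (a := C) (ENNReal.tendsto_ofReal h2) (Or.inr hC)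
    simpa using h3
  refine hc (le_antisymm (ge_of_tendsto h1 ?_) (zero_le))
  filter_upwards [Filter.eventually_ge_atTop N₀, Filter.eventually_ge_atTop 1] with N hN hN1
  have hN0 : (0 : ℝ) < N := by exact_mod_cast hN1
  have h4 := mul_le_mul_left (h N hN hN1) (ENNReal.ofReal ((N : ℝ) ^ (-a)))
  rw [mul_assoc, mul_assoc, ← ENNReal.ofReal_mul (by positivity),
    ← ENNReal.ofReal_mul (by positivity), ← Real.rpow_add hN0, ← Real.rpow_add hN0] at h4
  simpa [← sub_eq_add_neg] using h4

/-- The data of the test functions: a band-limited nonnegative function together with a lower bound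
near the origin. -/
theorem exists_kernel {r : ℝ} (hr : 0 < r) :
    ∃ (g : 𝓢(Phys d n, ℂ)) (ρ : Phys d n → ℝ) (γ δ : ℝ), (∀ x, g x = ρ x) ∧ (∀ x, 0 ≤ ρ x) ∧
      (∀ ξ, 𝓕 g ξ ≠ 0 → ‖ξ‖ ≤ r) ∧ 0 < γ ∧ 0 < δ ∧ ∀ x, ‖x‖ ≤ 2 * δ → γ ≤ ρ x := by
  obtain ⟨g, ρ, h1, h2, h3, h4⟩ := exists_nonneg_bandlimited (E := Phys d n) hr
  have hcont : Continuous ρ := by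
    have : ρ = fun x => (g x).re := by funext x; rw [h1, Complex.ofReal_re]
    rw [this]
    exact Complex.continuous_re.comp g.continuous
  have h5 : ∀ᶠ x in nhds (0 : Phys d n), ρ 0 / 2 < ρ x :=
    hcont.continuousAt.eventually (lt_mem_nhds (by linarith))
  obtain ⟨ε, hε, h6⟩ := Metric.eventually_nhds_iff.1 h5
  refine ⟨g, ρ, ρ 0 / 2, ε / 4, h1, h2, h4, by linarith, by linarith, fun x hx => (h6 ?_).le⟩
  rw [dist_zero_right]
  linarith

theorem le_norm_integral_of_nonneg {E : Type*} [MeasurableSpace E] {μ : Measure E} {F : E → ℂ}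
    (hF : Integrable F μ) {φ : E → ℝ} (hFφ : ∀ y, F y = φ y) (h0 : ∀ y, 0 ≤ φ y) {A : Set E}
    (hA : MeasurableSet A) (hA' : μ A ≠ ⊤) {c : ℝ} (hc : ∀ y ∈ A, c ≤ φ y) :
    c * μ.real A ≤ ‖∫ y, F y ∂μ‖ := by
  have h1 : Integrable φ μ := by
    have := hF.re
    refine this.congr (Filter.Eventually.of_forall fun y => ?_)
    simp [hFφ]
  have h2 : ∫ y, F y ∂μ = ((∫ y, φ y ∂μ : ℝ) : ℂ) := by
    rw [← integral_complex_ofReal]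
    exact integral_congr_ae (Filter.Eventually.of_forall hFφ)
  rw [h2, Complex.norm_real, Real.norm_of_nonneg (integral_nonneg h0)]
  calc c * μ.real A = ∫ _y in A, c ∂μ := by simp [mul_comm]
    _ ≤ ∫ y in A, φ y ∂μ :=
        setIntegral_mono_on (integrableOn_const hA') h1.integrableOn hA hc
    _ ≤ ∫ y, φ y ∂μ := setIntegral_le_integral h1 (Filter.Eventually.of_forall h0)

/-- A function that is bounded below on the `N`-fold expansion of a ball. -/
theorem le_eLpNorm_of_expanded_ball (j₀ : Fin d) {N : ℕ} (hN : 1 ≤ N) {h : Phys d n → ℂ} {c δ p : ℝ}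
    (hp : 0 < p) (hh : ∀ z, ‖z‖ ≤ δ → c ≤ ‖h (physScale j₀ N z)‖) :
    ENNReal.ofReal c * volume (Metric.closedBall (0 : Phys d n) δ) ^ (1 / p) *
      ENNReal.ofReal ((N : ℝ) ^ (n / p)) ≤ eLpNorm h (ENNReal.ofReal p) volume := by
  have h1 : ENNReal.ofReal c * volume (Metric.closedBall (0 : Phys d n) δ) ^ (1 / p) ≤
      eLpNorm (fun z => h (physScale j₀ N z)) (ENNReal.ofReal p) volume := by
    have h2 := eLpNorm_indicator_const (μ := (volume : Measure (Phys d n))) (c := max c 0)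
      (p := ENNReal.ofReal p) (measurableSet_closedBall (x := (0 : Phys d n)) (ε := δ))
      (by simpa using hp) ENNReal.ofReal_ne_top
    rw [ENNReal.toReal_ofReal hp.le] at h2
    have e : ‖max c 0‖ₑ = ENNReal.ofReal c := by
      rw [Real.enorm_of_nonneg (le_max_right _ _)]
      rcases le_total c 0 with h | h
      · rw [max_eq_right h, ENNReal.ofReal_zero, ENNReal.ofReal_of_nonpos h]
      · rw [max_eq_left h]
    rw [← e, ← h2]
    refine eLpNorm_mono fun z => ?_
    by_cases hz : z ∈ Metric.closedBall (0 : Phys d n) δ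
    · rw [Set.indicator_of_mem hz, Real.norm_of_nonneg (le_max_right _ _)]
      exact max_le (hh z (mem_closedBall_zero_iff.1 hz)) (norm_nonneg _)
    · rw [Set.indicator_of_notMem hz, norm_zero]
      exact norm_nonneg _
  have h3 := eLpNorm_comp_physScale j₀ hN h hp
  have hN0 : (0 : ℝ) < N := by exact_mod_cast hN
  rw [h3] at h1
  calc _ ≤ ENNReal.ofReal ((N : ℝ) ^ (-(n / p))) * eLpNorm h (ENNReal.ofReal p) volume *
        ENNReal.ofReal ((N : ℝ) ^ (n / p)) := by gcongr
    _ = eLpNorm h (ENNReal.ofReal p) volume := by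
      rw [mul_right_comm, ← ENNReal.ofReal_mul (by positivity), ← Real.rpow_add hN0]
      simp

variable {Θ : Fin d → 𝓢(Block l n, ℂ)}

theorem view_sum (hΘ : ∀ j ξ, 𝓕 (Θ j) ξ ≠ 0 → 1 / 2 ≤ ‖ξ‖ ∧ ‖ξ‖ ≤ 2) (ξ₀ : Freq l d n)
    (κ : Fin d → ℤ) {ι : Type*} (Λ : Finset ι) (b : ι → ℂ) (m : ι → 𝓢(Freq l d n, ℂ)) :
    view hΘ ξ₀ κ (∑ k ∈ Λ, b k • m k) = ∑ k ∈ Λ, b k • view hΘ ξ₀ κ (m k) := by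
  ext ξ
  simp only [view_apply, sum_apply, smul_apply, smul_eq_mul, Finset.sum_mul, mul_assoc]

/-- The multiplier inequality, tested on smooth symbols supported near the origin that are moved to
the point `ξ₀`. -/
def LocalBound (hΘ : ∀ j ξ, 𝓕 (Θ j) ξ ≠ 0 → 1 / 2 ≤ ‖ξ‖ ∧ ‖ξ‖ ≤ 2) (ξ₀ : Freq l d n)
    (s : Fin d → ℝ) (u p : ℝ) (q : Fin l → ℝ) : Prop :=
  ∃ C : ℝ≥0, ∀ m : 𝓢(Freq l d n, ℂ), (∀ ξ, m ξ ≠ 0 → ‖ξ‖ ≤ 1 / 2) → ∀ B : ℝ≥0∞, B < ⊤ →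
    (∀ κ ∈ nearScales d, eLpNorm (lift s (view hΘ ξ₀ κ m)) (ENNReal.ofReal u) volume ≤ B) →
    ∀ f : Fin l → 𝓢(Phys d n, ℂ), eLpNorm (multiplierOp m f) (ENNReal.ofReal p) volume ≤
      C * B * ∏ i, eLpNorm (f i) (ENNReal.ofReal (q i)) volume

/-- The radius that keeps the symbols in the ball of radius `1 / 2`. -/
noncomputable def rad (l : ℕ) : ℝ := 1 / (4 * l)

theorem rad_pos (i₀ : Fin l) : 0 < rad l := by
  have : (0 : ℝ) < l := by exact_mod_cast i₀.pos
  unfold rad; positivity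

theorem two_mul_rad (i₀ : Fin l) : 2 * l * rad l = 1 / 2 := by
  have : (l : ℝ) ≠ 0 := by exact_mod_cast i₀.pos.ne'
  unfold rad; field_simp; norm_num

/-- The radius of the frequency supports of the test functions: a sum of `l` frequencies of that
size stays in the region where the plateau function is `1`. -/
noncomputable def testRad (l : ℕ) : ℝ := rad l / 2 / l

theorem testRad_pos (i₀ : Fin l) : 0 < testRad l := by
  have : (0 : ℝ) < l := by exact_mod_cast i₀.pos
  have := rad_pos i₀
  unfold testRad; positivity

theorem mul_testRad (i₀ : Fin l) : l * testRad l = rad l / 2 := by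
  have : (l : ℝ) ≠ 0 := by exact_mod_cast i₀.pos.ne'
  unfold testRad; field_simp

theorem testRad_le (i₀ : Fin l) : testRad l ≤ rad l / 2 := by
  rw [← mul_testRad i₀]
  have h := (testRad_pos i₀).le
  have : (1 : ℝ) ≤ l := by exact_mod_cast i₀.pos
  nlinarith

/-- A smooth function that is `1` on the ball of radius `rad l / 2` and vanishes outside the ball of
radius `rad l`. -/
noncomputable def plateau (i₀ : Fin l) : 𝓢(Phys d n, ℂ) :=
  bumpS ⟨rad l / 2, rad l, half_pos (rad_pos i₀), half_lt_self (rad_pos i₀)⟩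

theorem plateau_eq_one (i₀ : Fin l) {x : Phys d n} (hx : ‖x‖ ≤ rad l / 2) : plateau i₀ x = 1 := by
  rw [plateau, bumpS_apply, ContDiffBump.one_of_mem_closedBall _ (mem_closedBall_zero_iff.2 hx)]
  simp

theorem norm_le_of_plateau_ne_zero (i₀ : Fin l) {x : Phys d n} (hx : plateau i₀ x ≠ 0) :
    ‖x‖ ≤ rad l := by
  by_contra hlt
  refine hx ?_
  rw [plateau, bumpS_apply, ContDiffBump.zero_of_le_dist]
  · simp
  · rw [dist_zero_right]; exact (not_le.1 hlt).le

end Tools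

/-! ### Testing on kernels at a large scale -/

section Kernel

variable {l d n : ℕ}

theorem integrable_kernel_mul {K : Phys d n → ℂ} (hK : Integrable K) (f : Fin l → 𝓢(Phys d n, ℂ))
    (x : Phys d n) : Integrable (fun y => K (x - y) * ∏ i, f i y) := by
  refine (hK.comp_sub_left x).mul_bdd (c := ∏ i, SchwartzMap.seminorm ℝ 0 0 (f i)) ?_ ?_
  · exact (continuous_finsetProd _ fun i _ => (f i).continuous).aestronglyMeasurable
  · refine Filter.Eventually.of_forall fun y => ?_
    rw [norm_prod]
    exact Finset.prod_le_prod (fun _ _ => norm_nonneg _) fun i _ =>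
      SchwartzMap.norm_le_seminorm ℝ (f i) y

/-- If on the frequency support of the inputs the symbol depends on `ξ_1 + ⋯ + ξ_l` only, then the
operator is the convolution of the product of the inputs with a kernel. -/
theorem multiplierOp_eq_convolution {K : Phys d n → ℂ} (hK : Integrable K) {m : Freq l d n → ℂ}
    {f h : Fin l → 𝓢(Phys d n, ℂ)}
    (hm : ∀ ξ, m ξ * ∏ i, 𝓕 (f i) (slot i ξ) =
      𝓕 K (∑ i, slot i ξ) * ∏ i, 𝓕 (h i) (slot i ξ)) (x : Phys d n) :
    multiplierOp m f x = ∫ y, K (x - y) * ∏ i, h i y := by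
  rw [multiplierOp_eq, ← integral_fourier_sum_slot hK]
  simp_rw [hm]

/-- The factors of the symbols that act as a convolution with `g`. -/
noncomputable def kernelFactors (i₀ : Fin l) (g : 𝓢(Phys d n, ℂ)) : Fin l → 𝓢(Phys d n, ℂ) :=
  Function.update (fun _ => plateau i₀) i₀ (𝓕 g)

theorem norm_le_of_kernelFactors_ne_zero {i₀ : Fin l} {g : 𝓢(Phys d n, ℂ)}
    (hg : ∀ ξ, 𝓕 g ξ ≠ 0 → ‖ξ‖ ≤ testRad l) (i : Fin l) (x : Phys d n)
    (h : kernelFactors i₀ g i x ≠ 0) : ‖x‖ ≤ rad l := by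
  by_cases hi : i = i₀
  · subst hi
    rw [kernelFactors, Function.update_self] at h
    have := rad_pos i
    linarith [hg x h, testRad_le i]
  · rw [kernelFactors, Function.update_of_ne hi] at h
    exact norm_le_of_plateau_ne_zero i₀ h

/-- The inputs of the test: those with index in `I` are spread out at scale `N` in the parameter
`j₀`. -/
noncomputable def testInput (j₀ : Fin d) (I : Finset (Fin l)) (g : 𝓢(Phys d n, ℂ)) (N : ℕ)
    (i : Fin l) : 𝓢(Phys d n, ℂ) :=
  if i ∈ I then spread j₀ N g else g

theorem prod_eLpNorm_testInput (j₀ : Fin d) (I : Finset (Fin l)) (g : 𝓢(Phys d n, ℂ)) {N : ℕ}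
    (hN : 1 ≤ N) {q : Fin l → ℝ} (hq : ∀ i, 0 < q i) :
    ∏ i, eLpNorm (testInput j₀ I g N i) (ENNReal.ofReal (q i)) volume =
      ENNReal.ofReal ((N : ℝ) ^ (∑ i ∈ I, n / q i)) *
        ∏ i, eLpNorm g (ENNReal.ofReal (q i)) volume := by
  have hN0 : (0 : ℝ) < N := by exact_mod_cast hN
  have h : ∀ i, eLpNorm (testInput j₀ I g N i) (ENNReal.ofReal (q i)) volume =
      (if i ∈ I then ENNReal.ofReal ((N : ℝ) ^ (n / q i)) else 1) *
        eLpNorm g (ENNReal.ofReal (q i)) volume := by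
    intro i
    rw [testInput]
    split_ifs with hi
    · exact eLpNorm_comp_physScale_symm j₀ hN g (hq i)
    · rw [one_mul]
  simp_rw [h]
  rw [Finset.prod_mul_distrib, Finset.prod_ite_mem, Finset.univ_inter,
    ← ENNReal.ofReal_prod_of_nonneg (fun i _ => by positivity),
    Real.rpow_sum_of_pos hN0]

/-- The kernel `N ^ (-n) g(x_1, …, x_{j₀} / N, …, x_d)`. -/
noncomputable def kernelAt (j₀ : Fin d) (g : 𝓢(Phys d n, ℂ)) (N : ℕ) : 𝓢(Phys d n, ℂ) :=
  (((sc N ^ n)⁻¹ : ℝ) : ℂ) • spread j₀ N g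

theorem fourier_kernelAt (j₀ : Fin d) (g : 𝓢(Phys d n, ℂ)) (N : ℕ) (ξ : Phys d n) :
    𝓕 (kernelAt j₀ g N) ξ = 𝓕 g (physScale j₀ N ξ) := by
  rw [kernelAt, FourierTransform.fourier_smul, smul_apply, fourier_spread, smul_eq_mul, ← mul_assoc,
    ← Complex.ofReal_mul, inv_mul_cancel₀ (pow_pos (sc_pos N) n).ne']
  simp

theorem symb_kernelFactors_mul (i₀ : Fin l) (j₀ : Fin d) (I : Finset (Fin l))
    {g : 𝓢(Phys d n, ℂ)} (hg : ∀ ξ, 𝓕 g ξ ≠ 0 → ‖ξ‖ ≤ testRad l) (N : ℕ) (ξ : Freq l d n) :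
    symb i₀ j₀ (insert i₀ I) (kernelFactors i₀ g) (norm_le_of_kernelFactors_ne_zero hg) N ξ *
        ∏ i, 𝓕 (testInput j₀ I g N i) (slot i ξ) =
      𝓕 (kernelAt j₀ g N) (∑ i, slot i ξ) * ∏ i, 𝓕 (testInput j₀ I g N i) (slot i ξ) := by
  by_cases h0 : ∏ i, 𝓕 (testInput j₀ I g N i) (slot i ξ) = 0
  · rw [h0, mul_zero, mul_zero]
  congr 1
  rw [symb_apply, ← Finset.mul_prod_erase _ _ (Finset.mem_univ i₀), Finset.prod_eq_one, mul_one,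
    slot_freqScale, if_pos (Finset.mem_insert_self _ _), slot_shear_self, fourier_kernelAt,
    kernelFactors, Function.update_self]
  intro i hi
  have hne := Finset.ne_of_mem_erase hi
  have h1 : 𝓕 (testInput j₀ I g N i) (slot i ξ) ≠ 0 :=
    fun h => h0 (Finset.prod_eq_zero (Finset.mem_univ i) h)
  rw [kernelFactors, Function.update_of_ne hne, slot_freqScale, slot_shear_of_ne hne]
  refine plateau_eq_one i₀ (le_trans ?_ (testRad_le i₀))
  by_cases hiI : i ∈ I
  · rw [if_pos (Finset.mem_insert_of_mem hiI)]
    rw [testInput, if_pos hiI, fourier_spread] at h1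
    exact hg _ (right_ne_zero_of_mul h1)
  · rw [if_neg (by simp [hne, hiI])]
    rw [testInput, if_neg hiI] at h1
    exact hg _ h1

theorem norm_physScale_symm_le (j₀ : Fin d) (N : ℕ) (x : Phys d n) :
    ‖(physScale j₀ N).symm x‖ ≤ ‖x‖ := by
  have := norm_le_norm_physScale j₀ N ((physScale j₀ N).symm x)
  rwa [ContinuousLinearEquiv.apply_symm_apply] at this

/-- The output of the test is of size `N ^ (-n)` on a ball expanded by the factor `N`. -/
theorem le_norm_multiplierOp_testInput (i₀ : Fin l) (j₀ : Fin d) (I : Finset (Fin l))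
    {g : 𝓢(Phys d n, ℂ)} (hg : ∀ ξ, 𝓕 g ξ ≠ 0 → ‖ξ‖ ≤ testRad l) {ρ : Phys d n → ℝ} {γ δ : ℝ}
    (hρ : ∀ x, g x = ρ x) (hρ0 : ∀ x, 0 ≤ ρ x) (hγ : 0 < γ) (hδ : 0 < δ)
    (hργ : ∀ x, ‖x‖ ≤ 2 * δ → γ ≤ ρ x) (N : ℕ) {z : Phys d n} (hz : ‖z‖ ≤ δ) :
    (sc N ^ n)⁻¹ * γ ^ (l + 1) * volume.real (Metric.closedBall (0 : Phys d n) δ) ≤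
      ‖multiplierOp (symb i₀ j₀ (insert i₀ I) (kernelFactors i₀ g)
        (norm_le_of_kernelFactors_ne_zero hg) N) (testInput j₀ I g N) (physScale j₀ N z)‖ := by
  rw [multiplierOp_eq_convolution (K := kernelAt j₀ g N) (SchwartzMap.integrable _)
    (h := testInput j₀ I g N) fun ξ => symb_kernelFactors_mul i₀ j₀ I hg N ξ]
  have hsc := inv_pos.2 (pow_pos (sc_pos N) n)
  have hin : ∀ i y, testInput j₀ I g N i y =
      ρ (if i ∈ I then (physScale j₀ N).symm y else y) := by
    intro i y
    rw [testInput]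
    split_ifs
    · rw [spread_apply, hρ]
    · rw [hρ]
  refine le_norm_integral_of_nonneg (integrable_kernel_mul (SchwartzMap.integrable _) _ _)
    (φ := fun y => (sc N ^ n)⁻¹ * ρ (z - (physScale j₀ N).symm y) *
      ∏ i, ρ (if i ∈ I then (physScale j₀ N).symm y else y)) (fun y => ?_) (fun y => ?_)
    Metric.isClosed_closedBall.measurableSet measure_closedBall_lt_top.ne fun y hy => ?_
  · simp_rw [hin]
    rw [kernelAt, smul_apply, spread_apply, map_sub, ContinuousLinearEquiv.symm_apply_apply, hρ]
    push_cast
    rfl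
  · exact mul_nonneg (mul_nonneg hsc.le (hρ0 _)) (Finset.prod_nonneg fun i _ => hρ0 _)
  · rw [mem_closedBall_zero_iff] at hy
    have hy' := (norm_physScale_symm_le j₀ N y).trans hy
    rw [pow_succ', ← mul_assoc]
    have h1 : γ ≤ ρ (z - (physScale j₀ N).symm y) :=
      hργ _ ((norm_sub_le _ _).trans (by linarith))
    have h2 : γ ^ l ≤ ∏ i : Fin l, ρ (if i ∈ I then (physScale j₀ N).symm y else y) := by
      rw [← Fin.prod_const]
      refine Finset.prod_le_prod (fun _ _ => hγ.le) fun i _ => hργ _ ?_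
      split_ifs <;> linarith
    gcongr
    exact mul_nonneg hsc.le (hρ0 _)

variable {Θ : Fin d → 𝓢(Block l n, ℂ)} {hΘ : ∀ j ξ, 𝓕 (Θ j) ξ ≠ 0 → 1 / 2 ≤ ‖ξ‖ ∧ ‖ξ‖ ≤ 2}
  {ξ₀ : Freq l d n} {s : Fin d → ℝ} {u p : ℝ} {q : Fin l → ℝ}

theorem symb_support {i₀ : Fin l} {j₀ : Fin d} {J : Finset (Fin l)} {Φ : Fin l → 𝓢(Phys d n, ℂ)}
    (hΦ : ∀ i x, Φ i x ≠ 0 → ‖x‖ ≤ rad l) {N : ℕ} {ξ : Freq l d n}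
    (h : symb i₀ j₀ J Φ hΦ N ξ ≠ 0) : ‖ξ‖ ≤ 1 / 2 := by
  rw [← two_mul_rad i₀]
  exact norm_le_of_symb_ne_zero hΦ h

/-- Testing on a convolution whose kernel, like the inputs with index in `I`, lives at a large scale
`N` in one parameter. -/
theorem LocalBound.exponent_le (hloc : LocalBound hΘ ξ₀ s u p q) (hs : ∀ j, 0 ≤ s j) (hu : 1 ≤ u)
    (hp : 0 < p) (hq : ∀ i, 1 < q i) (j₀ : Fin d) {I : Finset (Fin l)} {i₀ : Fin l} (hI : i₀ ∉ I) :
    n / p - n ≤ s j₀ - (I.card + 1) * n / u + ∑ i ∈ I, n / q i := by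
  obtain ⟨g, ρ, γ, δ, hρ, hρ0, hg, hγ, hδ, hργ⟩ := exists_kernel (d := d) (n := n) (testRad_pos i₀)
  obtain ⟨C, hC⟩ := hloc
  obtain ⟨C', hC'⟩ := eLpNorm_lift_view_symb_le hΘ ξ₀ hs hu i₀ j₀ (insert i₀ I)
    (norm_le_of_kernelFactors_ne_zero hg)
  have hvol : 0 < volume.real (Metric.closedBall (0 : Phys d n) δ) :=
    ENNReal.toReal_pos (Metric.measure_closedBall_pos _ _ hδ).ne' measure_closedBall_lt_top.ne
  refine exponent_le_of_forall
    (c := ENNReal.ofReal (γ ^ (l + 1) * volume.real (Metric.closedBall (0 : Phys d n) δ)) *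
      volume (Metric.closedBall (0 : Phys d n) δ) ^ (1 / p))
    (C := C * C' * ∏ i, eLpNorm g (ENNReal.ofReal (q i)) volume) ?_ ?_ 0 fun N _ hN => ?_
  · refine mul_ne_zero ?_ ?_
    · rw [Ne, ENNReal.ofReal_eq_zero, not_le]; positivity
    · exact (ENNReal.rpow_pos (Metric.measure_closedBall_pos _ _ hδ)
        measure_closedBall_lt_top.ne).ne'
  · exact ENNReal.mul_ne_top (ENNReal.mul_ne_top ENNReal.coe_ne_top ENNReal.coe_ne_top)
      (ENNReal.prod_ne_top fun i _ => (g.memLp _ volume).2.ne)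
  · have hN0 : (0 : ℝ) < N := by exact_mod_cast hN
    have h1 := le_eLpNorm_of_expanded_ball j₀ hN hp fun z hz =>
      le_norm_multiplierOp_testInput i₀ j₀ I hg hρ hρ0 hγ hδ hργ N hz
    have h2 := hC _ (fun ξ hξ => symb_support (norm_le_of_kernelFactors_ne_zero hg) hξ) _
      (ENNReal.mul_lt_top ENNReal.coe_lt_top ENNReal.ofReal_lt_top)
      (fun κ hκ => hC' κ hκ N hN) (testInput j₀ I g N)
    rw [prod_eLpNorm_testInput j₀ I g hN fun i => zero_lt_one.trans (hq i)] at h2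
    have h3 := h1.trans h2
    have e1 : ENNReal.ofReal ((sc N ^ n)⁻¹ * γ ^ (l + 1) *
        volume.real (Metric.closedBall (0 : Phys d n) δ)) = ENNReal.ofReal ((N : ℝ) ^ (-(n : ℝ))) *
        ENNReal.ofReal (γ ^ (l + 1) * volume.real (Metric.closedBall (0 : Phys d n) δ)) := by
      rw [← ENNReal.ofReal_mul (by positivity), sc_eq hN, Real.rpow_neg hN0.le, Real.rpow_natCast,
        mul_assoc]
    have e2 : ENNReal.ofReal ((N : ℝ) ^ ((n : ℝ) / p - n)) =
        ENNReal.ofReal ((N : ℝ) ^ (-(n : ℝ))) * ENNReal.ofReal ((N : ℝ) ^ ((n : ℝ) / p)) := by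
      rw [← ENNReal.ofReal_mul (by positivity), ← Real.rpow_add hN0]; ring_nf
    have e3 : ENNReal.ofReal ((N : ℝ) ^ (s j₀ - (I.card + 1) * n / u + ∑ i ∈ I, n / q i)) =
        ENNReal.ofReal ((N : ℝ) ^ (s j₀ - (insert i₀ I).card * n / u)) *
          ENNReal.ofReal ((N : ℝ) ^ (∑ i ∈ I, n / q i)) := by
      rw [← ENNReal.ofReal_mul (by positivity), ← Real.rpow_add hN0,
        Finset.card_insert_of_notMem hI]
      push_cast; ring_nf
    rw [e1] at h3
    rw [e2, e3]
    calc _ = _ := by ring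
      _ ≤ _ := h3
      _ = _ := by ring

end Kernel

/-! ### Sparse sums in `L^u` -/

section Sparse

/-- The coefficient of `a ^ u` is exactly `1`, so that the inequality can be iterated. -/
theorem add_rpow_le_three {a b u : ℝ} (ha : 0 ≤ a) (hb : 0 ≤ b) (hu : 1 ≤ u) :
    (a + b) ^ u ≤ a ^ u + u * 2 ^ u * (a ^ (u - 1) * b) + u * 2 ^ u * b ^ u := by
  have h2 : (0 : ℝ) ≤ u * 2 ^ u := by positivity
  rcases le_or_gt b a with h | h
  · rcases ha.eq_or_lt with rfl | ha'
    · obtain rfl : b = 0 := le_antisymm h hb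
      simp [Real.zero_rpow (by linarith : u ≠ 0)]
    have hx : 0 < a + b := by linarith
    have h1 := one_add_mul_self_le_rpow_one_add (s := -(b / (a + b)))
      (by rw [neg_le_neg_iff, div_le_one hx]; linarith) hu
    have e : 1 + -(b / (a + b)) = a / (a + b) := by field_simp; ring
    rw [e, Real.div_rpow ha hx.le, le_div_iff₀ (Real.rpow_pos_of_pos hx u)] at h1
    have e2 : (a + b) ^ u = (a + b) ^ (u - 1) * (a + b) := by
      rw [← Real.rpow_add_one hx.ne']; ring_nf
    have e3 : b / (a + b) * (a + b) ^ u = b * (a + b) ^ (u - 1) := by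
      rw [e2]; field_simp
    have h3 : (a + b) ^ (u - 1) ≤ 2 ^ u * a ^ (u - 1) := by
      calc (a + b) ^ (u - 1) ≤ (2 * a) ^ (u - 1) :=
            Real.rpow_le_rpow hx.le (by linarith) (by linarith)
        _ = 2 ^ (u - 1) * a ^ (u - 1) := Real.mul_rpow (by norm_num) ha
        _ ≤ 2 ^ u * a ^ (u - 1) := by
          gcongr
          · norm_num
          · linarith
    have h4 : u * (b * (a + b) ^ (u - 1)) ≤ u * (b * (2 ^ u * a ^ (u - 1))) := by gcongr
    have h5 : 0 ≤ u * 2 ^ u * b ^ u := by positivity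
    nlinarith
  · have h1 : (a + b) ^ u ≤ 2 ^ u * b ^ u := by
      rw [← Real.mul_rpow (by norm_num) hb]
      exact Real.rpow_le_rpow (by linarith) (by linarith) (by linarith)
    have h3 : 2 ^ u * b ^ u ≤ u * 2 ^ u * b ^ u := by
      have : (0 : ℝ) ≤ 2 ^ u * b ^ u := by positivity
      nlinarith
    have h4 : 0 ≤ a ^ u := by positivity
    have h5 : 0 ≤ u * 2 ^ u * (a ^ (u - 1) * b) := by positivity
    linarith

variable {V : Type*} [NormedAddCommGroup V] [NormedSpace ℝ V] [MeasurableSpace V] [BorelSpace V]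
  {μ : Measure V}

theorem lintegral_add_rpow_le (S F : 𝓢(V, ℂ)) {u : ℝ} (hu : 1 ≤ u) :
    ∫⁻ x, ‖(S + F) x‖ₑ ^ u ∂μ ≤ ∫⁻ x, ‖S x‖ₑ ^ u ∂μ +
      ENNReal.ofReal (u * 2 ^ u * SchwartzMap.seminorm ℝ 0 0 S ^ (u - 1)) * ∫⁻ x, ‖F x‖ₑ ∂μ +
      ENNReal.ofReal (u * 2 ^ u) * ∫⁻ x, ‖F x‖ₑ ^ u ∂μ := by
  have hF : Measurable fun x => ‖F x‖ₑ := F.continuous.enorm.measurable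
  have hS : Measurable fun x => ‖S x‖ₑ := S.continuous.enorm.measurable
  rw [← lintegral_const_mul _ hF, ← lintegral_const_mul _ (hF.pow_const u),
    ← lintegral_add_left (hS.pow_const u), ← lintegral_add_right _ ((hF.pow_const u).const_mul _)]
  refine lintegral_mono fun x => ?_
  have hu0 : 0 ≤ u := by linarith
  simp only [← ofReal_norm]
  rw [ENNReal.ofReal_rpow_of_nonneg (norm_nonneg _) hu0,
    ENNReal.ofReal_rpow_of_nonneg (norm_nonneg _) hu0,
    ENNReal.ofReal_rpow_of_nonneg (norm_nonneg _) hu0, ← ENNReal.ofReal_mul (by positivity),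
    ← ENNReal.ofReal_mul (by positivity), ← ENNReal.ofReal_add (by positivity) (by positivity),
    ← ENNReal.ofReal_add (by positivity) (by positivity)]
  refine ENNReal.ofReal_le_ofReal ?_
  have h1 : ‖(S + F) x‖ ^ u ≤ (‖S x‖ + ‖F x‖) ^ u :=
    Real.rpow_le_rpow (norm_nonneg _) (norm_add_le _ _) hu0
  have h2 := add_rpow_le_three (norm_nonneg (S x)) (norm_nonneg (F x)) hu
  have h3 : ‖S x‖ ^ (u - 1) ≤ SchwartzMap.seminorm ℝ 0 0 S ^ (u - 1) :=
    Real.rpow_le_rpow (norm_nonneg _) (SchwartzMap.norm_le_seminorm ℝ S x) (by linarith)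
  have h4 : u * 2 ^ u * (‖S x‖ ^ (u - 1) * ‖F x‖) ≤
      u * 2 ^ u * SchwartzMap.seminorm ℝ 0 0 S ^ (u - 1) * ‖F x‖ := by
    rw [← mul_assoc]; gcongr
  linarith

/-- Functions that are bounded in `L^u` and tend to zero in `L^1` behave, along sparse sets of
indices, as if they had disjoint supports: the `u`-th powers of the norms add up. -/
theorem exists_sparse {ι : Type*} (K : Finset ι) (F : ι → ℕ → 𝓢(V, ℂ)) {u : ℝ} (hu : 1 ≤ u)
    {C : ℝ≥0} (h1 : ∀ κ ∈ K, ∀ N, 1 ≤ N → ∫⁻ x, ‖F κ N x‖ₑ ^ u ∂μ ≤ C)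
    (h2 : ∀ κ ∈ K, Filter.Tendsto (fun N => ∫⁻ x, ‖F κ N x‖ₑ ∂μ) Filter.atTop (nhds 0)) :
    ∃ C' : ℝ≥0, ∀ k : ℕ, ∃ Λ : Finset ℕ, Λ.card = k ∧
      ∀ κ ∈ K, ∫⁻ x, ‖(∑ N ∈ Λ, F κ N) x‖ₑ ^ u ∂μ ≤ k * C' := by
  refine ⟨1 + Real.toNNReal (u * 2 ^ u) * C, fun k => ?_⟩
  induction k with
  | zero =>
    refine ⟨∅, rfl, fun κ _ => ?_⟩
    simp [ENNReal.zero_rpow_of_pos (by linarith : 0 < u)]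
  | succ k ih =>
    obtain ⟨Λ, hc, hk⟩ := ih
    -- the mixed term is controlled by the `L^1` norm of the new function, since `∑ N ∈ Λ, F κ N` is
    -- bounded; so every large enough `N` may be added to `Λ`
    have h3 : ∀ κ ∈ K, ∀ᶠ N in Filter.atTop,
        ENNReal.ofReal (u * 2 ^ u * SchwartzMap.seminorm ℝ 0 0 (∑ N ∈ Λ, F κ N) ^ (u - 1)) *
          ∫⁻ x, ‖F κ N x‖ₑ ∂μ ≤ 1 := by
      intro κ hκ
      have h := ENNReal.Tendsto.const_mul (a := ENNReal.ofReal (u * 2 ^ u *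
        SchwartzMap.seminorm ℝ 0 0 (∑ N ∈ Λ, F κ N) ^ (u - 1))) (h2 κ hκ)
        (Or.inr ENNReal.ofReal_ne_top)
      rw [mul_zero] at h
      exact (h.eventually (gt_mem_nhds zero_lt_one)).mono fun N hN => hN.le
    obtain ⟨N, hN, hNΛ⟩ := (((Filter.eventually_all_finset K).2 h3).and
      (Filter.eventually_ge_atTop (Λ.sup id + 1))).exists
    have hnot : N ∉ Λ := fun h => by
      have := Finset.le_sup (f := id) h
      simp only [id] at this
      omega
    refine ⟨insert N Λ, by rw [Finset.card_insert_of_notMem hnot, hc], fun κ hκ => ?_⟩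
    rw [Finset.sum_insert hnot, add_comm]
    refine (lintegral_add_rpow_le _ _ hu).trans ?_
    have h4 := hN κ hκ
    have h5 := h1 κ hκ N (by omega)
    calc _ ≤ (k : ℝ≥0∞) * ((1 + Real.toNNReal (u * 2 ^ u) * C : ℝ≥0) : ℝ≥0∞) + 1 +
          ENNReal.ofReal (u * 2 ^ u) * C := by
          gcongr
          exact hk κ hκ
      _ = _ := by
        push_cast
        simp only [ENNReal.ofReal]
        ring

end Sparse

/-! ### Testing on sparse sums of plateau symbols -/

section Strict

variable {l d n : ℕ} {Θ : Fin d → 𝓢(Block l n, ℂ)}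
  {hΘ : ∀ j ξ, 𝓕 (Θ j) ξ ≠ 0 → 1 / 2 ≤ ‖ξ‖ ∧ ‖ξ‖ ≤ 2}
  {ξ₀ : Freq l d n} {s : Fin d → ℝ} {u p : ℝ} {q : Fin l → ℝ}

theorem norm_sum_slot_le {ξ : Fin l → Phys d n} {r : ℝ} (h : ∀ i, ‖ξ i‖ ≤ r) :
    ‖∑ i, ξ i‖ ≤ l * r :=
  (norm_sum_le _ _).trans ((Finset.sum_le_sum fun i _ => h i).trans (by simp))

/-- The plateau symbols at scales up to `M` are equal to `1` on the frequency support of inputs at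
scale `M`. -/
theorem symb_plateau_mul (i₀ : Fin l) (j₀ : Fin d) {g : 𝓢(Phys d n, ℂ)}
    (hg : ∀ ξ, 𝓕 g ξ ≠ 0 → ‖ξ‖ ≤ testRad l) {N M : ℕ} (hNM : N ≤ M) (ξ : Freq l d n) :
    symb i₀ j₀ Finset.univ (fun _ => plateau i₀)
        (fun _ _ h => norm_le_of_plateau_ne_zero i₀ h) N ξ *
        ∏ i, 𝓕 (testInput j₀ Finset.univ g M i) (slot i ξ) =
      ∏ i, 𝓕 (testInput j₀ Finset.univ g M i) (slot i ξ) := by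
  by_cases h0 : ∏ i, 𝓕 (testInput j₀ Finset.univ g M i) (slot i ξ) = 0
  · rw [h0, mul_zero]
  have h1 : ∀ i, ‖physScale j₀ N (slot i ξ)‖ ≤ testRad l := by
    intro i
    have h2 : 𝓕 (testInput j₀ Finset.univ g M i) (slot i ξ) ≠ 0 :=
      fun h => h0 (Finset.prod_eq_zero (Finset.mem_univ i) h)
    rw [testInput, if_pos (Finset.mem_univ i), fourier_spread] at h2
    exact (norm_physScale_le hNM _).trans (hg _ (right_ne_zero_of_mul h2))
  rw [symb_apply, Finset.prod_eq_one, one_mul]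
  intro i _
  rw [slot_freqScale, if_pos (Finset.mem_univ i)]
  refine plateau_eq_one i₀ ?_
  by_cases hi : i = i₀
  · subst hi
    rw [slot_shear_self, map_sum, ← mul_testRad i]
    exact norm_sum_slot_le h1
  · rw [slot_shear_of_ne hi]
    exact (h1 i).trans (testRad_le i₀)

/-- If `s_{j₀} ≤ l n / u`, the lifted symbols at scale `N` are bounded in `L^u` and tend to zero in
`L^1`. A sparse sum of `k` of them has norm at most of order `k ^ (1 / u)`, while the operator acts on
suitable inputs as `k` times the pointwise product. -/
theorem LocalBound.card_mul_lt (hloc : LocalBound hΘ ξ₀ s u p q) (hs : ∀ j, 0 ≤ s j) (hu : 1 < u)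
    (hn : 1 ≤ n) (hp0 : 0 < p) (hp : 1 / p = ∑ i, 1 / q i) (hq : ∀ i, 1 < q i) (i₀ : Fin l)
    (j₀ : Fin d) : l * n / u < s j₀ := by
  by_contra hlt
  rw [not_lt] at hlt
  obtain ⟨g, ρ, γ, δ, hρ, hρ0, hg, hγ, hδ, hργ⟩ := exists_kernel (d := d) (n := n) (testRad_pos i₀)
  obtain ⟨C, hC⟩ := hloc
  have hΦ : ∀ (_ : Fin l) (x : Phys d n), plateau i₀ x ≠ 0 → ‖x‖ ≤ rad l :=
    fun _ _ h => norm_le_of_plateau_ne_zero i₀ h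
  let m : ℕ → 𝓢(Freq l d n, ℂ) := symb i₀ j₀ Finset.univ (fun _ => plateau i₀) hΦ
  obtain ⟨C₁, hC₁⟩ := eLpNorm_lift_view_symb_le hΘ ξ₀ hs hu.le i₀ j₀ Finset.univ hΦ
  obtain ⟨C₂, hC₂⟩ := eLpNorm_lift_view_symb_le hΘ ξ₀ hs le_rfl i₀ j₀ Finset.univ hΦ
  have hu0 : 0 < u := by linarith
  have hln : 0 < (l : ℝ) * n := by
    have : 0 < l := i₀.pos
    positivity
  have hpow : ∀ F : 𝓢(Freq l d n, ℂ), eLpNorm F (ENNReal.ofReal u) volume =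
      (∫⁻ x, ‖F x‖ₑ ^ u) ^ (1 / u) := fun F => by
    rw [eLpNorm_eq_lintegral_rpow_enorm_toReal (by simpa using hu0) ENNReal.ofReal_ne_top,
      ENNReal.toReal_ofReal hu0.le]
  have hF1 : ∀ κ ∈ nearScales d, ∀ N, 1 ≤ N →
      ∫⁻ x, ‖lift s (view hΘ ξ₀ κ (m N)) x‖ₑ ^ u ≤ ((C₁ ^ u : ℝ≥0) : ℝ≥0∞) := by
    intro κ hκ N hN
    have h1 := hC₁ κ hκ N hN
    rw [hpow] at h1
    have hN0 : (1 : ℝ) ≤ N := by exact_mod_cast hN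
    have h2 : ENNReal.ofReal ((N : ℝ) ^ (s j₀ - (Finset.univ : Finset (Fin l)).card * n / u)) ≤ 1 := by
      rw [ENNReal.ofReal_le_one]
      refine Real.rpow_le_one_of_one_le_of_nonpos hN0 ?_
      simp only [Finset.card_univ, Fintype.card_fin]
      linarith
    have h3 := h1.trans (mul_le_mul_right h2 (C₁ : ℝ≥0∞))
    rw [mul_one] at h3
    have h4 := ENNReal.rpow_le_rpow h3 hu0.le
    rwa [← ENNReal.rpow_mul, one_div_mul_cancel hu0.ne', ENNReal.rpow_one,
      ← ENNReal.coe_rpow_of_nonneg _ hu0.le] at h4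
  have hF2 : ∀ κ ∈ nearScales d, Filter.Tendsto
      (fun N => ∫⁻ x, ‖lift s (view hΘ ξ₀ κ (m N)) x‖ₑ) Filter.atTop (nhds 0) := by
    intro κ hκ
    have h1 : 0 < (l : ℝ) * n - s j₀ := by
      have : (l : ℝ) * n / u < l * n := div_lt_self hln hu
      linarith
    have h2 := (tendsto_rpow_neg_atTop h1).comp (tendsto_natCast_atTop_atTop (R := ℝ))
    have h3 := ENNReal.Tendsto.const_mul (a := C₂) (ENNReal.tendsto_ofReal h2)
      (Or.inr ENNReal.coe_ne_top)
    rw [ENNReal.ofReal_zero, mul_zero] at h3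
    refine tendsto_of_tendsto_of_tendsto_of_le_of_le' tendsto_const_nhds h3
      (Filter.Eventually.of_forall fun _ => zero_le) ?_
    filter_upwards [Filter.eventually_ge_atTop 1] with N hN
    have h4 := hC₂ κ hκ N hN
    rw [ENNReal.ofReal_one, eLpNorm_one_eq_lintegral_enorm] at h4
    refine h4.trans (le_of_eq ?_)
    simp
  obtain ⟨C', hC'⟩ := exists_sparse (μ := volume) (nearScales d)
    (fun κ N => lift s (view hΘ ξ₀ κ (m N))) hu.le hF1 hF2
  have hA : eLpNorm (fun x => ∏ _i : Fin l, g x) (ENNReal.ofReal p) volume ≠ 0 := by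
    intro h0
    have hcont : Continuous fun x => ∏ _i : Fin l, g x :=
      continuous_finsetProd _ fun i _ => g.continuous
    rw [eLpNorm_eq_zero_iff hcont.aestronglyMeasurable (by simpa using hp0)] at h0
    have h1 : ∏ _i : Fin l, g 0 = 0 :=
      congrFun ((hcont.ae_eq_iff_eq (μ := volume) continuous_const).1 h0) 0
    obtain ⟨i, -, hi⟩ := Finset.prod_eq_zero_iff.1 h1
    rw [hρ] at hi
    have := hργ 0 (by simp [hδ.le])
    have : ρ 0 = 0 := by exact_mod_cast hi
    linarith
  have hle : (1 : ℝ) ≤ 1 / u := by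
    refine exponent_le_of_forall hA (C := C * (C' : ℝ≥0∞) ^ (1 / u) *
      ∏ i, eLpNorm g (ENNReal.ofReal (q i)) volume) ?_ 0 fun k _ hk => ?_
    · exact ENNReal.mul_ne_top (ENNReal.mul_ne_top ENNReal.coe_ne_top
        (ENNReal.rpow_ne_top_of_nonneg (by positivity) ENNReal.coe_ne_top))
        (ENNReal.prod_ne_top fun i _ => (g.memLp _ volume).2.ne)
    obtain ⟨Λ, hcard, hsum⟩ := hC' k
    -- the inputs live at the largest scale of `Λ`, where all the symbols are `1`
    let M : ℕ := max 1 (Λ.sup id)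
    have hM : 1 ≤ M := le_max_left _ _
    have hM0 : (0 : ℝ) < M := by exact_mod_cast hM
    have h1 := hC (∑ N ∈ Λ, (1 : ℂ) • m N) (fun ξ hξ => ?_) ((k * C' : ℝ≥0∞) ^ (1 / u))
      (ENNReal.rpow_lt_top_of_nonneg (by positivity)
        (ENNReal.mul_ne_top (ENNReal.natCast_ne_top k) ENNReal.coe_ne_top))
      (fun κ hκ => ?_) (testInput j₀ Finset.univ g M)
    · have hT : multiplierOp (∑ N ∈ Λ, (1 : ℂ) • m N : 𝓢(Freq l d n, ℂ)) (testInput j₀ Finset.univ g M) =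
          (k : ℂ) • fun x => ∏ _i : Fin l, g ((physScale j₀ M).symm x) := by
        funext x
        have e0 : ∀ ξ, ∀ N ∈ Λ, m N ξ * ∏ i, 𝓕 (testInput j₀ Finset.univ g M i) (slot i ξ) =
            ∏ i, 𝓕 (testInput j₀ Finset.univ g M i) (slot i ξ) := fun ξ N hN =>
          symb_plateau_mul i₀ j₀ hg ((Finset.le_sup (f := id) hN).trans (le_max_right 1 _)) ξ
        have e : ∀ ξ, (∑ N ∈ Λ, (1 : ℂ) • m N : 𝓢(Freq l d n, ℂ)) ξ *
            ∏ i, 𝓕 (testInput j₀ Finset.univ g M i) (slot i ξ) =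
            k * ∏ i, 𝓕 (testInput j₀ Finset.univ g M i) (slot i ξ) := by
          intro ξ
          simp only [sum_apply, one_smul]
          rw [Finset.sum_mul, Finset.sum_congr rfl (e0 ξ), Finset.sum_const, hcard, nsmul_eq_mul]
        rw [multiplierOp_eq]
        simp_rw [e, mul_assoc]
        rw [integral_const_mul, integral_prod_fourier_slot]
        simp [testInput]
      rw [hT, eLpNorm_const_smul, eLpNorm_comp_physScale_symm j₀ hM
        (fun x => ∏ _i : Fin l, g x) hp0, prod_eLpNorm_testInput j₀ _ g hM
        fun i => zero_lt_one.trans (hq i)] at h1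
      have e1 : ∑ i : Fin l, (n : ℝ) / q i = n / p := by
        rw [div_eq_mul_one_div, hp, Finset.mul_sum]
        exact Finset.sum_congr rfl fun i _ => div_eq_mul_one_div _ _
      have e2 : ‖(k : ℂ)‖ₑ = ENNReal.ofReal ((k : ℝ) ^ (1 : ℝ)) := by
        rw [← ofReal_norm, Complex.norm_natCast, Real.rpow_one]
      have e3 : (k * C' : ℝ≥0∞) ^ (1 / u) =
          ENNReal.ofReal ((k : ℝ) ^ (1 / u)) * (C' : ℝ≥0∞) ^ (1 / u) := by
        rw [ENNReal.mul_rpow_of_nonneg _ _ (by positivity),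
          ← ENNReal.ofReal_rpow_of_nonneg (by positivity) (by positivity), ENNReal.ofReal_natCast]
      rw [e1, e2, e3] at h1
      have hP : ENNReal.ofReal ((M : ℝ) ^ ((n : ℝ) / p)) ≠ 0 := by
        rw [Ne, ENNReal.ofReal_eq_zero, not_le]; positivity
      refine (ENNReal.mul_le_mul_iff_right hP ENNReal.ofReal_ne_top).1 ?_
      calc _ = _ := by ring
        _ ≤ _ := h1
        _ = _ := by ring
    · simp only [sum_apply, one_smul] at hξ
      obtain ⟨N, -, hN⟩ := Finset.exists_ne_zero_of_sum_ne_zero hξ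
      exact symb_support hΦ hN
    · have h2 := hsum κ hκ
      rw [view_sum, map_sum, hpow]
      simp only [one_smul]
      exact ENNReal.rpow_le_rpow h2 (by positivity)
  have : 1 / u < 1 := by rw [div_lt_one hu0]; exact hu
  linarith

end Strict

/-! ### Testing on lacunary kernels in the quasi-norm range -/

section Quasinorm

variable {l d n : ℕ}

/-- The ball of radius `δ`, expanded by the factor `2 ^ k` in the parameter `j₀`. -/
def expandedBall (j₀ : Fin d) (δ : ℝ) (k : ℕ) : Set (Phys d n) :=
  (physScale j₀ (2 ^ k)).symm ⁻¹' Metric.closedBall 0 δ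

theorem measurableSet_expandedBall (j₀ : Fin d) (δ : ℝ) (k : ℕ) :
    MeasurableSet (expandedBall (n := n) j₀ δ k) :=
  (physScale j₀ (2 ^ k)).symm.continuous.measurable measurableSet_closedBall

theorem volume_expandedBall (j₀ : Fin d) (δ : ℝ) (k : ℕ) :
    volume (expandedBall (n := n) j₀ δ k) =
      2 ^ (k * n) * volume (Metric.closedBall (0 : Phys d n) δ) := by
  have h : expandedBall (n := n) j₀ δ k =
      physScale j₀ (2 ^ k) '' Metric.closedBall (0 : Phys d n) δ :=
    ((physScale j₀ (2 ^ k)).image_eq_preimage_symm _).symm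
  have h2 := Measure.addHaar_image_continuousLinearMap (volume : Measure (Phys d n))
    (physScale (n := n) j₀ (2 ^ k) : Phys d n →L[ℝ] Phys d n) (Metric.closedBall (0 : Phys d n) δ)
  rw [h]
  refine h2.trans ?_
  rw [det_physScale, abs_of_pos (pow_pos (sc_pos _) n),
    sc_eq Nat.one_le_two_pow, ENNReal.ofReal_pow (by positivity), ENNReal.ofReal_natCast, pow_mul]
  push_cast
  rfl

theorem expandedBall_mono (j₀ : Fin d) (δ : ℝ) (k : ℕ) :
    expandedBall (n := n) j₀ δ k ⊆ expandedBall j₀ δ (k + 1) := by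
  intro x hx
  rw [expandedBall, Set.mem_preimage, mem_closedBall_zero_iff] at hx ⊢
  refine le_trans ?_ hx
  have h := norm_physScale_le (j₀ := j₀) (Nat.pow_le_pow_right two_pos (Nat.le_succ k))
    ((physScale j₀ (2 ^ k)).symm ((physScale j₀ (2 ^ (k + 1))).symm x))
  rw [ContinuousLinearEquiv.apply_symm_apply] at h
  refine h.trans (le_of_eq ?_)
  congr 1
  ext a
  have := ite_sc_ne_zero (2 ^ (k + 1)) (a.1 = j₀)
  simp only [physScale, diagE_apply, diagE_symm_apply]
  field_simp

/-- A function that is at least `N ^ (-n / p)` on the ball expanded by the factor `N`, for `K`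
lacunary values of `N`, has a `p`-th power with integral at least of order `K`. -/
theorem mul_le_lintegral_of_expandedBall (hn : 1 ≤ n) (j₀ : Fin d) {δ c p : ℝ} (hc : 0 ≤ c)
    (hp : 0 < p) {h : Phys d n → ℂ} (K : ℕ)
    (hh : ∀ k < K, ∀ x ∈ expandedBall j₀ δ k, c * ((2 ^ k : ℕ) : ℝ) ^ (-(n / p)) ≤ ‖h x‖) :
    K * (ENNReal.ofReal (c ^ p) * (2⁻¹ * volume (Metric.closedBall (0 : Phys d n) δ))) ≤
      ∫⁻ x, ‖h x‖ₑ ^ p := by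
  set V := volume (Metric.closedBall (0 : Phys d n) δ) with hV
  have hVt : V ≠ ⊤ := measure_closedBall_lt_top.ne
  have hpt : ∀ k < K, ∀ x ∈ expandedBall j₀ δ k,
      ENNReal.ofReal (c ^ p) * (2 ^ (k * n))⁻¹ ≤ ‖h x‖ₑ ^ p := by
    intro k hk x hx
    have h1 := hh k hk x hx
    have h2 := ENNReal.rpow_le_rpow (ENNReal.ofReal_le_ofReal h1) hp.le
    rw [ofReal_norm] at h2
    refine le_trans (le_of_eq ?_) h2
    rw [ENNReal.ofReal_rpow_of_nonneg (by positivity) hp.le, Real.mul_rpow hc (by positivity),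
      ← Real.rpow_mul (by positivity), ENNReal.ofReal_mul (by positivity)]
    congr 1
    have : -(n / p) * p = -(n : ℝ) := by field_simp
    rw [this, Real.rpow_neg (by positivity), Real.rpow_natCast,
      ENNReal.ofReal_inv_of_pos (by positivity), pow_mul]
    push_cast
    rw [ENNReal.ofReal_pow (by positivity), ENNReal.ofReal_pow (by positivity)]
    simp
  have hshell : ∀ (k : ℕ) (A : Set (Phys d n)), k < K → MeasurableSet A →
      A ⊆ expandedBall j₀ δ k → 2⁻¹ * (2 ^ (k * n) * V) ≤ volume A →
      ENNReal.ofReal (c ^ p) * (2⁻¹ * V) ≤ ∫⁻ x in A, ‖h x‖ₑ ^ p := by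
    intro k A hk hA hsub hvol
    calc ENNReal.ofReal (c ^ p) * (2⁻¹ * V)
        = ENNReal.ofReal (c ^ p) * (2 ^ (k * n))⁻¹ * (2⁻¹ * (2 ^ (k * n) * V)) := by
          have : ((2 : ℝ≥0∞) ^ (k * n))⁻¹ * 2 ^ (k * n) = 1 :=
            ENNReal.inv_mul_cancel (by positivity) (ENNReal.pow_ne_top (by simp))
          calc _ = ENNReal.ofReal (c ^ p) * (2⁻¹ * V) * (((2 : ℝ≥0∞) ^ (k * n))⁻¹ * 2 ^ (k * n)) := by
                rw [this, mul_one]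
            _ = _ := by ring
      _ ≤ ENNReal.ofReal (c ^ p) * (2 ^ (k * n))⁻¹ * volume A := by gcongr
      _ = ∫⁻ _x in A, ENNReal.ofReal (c ^ p) * (2 ^ (k * n))⁻¹ := by rw [setLIntegral_const]
      _ ≤ _ := setLIntegral_mono' hA fun x hx => hpt k hk x (hsub hx)
  -- the shells between consecutive balls carry at least half of the volume of the larger ball
  have main : ∀ k, k < K → (k + 1 : ℕ) * (ENNReal.ofReal (c ^ p) * (2⁻¹ * V)) ≤
      ∫⁻ x in expandedBall j₀ δ k, ‖h x‖ₑ ^ p := by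
    intro k
    induction k with
    | zero =>
      intro hk
      rw [zero_add, Nat.cast_one, one_mul]
      refine hshell 0 _ hk (measurableSet_expandedBall j₀ δ 0) le_rfl ?_
      rw [volume_expandedBall]
      exact mul_le_of_le_one_left zero_le (by simp)
    | succ k ih =>
      intro hk
      have hsub := expandedBall_mono (n := n) j₀ δ k
      have hm := measurableSet_expandedBall (n := n) j₀ δ k
      have hm' := measurableSet_expandedBall (n := n) j₀ δ (k + 1)
      rw [← Set.union_sdiff_cancel hsub, lintegral_union (hm'.diff hm) Set.disjoint_sdiff_right,
        Nat.cast_succ, add_mul, one_mul]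
      refine add_le_add (ih (by omega)) (hshell (k + 1) _ hk (hm'.diff hm) Set.sdiff_subset ?_)
      have h1 : 2 ^ (k * n) * V ≤ 2⁻¹ * (2 ^ ((k + 1) * n) * V) := by
        rw [← mul_assoc]
        gcongr
        have : (2 : ℝ≥0∞) ^ ((k + 1) * n) = 2 ^ (k * n) * 2 ^ n := by rw [← pow_add]; ring_nf
        rw [this]
        calc (2 : ℝ≥0∞) ^ (k * n) = 2 ^ (k * n) * (2⁻¹ * 2 ^ 1) := by
              rw [pow_one, ENNReal.inv_mul_cancel (by simp) (by simp), mul_one]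
          _ ≤ 2 ^ (k * n) * (2⁻¹ * 2 ^ n) := by
              gcongr
              simp
          _ = _ := by ring
      have h2 : volume (expandedBall (n := n) j₀ δ (k + 1)) ≤
          volume (expandedBall (n := n) j₀ δ k) + volume (expandedBall (n := n) j₀ δ (k + 1) \
            expandedBall (n := n) j₀ δ k) := by
        rw [← measure_union Set.disjoint_sdiff_right (hm'.diff hm), Set.union_sdiff_cancel hsub]
      rw [volume_expandedBall, volume_expandedBall] at h2
      set X := (2 : ℝ≥0∞) ^ ((k + 1) * n) * V
      have hX : X ≠ ⊤ := ENNReal.mul_ne_top (ENNReal.pow_ne_top (by simp)) hVt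
      have h3 : 2⁻¹ * X + 2⁻¹ * X ≤ 2⁻¹ * X + volume (expandedBall (n := n) j₀ δ (k + 1) \
            expandedBall (n := n) j₀ δ k) := by
        rw [← add_mul, ENNReal.inv_two_add_inv_two, one_mul]
        exact h2.trans (add_le_add_left h1 _)
      exact (ENNReal.add_le_add_iff_left (ENNReal.mul_ne_top (by simp) hX)).1 h3
  rcases Nat.eq_zero_or_pos K with rfl | hK
  · simp
  · have h1 := main (K - 1) (by omega)
    rw [Nat.sub_add_cancel hK] at h1
    exact h1.trans (setLIntegral_le_lintegral _ _)

variable {Θ : Fin d → 𝓢(Block l n, ℂ)}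
  {hΘ : ∀ j ξ, 𝓕 (Θ j) ξ ≠ 0 → 1 / 2 ≤ ‖ξ‖ ∧ ‖ξ‖ ≤ 2}
  {ξ₀ : Freq l d n} {s : Fin d → ℝ} {u p : ℝ} {q : Fin l → ℝ}

theorem fourier_sum_smul_apply {E : Type*} [NormedAddCommGroup E]
    [InnerProductSpace ℝ E] [FiniteDimensional ℝ E] [MeasurableSpace E] [BorelSpace E] {ι : Type*}
    (Λ : Finset ι) (b : ι → ℂ) (f : ι → 𝓢(E, ℂ)) (ξ : E) :
    𝓕 (∑ k ∈ Λ, b k • f k) ξ = ∑ k ∈ Λ, b k * 𝓕 (f k) ξ := by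
  rw [← FourierTransform.fourierCLM_apply (R := ℂ), map_sum]
  simp [sum_apply]

/-- For `p < 1` the target space is not normed: `K` convolution kernels at lacunary scales, whose
norms add up to `K` on the side of the symbol, produce an output of size `K ^ (1 / p)`. -/
theorem LocalBound.lt_of_lt_one (hloc : LocalBound hΘ ξ₀ s u p q) (hs : ∀ j, 0 ≤ s j) (hu : 1 ≤ u)
    (hn : 1 ≤ n) (hp0 : 0 < p) (hp1 : p < 1) (i₀ : Fin l)
    (j₀ : Fin d) : n / p - n + n / u < s j₀ := by
  by_contra hlt
  rw [not_lt] at hlt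
  obtain ⟨g, ρ, γ, δ, hρ, hρ0, hg, hγ, hδ, hργ⟩ := exists_kernel (d := d) (n := n) (testRad_pos i₀)
  obtain ⟨C, hC⟩ := hloc
  obtain ⟨C', hC'⟩ := eLpNorm_lift_view_symb_le hΘ ξ₀ hs hu i₀ j₀ (insert i₀ ∅)
    (norm_le_of_kernelFactors_ne_zero (i₀ := i₀) hg)
  let m : ℕ → 𝓢(Freq l d n, ℂ) := symb i₀ j₀ (insert i₀ ∅) (kernelFactors i₀ g)
    (norm_le_of_kernelFactors_ne_zero hg)
  -- the weights normalize the outputs in `L^p`; since `s j₀ ≤ n / p - n + n / u` they also keep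
  -- the norms of the symbols bounded
  let b : ℕ → ℝ := fun k => ((2 ^ k : ℕ) : ℝ) ^ (n - n / p)
  have hb : ∀ k, 0 < b k := fun k => Real.rpow_pos_of_pos (by positivity) _
  let V := volume (Metric.closedBall (0 : Phys d n) δ)
  have hV : 0 < V := Metric.measure_closedBall_pos _ _ hδ
  have hVt : V ≠ ⊤ := measure_closedBall_lt_top.ne
  have hVr : 0 < V.toReal := ENNReal.toReal_pos hV.ne' hVt
  let c : ℝ := γ ^ (l + 1) * V.toReal
  have hc : 0 < c := by positivity
  have hle : 1 / p ≤ 1 := by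
    refine exponent_le_of_forall (c := (ENNReal.ofReal (c ^ p) * (2⁻¹ * V)) ^ (1 / p))
      (C := C * C' * ∏ i, eLpNorm g (ENNReal.ofReal (q i)) volume) ?_ ?_ 0 fun K _ hK => ?_
    · refine (ENNReal.rpow_pos ?_ ?_).ne'
      · refine ENNReal.mul_pos ?_ (mul_ne_zero (by simp) hV.ne')
        rw [Ne, ENNReal.ofReal_eq_zero, not_le]; positivity
      · exact ENNReal.mul_ne_top ENNReal.ofReal_ne_top (ENNReal.mul_ne_top (by simp) hVt)
    · exact ENNReal.mul_ne_top (ENNReal.mul_ne_top ENNReal.coe_ne_top ENNReal.coe_ne_top)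
        (ENNReal.prod_ne_top fun i _ => (g.memLp _ volume).2.ne)
    have h1 := hC (∑ k ∈ Finset.range K, (b k : ℂ) • m (2 ^ k)) (fun ξ hξ => ?_) (K * C' : ℝ≥0∞)
      (ENNReal.mul_lt_top (ENNReal.natCast_lt_top K) ENNReal.coe_lt_top) (fun κ hκ => ?_)
      (fun _ => g)
    · let Γ : 𝓢(Phys d n, ℂ) := ∑ k ∈ Finset.range K, (b k : ℂ) • kernelAt j₀ g (2 ^ k)
      have hT : ∀ x, multiplierOp (∑ k ∈ Finset.range K, (b k : ℂ) • m (2 ^ k) : 𝓢(Freq l d n, ℂ))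
          (fun _ => g) x = ∫ y, Γ (x - y) * ∏ _i : Fin l, g y := fun x => by
        refine multiplierOp_eq_convolution Γ.integrable (h := fun _ => g) (fun ξ => ?_) x
        have e := fourier_sum_smul_apply (Finset.range K) (fun k => (b k : ℂ))
          (fun k => kernelAt j₀ g (2 ^ k)) (∑ i, slot i ξ)
        rw [SchwartzMap.fourier_coe] at e
        rw [e]
        simp only [sum_apply, smul_apply, smul_eq_mul, Finset.sum_mul]
        refine Finset.sum_congr rfl fun k _ => ?_
        have := symb_kernelFactors_mul i₀ j₀ ∅ hg (2 ^ k) ξ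
        simp only [testInput, Finset.notMem_empty, if_false] at this
        rw [mul_assoc, mul_assoc, ← this]
      have hlow : ∀ k < K, ∀ x ∈ expandedBall j₀ δ k, c * ((2 ^ k : ℕ) : ℝ) ^ (-(n / p)) ≤
          ‖multiplierOp (∑ k ∈ Finset.range K, (b k : ℂ) • m (2 ^ k) : 𝓢(Freq l d n, ℂ))
            (fun _ => g) x‖ := by
        intro k hk x hx
        rw [expandedBall, Set.mem_preimage, mem_closedBall_zero_iff] at hx
        have hterm : ∀ k y, 0 ≤ b k * ((sc (2 ^ k) ^ n)⁻¹ * ρ ((physScale j₀ (2 ^ k)).symm y)) :=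
          fun k y => mul_nonneg (hb k).le
            (mul_nonneg (inv_pos.2 (pow_pos (sc_pos _) n)).le (hρ0 _))
        rw [hT]
        have h3 := le_norm_integral_of_nonneg (integrable_kernel_mul Γ.integrable (fun _ : Fin l => g) x)
          (φ := fun y => (∑ k ∈ Finset.range K, b k * ((sc (2 ^ k) ^ n)⁻¹ *
            ρ ((physScale j₀ (2 ^ k)).symm (x - y)))) * ρ y ^ l) (fun y => ?_) (fun y => ?_)
          (A := Metric.closedBall 0 δ) (c := ((2 ^ k : ℕ) : ℝ) ^ (-(n / p)) * γ ^ (l + 1))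
          measurableSet_closedBall hVt fun y hy => ?_
        · refine le_trans (le_of_eq ?_) h3
          simp only [c, Measure.real, V]
          ring
        · simp only [Γ, sum_apply, smul_apply, kernelAt, spread_apply, smul_eq_mul, hρ]
          push_cast
          simp
        · exact mul_nonneg (Finset.sum_nonneg fun k _ => hterm k _) (pow_nonneg (hρ0 _) _)
        · rw [mem_closedBall_zero_iff] at hy
          have h4 : γ ≤ ρ ((physScale j₀ (2 ^ k)).symm (x - y)) := by
            refine hργ _ ?_
            rw [map_sub]
            have := norm_physScale_symm_le j₀ (2 ^ k) y
            exact (norm_sub_le _ _).trans (by linarith)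
          have h5 : γ ≤ ρ y := hργ _ (by linarith)
          have h6 := Finset.single_le_sum (f := fun k => b k * ((sc (2 ^ k) ^ n)⁻¹ *
            ρ ((physScale j₀ (2 ^ k)).symm (x - y)))) (fun k _ => hterm k _)
            (Finset.mem_range.2 hk)
          have h7 : ((2 ^ k : ℕ) : ℝ) ^ (-(n / p)) = b k * (sc (2 ^ k) ^ n)⁻¹ := by
            have h2k : (0 : ℝ) < ((2 ^ k : ℕ) : ℝ) := by positivity
            rw [sc_eq Nat.one_le_two_pow, ← Real.rpow_natCast _ n, ← Real.rpow_neg h2k.le,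
              ← Real.rpow_add h2k]
            congr 1; ring
          have h8 := inv_pos.2 (pow_pos (sc_pos (2 ^ k)) n)
          have h9 := hb k
          calc ((2 ^ k : ℕ) : ℝ) ^ (-(n / p)) * γ ^ (l + 1)
              = b k * ((sc (2 ^ k) ^ n)⁻¹ * γ) * γ ^ l := by rw [h7, pow_succ']; ring
            _ ≤ b k * ((sc (2 ^ k) ^ n)⁻¹ * ρ ((physScale j₀ (2 ^ k)).symm (x - y))) * ρ y ^ l := by
                gcongr
                exact hterm k _
            _ ≤ _ := mul_le_mul_of_nonneg_right h6 (pow_nonneg (hρ0 _) _)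
      have h2 := mul_le_lintegral_of_expandedBall hn j₀ hc.le hp0 K hlow
      have h3 := ENNReal.rpow_le_rpow h2 (by positivity : 0 ≤ 1 / p)
      rw [eLpNorm_eq_lintegral_rpow_enorm_toReal (by simpa using hp0) ENNReal.ofReal_ne_top,
        ENNReal.toReal_ofReal hp0.le] at h1
      have h4 := h3.trans h1
      rw [ENNReal.mul_rpow_of_nonneg _ _ (by positivity), ← ENNReal.ofReal_natCast,
        ENNReal.ofReal_rpow_of_nonneg (by positivity) (by positivity)] at h4
      rw [Real.rpow_one]
      calc _ = _ := mul_comm _ _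
        _ ≤ _ := h4
        _ = _ := by ring
    · simp only [sum_apply] at hξ
      obtain ⟨k, -, hk⟩ := Finset.exists_ne_zero_of_sum_ne_zero hξ
      rw [smul_apply, smul_eq_mul] at hk
      exact symb_support (norm_le_of_kernelFactors_ne_zero hg) (right_ne_zero_of_mul hk)
    · have hu' : (1 : ℝ≥0∞) ≤ ENNReal.ofReal u := by
        rw [← ENNReal.ofReal_one]; exact ENNReal.ofReal_le_ofReal hu
      rw [view_sum, map_sum]
      have e : ⇑(∑ k ∈ Finset.range K, lift s ((b k : ℂ) • view hΘ ξ₀ κ (m (2 ^ k)))) =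
          ∑ k ∈ Finset.range K, ⇑(lift s ((b k : ℂ) • view hΘ ξ₀ κ (m (2 ^ k)))) := by
        ext x; simp [sum_apply]
      rw [e]
      refine (eLpNorm_sum_le (fun k _ => (lift s _).continuous.aestronglyMeasurable) hu').trans ?_
      refine (Finset.sum_le_sum (g := fun _ => (C' : ℝ≥0∞)) fun k _ => ?_).trans (by simp)
      have h2k : (1 : ℝ) ≤ ((2 ^ k : ℕ) : ℝ) := by exact_mod_cast Nat.one_le_two_pow
      have e2 : ⇑(lift s ((b k : ℂ) • view hΘ ξ₀ κ (m (2 ^ k)))) =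
          (b k : ℂ) • ⇑(lift s (view hΘ ξ₀ κ (m (2 ^ k)))) := by rw [map_smul]; rfl
      rw [e2, eLpNorm_const_smul]
      have h2 := hC' κ hκ (2 ^ k) Nat.one_le_two_pow
      have e3 : ‖(b k : ℂ)‖ₑ = ENNReal.ofReal (b k) := by
        rw [← ofReal_norm, Complex.norm_real, Real.norm_of_nonneg (hb k).le]
      rw [e3]
      refine (mul_le_mul_right h2 _).trans ?_
      rw [mul_left_comm, ← ENNReal.ofReal_mul (hb k).le]
      refine mul_le_of_le_one_right zero_le ?_
      rw [ENNReal.ofReal_le_one, ← Real.rpow_add (by linarith)]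
      refine Real.rpow_le_one_of_one_le_of_nonpos h2k ?_
      simp only [insert_empty_eq, Finset.card_singleton, Nat.cast_one, one_mul]
      linarith
  have : 1 < 1 / p := by rw [lt_div_iff₀ hp0]; linarith
  linarith

end Quasinorm

/-! ### The chirped Gaussian and its Fourier transform -/

section ChirpKernel

open Complex (I)

variable {d n : ℕ}

/-- The coefficients of the chirped Gaussian: the parameter `j₀` carries the chirp `N`. -/
noncomputable def chirpRate (j₀ : Fin d) (N : ℕ) (a : Fin d × Fin n) : ℂ :=
  if a.1 = j₀ then Real.pi * (1 - N * I) else Real.pi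

theorem re_chirpRate (j₀ : Fin d) (N : ℕ) (a : Fin d × Fin n) :
    (chirpRate j₀ N a).re = Real.pi := by
  unfold chirpRate
  split_ifs <;> simp

theorem chirpRate_ne_zero (j₀ : Fin d) (N : ℕ) (a : Fin d × Fin n) : chirpRate j₀ N a ≠ 0 := by
  intro h
  have := re_chirpRate j₀ N a
  rw [h, Complex.zero_re] at this
  exact Real.pi_ne_zero this.symm

/-- The Gaussian `e^{-π|ξ|² + iπN|ξ_{j₀}|²}`. -/
noncomputable def chirp (j₀ : Fin d) (N : ℕ) (ξ : Phys d n) : ℂ :=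
  Complex.exp (-∑ a, chirpRate j₀ N a * (ξ a : ℂ) ^ 2)

/-- The factor by which the chirp lowers the kernel: the product of the principal square roots of the
coefficients divided by `π`, of modulus about `N ^ (n / 2)`. -/
noncomputable def chirpAmp (n : ℕ) (j₀ : Fin d) (N : ℕ) : ℂ :=
  ∏ a : Fin d × Fin n, (chirpRate j₀ N a / Real.pi) ^ (1 / 2 : ℂ)

/-- The convolution kernel with Fourier transform `chirp`. -/
noncomputable def chirpKernel (j₀ : Fin d) (N : ℕ) (x : Phys d n) : ℂ :=
  (chirpAmp n j₀ N)⁻¹ * Complex.exp (-∑ a, (Real.pi ^ 2 / chirpRate j₀ N a) * (x a : ℂ) ^ 2)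

/-- Real parts of the coefficients of `chirpKernel`. -/
noncomputable def chirpDecay (j₀ : Fin d) (N : ℕ) (a : Fin d × Fin n) : ℝ :=
  if a.1 = j₀ then Real.pi / (1 + (N : ℝ) ^ 2) else Real.pi

/-- Imaginary parts of the coefficients of `chirpKernel`. -/
noncomputable def chirpTwist (j₀ : Fin d) (N : ℕ) (a : Fin d × Fin n) : ℝ :=
  if a.1 = j₀ then Real.pi * N / (1 + (N : ℝ) ^ 2) else 0

theorem pi_sq_div_chirpRate (j₀ : Fin d) (N : ℕ) (a : Fin d × Fin n) :
    (Real.pi : ℂ) ^ 2 / chirpRate j₀ N a = chirpDecay j₀ N a + chirpTwist j₀ N a * I := by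
  have hpi : (Real.pi : ℂ) ≠ 0 := by exact_mod_cast Real.pi_ne_zero
  rw [div_eq_iff (chirpRate_ne_zero j₀ N a)]
  unfold chirpRate chirpDecay chirpTwist
  split_ifs
  · have h : (1 + (N : ℂ) ^ 2) ≠ 0 := by
      have : (0 : ℝ) < 1 + (N : ℝ) ^ 2 := by positivity
      exact_mod_cast this.ne'
    push_cast
    field_simp
    ring_nf
    rw [Complex.I_sq]
    ring
  · push_cast; ring

theorem chirpDecay_pos (j₀ : Fin d) (N : ℕ) (a : Fin d × Fin n) : 0 < chirpDecay j₀ N a := by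
  unfold chirpDecay
  split_ifs
  · positivity
  · exact Real.pi_pos

theorem chirpAmp_ne_zero (j₀ : Fin d) (N : ℕ) : chirpAmp n j₀ N ≠ 0 := by
  refine Finset.prod_ne_zero_iff.2 fun a _ => ?_
  rw [Ne, Complex.cpow_eq_zero_iff, not_and_or]
  left
  exact div_ne_zero (chirpRate_ne_zero j₀ N a) (by exact_mod_cast Real.pi_ne_zero)

theorem norm_chirpAmp (j₀ : Fin d) (N : ℕ) :
    ‖chirpAmp n j₀ N‖ = (Real.sqrt (1 + (N : ℝ) ^ 2)) ^ ((n : ℝ) / 2) := by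
  have h : ∀ a : Fin d × Fin n, ‖(chirpRate j₀ N a / Real.pi) ^ (1 / 2 : ℂ)‖ =
      if a.1 = j₀ then Real.sqrt (1 + (N : ℝ) ^ 2) ^ (1 / 2 : ℝ) else 1 := by
    intro a
    have hpi : (Real.pi : ℂ) ≠ 0 := by exact_mod_cast Real.pi_ne_zero
    have e : (1 / 2 : ℂ) = ((1 / 2 : ℝ) : ℂ) := by push_cast; ring
    rw [e, Complex.norm_cpow_real]
    unfold chirpRate
    split_ifs
    · rw [mul_div_cancel_left₀ _ hpi]
      congr 1
      have e2 : (1 - N * I : ℂ) = ((1 : ℝ) : ℂ) + ((-N : ℝ) : ℂ) * I := by push_cast; ring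
      rw [e2, Complex.norm_add_mul_I]
      norm_num
    · rw [div_self hpi, norm_one, Real.one_rpow]
  rw [chirpAmp, norm_prod]
  simp_rw [h]
  rw [Fintype.prod_prod_type, Finset.prod_eq_single j₀]
  · simp only [if_true, Finset.prod_const, Finset.card_univ, Fintype.card_fin]
    rw [← Real.rpow_mul_natCast (by positivity)]
    congr 1; ring
  · intro j _ hj; simp [hj]
  · simp

theorem rpow_le_norm_chirpAmp (j₀ : Fin d) (N : ℕ) :
    (N : ℝ) ^ ((n : ℝ) / 2) ≤ ‖chirpAmp n j₀ N‖ := by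
  rw [norm_chirpAmp]
  refine Real.rpow_le_rpow (by positivity) ?_ (by positivity)
  exact Real.le_sqrt_of_sq_le (by linarith)

theorem norm_chirpAmp_le (j₀ : Fin d) {N : ℕ} (hN : 1 ≤ N) :
    ‖chirpAmp n j₀ N‖ ≤ 2 ^ ((n : ℝ) / 2) * (N : ℝ) ^ ((n : ℝ) / 2) := by
  have hN1 : (1 : ℝ) ≤ N := by exact_mod_cast hN
  rw [norm_chirpAmp, ← Real.mul_rpow (by norm_num) (by positivity)]
  refine Real.rpow_le_rpow (by positivity) ?_ (by positivity)
  refine Real.sqrt_le_iff.2 ⟨by positivity, by nlinarith⟩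

theorem re_pi_sq_div_chirpRate_pos (j₀ : Fin d) (N : ℕ) (a : Fin d × Fin n) :
    0 < ((Real.pi : ℂ) ^ 2 / chirpRate j₀ N a).re := by
  rw [pi_sq_div_chirpRate]
  simpa using chirpDecay_pos j₀ N a

theorem integrable_chirpKernel (j₀ : Fin d) (N : ℕ) :
    Integrable (chirpKernel (n := n) j₀ N) := by
  refine Integrable.const_mul ?_ _
  rw [← (PiLp.volume_preserving_toLp (Fin d × Fin n)).integrable_comp_emb
    (MeasurableEquiv.toLp 2 _).measurableEmbedding]
  have h := GaussianFourier.integrable_cexp_neg_sum_mul_add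
    (re_pi_sq_div_chirpRate_pos (n := n) j₀ N) 0
  refine h.congr (Filter.Eventually.of_forall fun v => ?_)
  simp

theorem fourier_chirpKernel (j₀ : Fin d) (N : ℕ) (ξ : Phys d n) :
    𝓕 (chirpKernel (n := n) j₀ N) ξ = chirp j₀ N ξ := by
  have hpi : (Real.pi : ℂ) ≠ 0 := by exact_mod_cast Real.pi_ne_zero
  rw [fourier_eq_integral_wave, ← (PiLp.volume_preserving_toLp (Fin d × Fin n)).integral_comp
    (MeasurableEquiv.toLp 2 _).measurableEmbedding]
  have h := GaussianFourier.integral_cexp_neg_sum_mul_add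
    (re_pi_sq_div_chirpRate_pos (n := n) j₀ N) (fun a => -2 * Real.pi * I * ξ a)
  have e : ∀ v : Fin d × Fin n → ℝ, wave (-inner ℝ (WithLp.toLp 2 v : Phys d n) ξ) *
      chirpKernel j₀ N (WithLp.toLp 2 v) = (chirpAmp n j₀ N)⁻¹ *
        Complex.exp (-∑ a, (Real.pi ^ 2 / chirpRate j₀ N a) * (v a : ℂ) ^ 2 +
          ∑ a, -2 * Real.pi * I * ξ a * v a) := by
    intro v
    rw [chirpKernel, mul_left_comm, wave_eq, ← Complex.exp_add, add_comm]
    congr 3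
    rw [PiLp.inner_apply]
    push_cast
    rw [← Finset.sum_neg_distrib, Finset.mul_sum, Finset.sum_mul]
    refine Finset.sum_congr rfl fun a _ => ?_
    simp
    ring
  simp_rw [e]
  rw [integral_const_mul, h, Finset.prod_mul_distrib]
  have e2 : ∏ a : Fin d × Fin n, ((Real.pi : ℂ) / (Real.pi ^ 2 / chirpRate j₀ N a)) ^ (1 / 2 : ℂ) =
      chirpAmp n j₀ N := by
    refine Finset.prod_congr rfl fun a _ => ?_
    have := chirpRate_ne_zero j₀ N a
    congr 1
    field_simp
  rw [e2, ← mul_assoc, inv_mul_cancel₀ (chirpAmp_ne_zero j₀ N), one_mul, chirp, ← Complex.exp_sum,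
    ← Finset.sum_neg_distrib]
  congr 1
  refine Finset.sum_congr rfl fun a _ => ?_
  have := chirpRate_ne_zero j₀ N a
  field_simp
  ring_nf
  rw [Complex.I_sq]
  ring

theorem chirpKernel_eq (j₀ : Fin d) (N : ℕ) (x : Phys d n) :
    chirpKernel j₀ N x = (chirpAmp n j₀ N)⁻¹ *
      (Complex.exp (((-∑ a, chirpTwist j₀ N a * x a ^ 2 : ℝ) : ℂ) * I) *
        (Real.exp (-∑ a, chirpDecay j₀ N a * x a ^ 2) : ℝ)) := by
  rw [chirpKernel, Complex.ofReal_exp, ← Complex.exp_add]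
  congr 2
  push_cast
  rw [← Finset.sum_neg_distrib, ← Finset.sum_neg_distrib, ← Finset.sum_neg_distrib,
    Finset.sum_mul, ← Finset.sum_add_distrib]
  refine Finset.sum_congr rfl fun a _ => ?_
  rw [pi_sq_div_chirpRate]
  ring

theorem norm_chirpKernel_le (j₀ : Fin d) (N : ℕ) (x : Phys d n) :
    ‖chirpKernel j₀ N x‖ ≤ ‖chirpAmp n j₀ N‖⁻¹ := by
  rw [chirpKernel_eq, norm_mul, norm_mul, Complex.norm_exp_ofReal_mul_I, one_mul, norm_inv,
    Complex.norm_real, Real.norm_of_nonneg (Real.exp_pos _).le]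
  refine mul_le_of_le_one_right (by positivity) (Real.exp_le_one_iff.2 ?_)
  rw [neg_nonpos]
  exact Finset.sum_nonneg fun a _ => mul_nonneg (chirpDecay_pos j₀ N a).le (sq_nonneg _)

theorem norm_chirp_le (j₀ : Fin d) (N : ℕ) (ξ : Phys d n) : ‖chirp j₀ N ξ‖ ≤ 1 := by
  rw [chirp, Complex.norm_exp, Real.exp_le_one_iff, Complex.neg_re, neg_nonpos, Complex.re_sum]
  refine Finset.sum_nonneg fun a _ => ?_
  have : (chirpRate j₀ N a * (ξ a : ℂ) ^ 2).re = Real.pi * ξ a ^ 2 := by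
    rw [← Complex.ofReal_pow, Complex.re_mul_ofReal, re_chirpRate]
  rw [this]
  positivity

end ChirpKernel

/-! ### Oscillatory integrals with a small phase -/

section Phase

theorem one_sub_abs_le_cos (x : ℝ) : 1 - |x| ≤ Real.cos x := by
  rcases le_or_gt |x| 2 with h | h
  · have h1 := Real.one_sub_sq_div_two_le_cos (x := x)
    have h2 : x ^ 2 = |x| ^ 2 := (sq_abs x).symm
    nlinarith [abs_nonneg x]
  · linarith [Real.neg_one_le_cos x]

/-- Lower bound for an oscillatory integral with a small phase, from `cos φ ≥ 1 - |φ|`. -/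
theorem le_norm_integral_of_phase {E : Type*} [MeasurableSpace E] {μ : Measure E}
    {H G φ ψ : E → ℝ} (hH : Integrable H μ) (hH0 : ∀ y, 0 ≤ H y) (hHG : ∀ y, H y ≤ G y)
    (hφm : AEStronglyMeasurable φ μ) (hφ : ∀ y, |φ y| ≤ ψ y)
    (hψ : Integrable (fun y => ψ y * G y) μ) {A : Set E} (hA : MeasurableSet A) (hA' : μ A ≠ ⊤)
    {c : ℝ} (hc : ∀ y ∈ A, c ≤ H y) :
    c * μ.real A - ∫ y, ψ y * G y ∂μ ≤
      ‖∫ y, Complex.exp ((φ y : ℂ) * Complex.I) * (H y : ℂ) ∂μ‖ := by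
  have hF : Integrable (fun y => Complex.exp ((φ y : ℂ) * Complex.I) * (H y : ℂ)) μ := by
    refine hH.ofReal.bdd_mul (c := 1) ?_ (Filter.Eventually.of_forall fun y => ?_)
    · exact Complex.continuous_exp.comp_aestronglyMeasurable
        ((Complex.continuous_ofReal.comp_aestronglyMeasurable hφm).mul_const _)
    · rw [Complex.norm_exp_ofReal_mul_I]
  calc c * μ.real A - ∫ y, ψ y * G y ∂μ ≤ ∫ y, H y ∂μ - ∫ y, ψ y * G y ∂μ := by
        gcongr
        calc c * μ.real A = ∫ _y in A, c ∂μ := by simp [mul_comm]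
          _ ≤ ∫ y in A, H y ∂μ :=
              setIntegral_mono_on (integrableOn_const hA') hH.integrableOn hA hc
          _ ≤ ∫ y, H y ∂μ := setIntegral_le_integral hH (Filter.Eventually.of_forall hH0)
    _ = ∫ y, (H y - ψ y * G y) ∂μ := (integral_sub hH hψ).symm
    _ ≤ ∫ y, (Complex.exp ((φ y : ℂ) * Complex.I) * (H y : ℂ)).re ∂μ := by
        refine integral_mono (hH.sub hψ) hF.re fun y => ?_
        simp only [Complex.re_mul_ofReal, Complex.exp_ofReal_mul_I_re]
        have h1 := one_sub_abs_le_cos (φ y)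
        have h2 := hφ y
        have h3 := hH0 y
        have h4 : |φ y| * H y ≤ ψ y * G y :=
          mul_le_mul h2 (hHG y) h3 ((abs_nonneg _).trans h2)
        nlinarith
    _ = (∫ y, Complex.exp ((φ y : ℂ) * Complex.I) * (H y : ℂ) ∂μ).re := integral_re hF
    _ ≤ _ := Complex.re_le_norm _

variable {d n : ℕ}

theorem physScale_coord (j₀ : Fin d) {N : ℕ} (hN : 1 ≤ N) (z : Phys d n) (a : Fin d × Fin n) :
    physScale j₀ N z a = (if a.1 = j₀ then (N : ℝ) else 1) * z a := by
  rw [physScale, diagE_apply, sc_eq hN]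

theorem abs_coord_le (x : Phys d n) (a : Fin d × Fin n) : |x a| ≤ ‖x‖ := by
  simpa using PiLp.norm_apply_le x a

theorem abs_chirpTwist_mul_le (j₀ : Fin d) {N : ℕ} (hN : 1 ≤ N) (z y : Phys d n)
    (a : Fin d × Fin n) :
    |chirpTwist j₀ N a * (y a ^ 2 - 2 * physScale j₀ N z a * y a)| ≤
      Real.pi * (‖y‖ ^ 2 / N + 2 * ‖z‖ * ‖y‖) := by
  have hN1 : (1 : ℝ) ≤ N := by exact_mod_cast hN
  have hy := abs_coord_le y a
  have hz := abs_coord_le z a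
  rw [physScale_coord j₀ hN]
  unfold chirpTwist
  split_ifs
  · have h1 : |y a ^ 2 - 2 * (N * z a) * y a| ≤ ‖y‖ ^ 2 + 2 * N * ‖z‖ * ‖y‖ := by
      refine (abs_sub _ _).trans (add_le_add ?_ ?_)
      · rw [abs_pow]; gcongr
      · rw [abs_mul, abs_mul, abs_mul, abs_two, Nat.abs_cast, ← mul_assoc]; gcongr
    have h2 : N / (1 + (N : ℝ) ^ 2) ≤ 1 / N := by
      rw [div_le_div_iff₀ (by positivity) (by positivity)]; nlinarith
    rw [abs_mul, abs_of_nonneg (by positivity), mul_div_assoc, mul_assoc]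
    gcongr
    calc N / (1 + (N : ℝ) ^ 2) * |y a ^ 2 - 2 * (N * z a) * y a|
        ≤ 1 / N * (‖y‖ ^ 2 + 2 * N * ‖z‖ * ‖y‖) := by gcongr
      _ = _ := by field_simp
  · rw [zero_mul, abs_zero]; positivity

theorem sum_chirpDecay_mul_le (j₀ : Fin d) {N : ℕ} (hN : 1 ≤ N) (z y : Phys d n) :
    ∑ a, chirpDecay j₀ N a * (physScale j₀ N z - y) a ^ 2 ≤
      2 * Real.pi * (‖z‖ ^ 2 + ‖y‖ ^ 2) := by
  rw [EuclideanSpace.norm_sq_eq, EuclideanSpace.norm_sq_eq, ← Finset.sum_add_distrib,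
    Finset.mul_sum]
  refine Finset.sum_le_sum fun a _ => ?_
  rw [PiLp.sub_apply, physScale_coord j₀ hN, Real.norm_eq_abs, Real.norm_eq_abs, sq_abs, sq_abs]
  unfold chirpDecay
  have hpi := Real.pi_pos
  split_ifs
  · rw [div_mul_eq_mul_div, div_le_iff₀ (by positivity), mul_assoc, mul_comm (2 : ℝ), mul_assoc]
    gcongr
    nlinarith [sq_nonneg ((N : ℝ) * z a + y a), sq_nonneg (N * y a), sq_nonneg (z a)]
  · rw [mul_comm (2 : ℝ), mul_assoc]
    gcongr
    nlinarith [sq_nonneg (z a + y a)]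

/-- After removal of a unimodular constant the phase of the chirped kernel is small on the ball
expanded by the factor `N`, so that there is no cancellation. -/
theorem exists_le_norm_integral_chirpKernel (j₀ : Fin d) {G : Phys d n → ℝ} {γ δ : ℝ}
    (hG0 : ∀ y, 0 ≤ G y) (hG : Integrable G)
    (hG1 : Integrable fun y => ‖y‖ * G y) (hG2 : Integrable fun y => ‖y‖ ^ 2 * G y)
    (hγ : 0 < γ) (hδ : 0 < δ) (hGγ : ∀ y, ‖y‖ ≤ δ → γ ≤ G y) :
    ∃ c > 0, ∃ δ' > 0, ∃ N₀ : ℕ, ∀ N : ℕ, N₀ ≤ N → 1 ≤ N → ∀ z : Phys d n, ‖z‖ ≤ δ' →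
      c * (N : ℝ) ^ (-((n : ℝ) / 2)) ≤
        ‖∫ y, chirpKernel j₀ N (physScale j₀ N z - y) * (G y : ℂ)‖ := by
  set V := volume.real (Metric.closedBall (0 : Phys d n) δ) with hVdef
  have hV : 0 < V :=
    ENNReal.toReal_pos (Metric.measure_closedBall_pos _ _ hδ).ne' measure_closedBall_lt_top.ne
  set κ : ℝ := ((Fintype.card (Fin d × Fin n) : ℕ) : ℝ) with hκ
  set M₁ := ∫ y, ‖y‖ * G y with hM₁
  set M₂ := ∫ y, ‖y‖ ^ 2 * G y with hM₂
  have hM₁0 : 0 ≤ M₁ := integral_nonneg fun y => mul_nonneg (norm_nonneg _) (hG0 y)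
  have hM₂0 : 0 ≤ M₂ := integral_nonneg fun y => mul_nonneg (by positivity) (hG0 y)
  have hpi := Real.pi_pos
  -- `c₀` bounds the integral without the phase from below; `N₀` and `δ'` make the loss caused by the
  -- phase at most `c₀ / 2`
  set c₀ := Real.exp (-(4 * Real.pi * δ ^ 2)) * γ * V with hc₀
  have hc₀p : 0 < c₀ := by positivity
  have hκ0 : 0 ≤ κ := by positivity
  obtain ⟨N₀, hN₀⟩ := exists_nat_gt (4 * (κ * Real.pi * M₂) / c₀)
  set δ' := min δ (c₀ / (8 * (κ * Real.pi * M₁ + 1))) with hδ'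
  have hδ'p : 0 < δ' := lt_min hδ (by positivity)
  refine ⟨2 ^ (-((n : ℝ) / 2)) * (c₀ / 2), by positivity, δ', hδ'p, N₀, fun N hN hN1 z hz => ?_⟩
  have hN0 : (0 : ℝ) < N := by exact_mod_cast hN1
  have hzδ : ‖z‖ ≤ δ := hz.trans (min_le_left _ _)
  let w : Phys d n := physScale j₀ N z
  let R : Phys d n → ℝ := fun y => Real.exp (-∑ a, chirpDecay j₀ N a * (w - y) a ^ 2)
  have hR0 : ∀ y, 0 ≤ R y := fun y => (Real.exp_pos _).le
  have hR1 : ∀ y, R y ≤ 1 := fun y => by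
    rw [Real.exp_le_one_iff, neg_nonpos]
    exact Finset.sum_nonneg fun a _ => mul_nonneg (chirpDecay_pos j₀ N a).le (sq_nonneg _)
  have hRc : Continuous R := by fun_prop
  let φ : Phys d n → ℝ := fun y => -∑ a, chirpTwist j₀ N a * (y a ^ 2 - 2 * w a * y a)
  let ψ : Phys d n → ℝ := fun y => κ * (Real.pi * (‖y‖ ^ 2 / N + 2 * ‖z‖ * ‖y‖))
  have hφψ : ∀ y, |φ y| ≤ ψ y := fun y => by
    rw [abs_neg]
    refine (Finset.abs_sum_le_sum_abs _ _).trans ((Finset.sum_le_sum fun a _ =>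
      abs_chirpTwist_mul_le j₀ hN1 z y a).trans ?_)
    simp [ψ, κ]
  have hψG : (fun y => ψ y * G y) = fun y => κ * Real.pi / N * (‖y‖ ^ 2 * G y) +
      κ * Real.pi * 2 * ‖z‖ * (‖y‖ * G y) := by
    funext y; simp only [ψ]; ring
  have hψint : Integrable fun y => ψ y * G y := by
    rw [hψG]; exact (hG2.const_mul _).add (hG1.const_mul _)
  have hψle : ∫ y, ψ y * G y ≤ c₀ / 2 := by
    rw [hψG, integral_add (hG2.const_mul _) (hG1.const_mul _), integral_const_mul,
      integral_const_mul, ← hM₁, ← hM₂]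
    have h1 : κ * Real.pi / N * M₂ ≤ c₀ / 4 := by
      have h2 : (N₀ : ℝ) ≤ N := by exact_mod_cast hN
      have h3 := hN₀.trans_le h2
      rw [div_lt_iff₀ hc₀p] at h3
      rw [div_mul_eq_mul_div, div_le_iff₀ hN0]
      linarith
    have h2 : κ * Real.pi * 2 * ‖z‖ * M₁ ≤ c₀ / 4 := by
      have h3 := hz.trans (min_le_right _ _)
      rw [le_div_iff₀ (by positivity)] at h3
      nlinarith [norm_nonneg z]
    linarith
  have hHint : Integrable fun y => R y * G y :=
    hG.bdd_mul (c := 1) hRc.aestronglyMeasurable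
      (Filter.Eventually.of_forall fun y => by rw [Real.norm_of_nonneg (hR0 y)]; exact hR1 y)
  have hφc : Continuous φ := by fun_prop
  have key := le_norm_integral_of_phase (μ := volume) hHint
    (fun y => mul_nonneg (hR0 y) (hG0 y))
    (fun y => mul_le_of_le_one_left (hG0 y) (hR1 y)) hφc.aestronglyMeasurable hφψ hψint
    (A := Metric.closedBall 0 δ) measurableSet_closedBall measure_closedBall_lt_top.ne
    (c := Real.exp (-(4 * Real.pi * δ ^ 2)) * γ) (fun y hy => by
      rw [mem_closedBall_zero_iff] at hy
      have h1 := sum_chirpDecay_mul_le j₀ hN1 z y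
      have h2 : ‖z‖ ^ 2 ≤ δ ^ 2 := by gcongr
      have h3 : ‖y‖ ^ 2 ≤ δ ^ 2 := by gcongr
      refine mul_le_mul (Real.exp_le_exp.2 (neg_le_neg (h1.trans ?_))) (hGγ y hy) hγ.le (hR0 y)
      nlinarith)
  have e : ∀ y, chirpKernel j₀ N (w - y) * (G y : ℂ) =
      (chirpAmp n j₀ N)⁻¹ * Complex.exp (((-∑ a, chirpTwist j₀ N a * w a ^ 2 : ℝ) : ℂ) *
        Complex.I) * (Complex.exp ((φ y : ℂ) * Complex.I) * ((R y * G y : ℝ) : ℂ)) := by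
    intro y
    rw [chirpKernel_eq]
    have h1 : (-∑ a, chirpTwist j₀ N a * (w - y) a ^ 2 : ℝ) =
        -∑ a, chirpTwist j₀ N a * w a ^ 2 + φ y := by
      simp only [φ]
      rw [← neg_add, ← Finset.sum_add_distrib]
      congr 1
      refine Finset.sum_congr rfl fun a _ => ?_
      rw [PiLp.sub_apply]
      ring
    have h2 : Real.exp (-∑ a, chirpDecay j₀ N a * (w - y) a ^ 2) = R y := rfl
    rw [h1, h2, Complex.ofReal_add, Complex.ofReal_mul, add_mul, Complex.exp_add]
    ring
  simp_rw [show physScale j₀ N z = w from rfl, e]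
  rw [integral_const_mul, norm_mul, norm_mul, Complex.norm_exp_ofReal_mul_I, mul_one, norm_inv]
  have h1 : 2 ^ (-((n : ℝ) / 2)) * (N : ℝ) ^ (-((n : ℝ) / 2)) ≤ ‖chirpAmp n j₀ N‖⁻¹ := by
    rw [Real.rpow_neg (by norm_num), Real.rpow_neg hN0.le, ← mul_inv]
    exact inv_anti₀ (norm_pos_iff.2 (chirpAmp_ne_zero j₀ N)) (norm_chirpAmp_le j₀ hN1)
  calc 2 ^ (-((n : ℝ) / 2)) * (c₀ / 2) * (N : ℝ) ^ (-((n : ℝ) / 2))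
      = 2 ^ (-((n : ℝ) / 2)) * (N : ℝ) ^ (-((n : ℝ) / 2)) * (c₀ / 2) := by ring
    _ ≤ ‖chirpAmp n j₀ N‖⁻¹ * _ := by
        gcongr
        refine le_trans ?_ key
        linarith

end Phase

/-! ### Testing on chirped Gaussian symbols -/

section ChirpTest

open scoped ContDiff

variable {l d n : ℕ}

/-- `|x_{j₀}|²`. -/
def blockSq (j₀ : Fin d) (x : Phys d n) : ℝ := ∑ a, if a.1 = j₀ then x a ^ 2 else 0

theorem contDiff_blockSq (j₀ : Fin d) : ContDiff ℝ ∞ (blockSq (n := n) j₀) := by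
  refine ContDiff.sum fun a _ => ?_
  split_ifs
  · fun_prop
  · exact contDiff_const

theorem blockSq_congr {j₀ : Fin d} {x y : Phys d n} (h : ∀ a, a.1 = j₀ → x a = y a) :
    blockSq j₀ x = blockSq j₀ y := by
  refine Finset.sum_congr rfl fun a _ => ?_
  split_ifs with ha
  · rw [h a ha]
  · rfl

theorem chirp_eq (j₀ : Fin d) (N : ℕ) (x : Phys d n) :
    chirp j₀ N x = Complex.exp (((N * (Real.pi * blockSq j₀ x) : ℝ) : ℂ) * Complex.I) *
      (Real.exp (-(Real.pi * ‖x‖ ^ 2)) : ℝ) := by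
  rw [chirp, Complex.ofReal_exp, ← Complex.exp_add]
  congr 1
  rw [EuclideanSpace.norm_sq_eq, blockSq]
  push_cast
  rw [← Finset.sum_neg_distrib, Finset.mul_sum, Finset.mul_sum, Finset.mul_sum, Finset.sum_mul,
    ← Finset.sum_neg_distrib, ← Finset.sum_add_distrib]
  refine Finset.sum_congr rfl fun a _ => ?_
  rw [← Complex.ofReal_pow ‖_‖, Real.norm_eq_abs, sq_abs, chirpRate]
  split_ifs <;> push_cast <;> ring

theorem contDiff_chirp (j₀ : Fin d) (N : ℕ) : ContDiff ℝ ∞ (chirp (n := n) j₀ N) := by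
  have h : chirp (n := n) j₀ N = fun x => Complex.exp (-∑ a, chirpRate j₀ N a * (x a : ℂ) ^ 2) := rfl
  rw [h]
  refine ContDiff.cexp (ContDiff.neg (ContDiff.sum fun a _ => ?_))
  refine contDiff_const.mul (ContDiff.pow ?_ 2)
  exact Complex.ofRealCLM.contDiff.comp (by fun_prop)

theorem hasCompactSupport_of_norm_le {E : Type*} [NormedAddCommGroup E] [ProperSpace E] {f : E → ℂ}
    {r : ℝ} (h : ∀ x, f x ≠ 0 → ‖x‖ ≤ r) : HasCompactSupport f :=
  HasCompactSupport.intro (isCompact_closedBall 0 r) fun x hx => by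
    by_contra hne
    exact hx (mem_closedBall_zero_iff.2 (h x hne))

/-- The function whose Fourier transform is `chirp * 𝓕 g`, for band-limited `g`. -/
noncomputable def chirped (j₀ : Fin d) (N : ℕ) {g : 𝓢(Phys d n, ℂ)} {r : ℝ}
    (hg : ∀ ξ, 𝓕 g ξ ≠ 0 → ‖ξ‖ ≤ r) : 𝓢(Phys d n, ℂ) :=
  𝓕⁻ (mulCS (chirp j₀ N) (contDiff_chirp j₀ N) (𝓕 g) (hasCompactSupport_of_norm_le hg))

theorem fourier_chirped (j₀ : Fin d) (N : ℕ) {g : 𝓢(Phys d n, ℂ)} {r : ℝ}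
    (hg : ∀ ξ, 𝓕 g ξ ≠ 0 → ‖ξ‖ ≤ r) (ξ : Phys d n) :
    𝓕 (chirped j₀ N hg) ξ = chirp j₀ N ξ * 𝓕 g ξ := by
  rw [chirped, FourierTransform.fourier_fourierInv_eq, mulCS_apply]

theorem norm_chirped_le (j₀ : Fin d) (N : ℕ) {g : 𝓢(Phys d n, ℂ)} {r : ℝ}
    (hg : ∀ ξ, 𝓕 g ξ ≠ 0 → ‖ξ‖ ≤ r) (x : Phys d n) :
    ‖chirped j₀ N hg x‖ ≤ ‖chirpAmp n j₀ N‖⁻¹ * ∫ y, ‖g y‖ := by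
  have h : chirped j₀ N hg x = ∫ y, chirpKernel j₀ N (x - y) * g y := by
    rw [← integral_fourier_mul (integrable_chirpKernel j₀ N), schwartz_eq_integral_fourier]
    refine integral_congr_ae (Filter.Eventually.of_forall fun ξ => ?_)
    simp only [fourier_chirped, fourier_chirpKernel]
  rw [h, ← integral_const_mul]
  refine (norm_integral_le_integral_norm _).trans (integral_mono_of_nonneg
    (Filter.Eventually.of_forall fun y => norm_nonneg _) (g.integrable.norm.const_mul _)
    (Filter.Eventually.of_forall fun y => ?_))
  simp only [norm_mul]
  gcongr
  exact norm_chirpKernel_le j₀ N _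

/-- Plancherel's identity. -/
theorem lintegral_enorm_sq_eq {E : Type*} [NormedAddCommGroup E] [InnerProductSpace ℝ E]
    [FiniteDimensional ℝ E] [MeasurableSpace E] [BorelSpace E] (f : 𝓢(E, ℂ)) :
    ∫⁻ x, ‖f x‖ₑ ^ (2 : ℝ) = ∫⁻ x, ‖𝓕 f x‖ₑ ^ (2 : ℝ) := by
  have h : ∀ f : 𝓢(E, ℂ), ∫⁻ x, ‖f x‖ₑ ^ (2 : ℝ) = ENNReal.ofReal (∫ x, ‖f x‖ ^ 2) := by
    intro f
    have hint : Integrable (fun x => ‖f x‖ ^ 2) :=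
      (memLp_two_iff_integrable_sq_norm f.continuous.aestronglyMeasurable).1 (f.memLp 2 volume)
    rw [ofReal_integral_eq_lintegral_ofReal hint (Filter.Eventually.of_forall fun x => sq_nonneg _)]
    refine lintegral_congr fun x => ?_
    rw [← ofReal_norm, ENNReal.ofReal_rpow_of_nonneg (norm_nonneg _) zero_le_two, Real.rpow_two]
  rw [h, h, SchwartzMap.integral_norm_sq_fourier]

/-- The chirp spreads a function out: the `L^q` norm with `q ≥ 2` is lowered as it would be for a
function of constant modulus on a ball of radius `N` in `ℝⁿ`. -/
theorem eLpNorm_chirped_le (j₀ : Fin d) {g : 𝓢(Phys d n, ℂ)} {r : ℝ}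
    (hg : ∀ ξ, 𝓕 g ξ ≠ 0 → ‖ξ‖ ≤ r) {q : ℝ} (hq : 2 ≤ q) :
    ∃ C : ℝ≥0, ∀ N : ℕ, 1 ≤ N → eLpNorm (chirped j₀ N hg) (ENNReal.ofReal q) volume ≤
      C * ENNReal.ofReal ((N : ℝ) ^ ((n : ℝ) / q - n / 2)) := by
  have hq0 : 0 < q := by linarith
  set M := ∫ y, ‖g y‖ with hM
  have hM0 : 0 ≤ M := integral_nonneg fun _ => norm_nonneg _
  set L := ∫⁻ x, ‖g x‖ₑ ^ (2 : ℝ) with hL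
  have hLt : L ≠ ⊤ := by
    have h := lintegral_rpow_enorm_lt_top_of_eLpNorm_lt_top (p := 2) (by simp) (by simp)
      (g.memLp 2 volume).2
    rw [ENNReal.toReal_ofNat] at h
    exact h.ne
  refine ⟨Real.toNNReal (M ^ ((q - 2) / q)) * (L ^ (1 / q)).toNNReal, fun N hN => ?_⟩
  have hN0 : (0 : ℝ) < N := by exact_mod_cast hN
  set f := chirped j₀ N hg with hf
  set S := (N : ℝ) ^ (-((n : ℝ) / 2)) * M with hS
  have hsup : ∀ x, ‖f x‖ ≤ S := fun x => by
    refine (norm_chirped_le j₀ N hg x).trans ?_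
    refine mul_le_mul_of_nonneg_right ?_ hM0
    rw [Real.rpow_neg hN0.le]
    exact inv_anti₀ (by positivity) (rpow_le_norm_chirpAmp j₀ N)
  have h2 : ∫⁻ x, ‖f x‖ₑ ^ (2 : ℝ) ≤ L := by
    rw [hL, lintegral_enorm_sq_eq, lintegral_enorm_sq_eq g]
    refine lintegral_mono fun ξ => ?_
    rw [hf, fourier_chirped]
    refine ENNReal.rpow_le_rpow ?_ zero_le_two
    rw [← ofReal_norm, ← ofReal_norm, norm_mul]
    exact ENNReal.ofReal_le_ofReal
      (mul_le_of_le_one_left (norm_nonneg _) (norm_chirp_le j₀ N ξ))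
  have h3 : ∫⁻ x, ‖f x‖ₑ ^ q ≤ ENNReal.ofReal (S ^ (q - 2)) * L := by
    refine le_trans ?_ (mul_le_mul_right h2 _)
    rw [← lintegral_const_mul _ (f.continuous.enorm.measurable.pow_const _)]
    refine lintegral_mono fun x => ?_
    have e : q = (q - 2) + 2 := by ring
    calc ‖f x‖ₑ ^ q = ‖f x‖ₑ ^ (q - 2) * ‖f x‖ₑ ^ (2 : ℝ) := by
          rw [← ENNReal.rpow_add_of_nonneg _ _ (by linarith) zero_le_two, ← e]
      _ ≤ _ := by
          gcongr
          rw [← ENNReal.ofReal_rpow_of_nonneg (by positivity) (by linarith), ← ofReal_norm]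
          exact ENNReal.rpow_le_rpow (ENNReal.ofReal_le_ofReal (hsup x)) (by linarith)
  rw [eLpNorm_eq_lintegral_rpow_enorm_toReal (by simpa using hq0) ENNReal.ofReal_ne_top,
    ENNReal.toReal_ofReal hq0.le]
  refine (ENNReal.rpow_le_rpow h3 (by positivity)).trans (le_of_eq ?_)
  rw [ENNReal.mul_rpow_of_nonneg _ _ (by positivity),
    ENNReal.ofReal_rpow_of_nonneg (by positivity) (by positivity), ← Real.rpow_mul (by positivity),
    hS, Real.mul_rpow (by positivity) hM0, ← Real.rpow_mul hN0.le, ENNReal.ofReal_mul (by positivity)]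
  have e1 : -((n : ℝ) / 2) * ((q - 2) * (1 / q)) = n / q - n / 2 := by field_simp; ring
  have e2 : (q - 2) * (1 / q) = (q - 2) / q := by ring
  rw [e1, e2]
  push_cast
  rw [ENNReal.coe_toNNReal (ENNReal.rpow_ne_top_of_nonneg (by positivity) hLt)]
  simp only [ENNReal.ofReal]
  ring

/-- The phase of the chirped symbol. -/
noncomputable def chirpPhase (j₀ : Fin d) (I : Finset (Fin l)) (ξ : Freq l d n) : ℝ :=
  Real.pi * (blockSq j₀ (∑ i, slot i ξ) - ∑ i ∈ I, blockSq j₀ (slot i ξ))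

/-- The logarithm of the modulus of the chirped symbol where the plateau functions are `1`. -/
noncomputable def chirpWeight (I : Finset (Fin l)) (ξ : Freq l d n) : ℝ :=
  Real.pi * (∑ i ∈ I, ‖slot i ξ‖ ^ 2 - ‖∑ i, slot i ξ‖ ^ 2)

theorem contDiff_slot (i : Fin l) : ContDiff ℝ ∞ (slot (d := d) (n := n) i) := (slotC i).contDiff

theorem contDiff_chirpPhase (j₀ : Fin d) (I : Finset (Fin l)) :
    ContDiff ℝ ∞ (chirpPhase (n := n) j₀ I) :=
  contDiff_const.mul (((contDiff_blockSq j₀).comp (ContDiff.sum fun i _ => contDiff_slot i)).sub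
    (ContDiff.sum fun i _ => (contDiff_blockSq j₀).comp (contDiff_slot i)))

theorem contDiff_chirpWeight (I : Finset (Fin l)) :
    ContDiff ℝ ∞ (chirpWeight (d := d) (n := n) I) :=
  contDiff_const.mul ((ContDiff.sum fun i _ => (contDiff_slot i).norm_sq ℝ).sub
    ((ContDiff.sum fun i _ => contDiff_slot i).norm_sq ℝ))

/-- The chirped symbol trades the chirps of the inputs for one chirp of the output. -/
theorem exp_chirpPhase_mul_prod (j₀ : Fin d) (I : Finset (Fin l)) (N : ℕ) (ξ : Freq l d n) :
    Complex.exp (((N * chirpPhase j₀ I ξ : ℝ) : ℂ) * Complex.I) * (Real.exp (chirpWeight I ξ) : ℝ) *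
      ∏ i ∈ I, chirp j₀ N (slot i ξ) = chirp j₀ N (∑ i, slot i ξ) := by
  simp_rw [chirp_eq, Complex.ofReal_exp, ← Complex.exp_add]
  rw [← Complex.exp_sum, ← Complex.exp_add]
  congr 1
  rw [Finset.sum_add_distrib, ← Finset.sum_mul, ← Complex.ofReal_sum, ← Complex.ofReal_sum,
    ← Finset.mul_sum, ← Finset.mul_sum, Finset.sum_neg_distrib, ← Finset.mul_sum, chirpPhase,
    chirpWeight]
  push_cast
  ring

/-- The amplitude of the chirped symbol. -/
noncomputable def chirpBase (d n : ℕ) (i₀ : Fin l) (I : Finset (Fin l)) : 𝓢(Freq l d n, ℂ) :=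
  mulCS (fun ξ => ((Real.exp (chirpWeight I ξ) : ℝ) : ℂ))
    (Complex.ofRealCLM.contDiff.comp (Real.contDiff_exp.comp (contDiff_chirpWeight I)))
    (tensorS (fun _ => plateau i₀) fun _ _ h => norm_le_of_plateau_ne_zero i₀ h)
    (hasCompactSupport_of_norm_le fun _ h => (norm_le_sum_slot _).trans
      (Finset.sum_le_sum fun i _ => norm_le_of_prod_slot_ne_zero
        (fun _ _ h => norm_le_of_plateau_ne_zero i₀ h) h i))

/-- The chirped symbol `e^{iN chirpPhase} e^{chirpWeight} ∏_i plateau(ξ_i)`: on the region where the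
plateau functions are `1` it is the quotient of the chirped Gaussian at `ξ_1 + ⋯ + ξ_l` by the chirped
Gaussians at `ξ_i`, `i ∈ I`. -/
noncomputable def chirpSymb (i₀ : Fin l) (j₀ : Fin d) (I : Finset (Fin l)) (N : ℕ) :
    𝓢(Freq l d n, ℂ) :=
  mulCS (fun ξ => Complex.exp (((N * chirpPhase j₀ I ξ : ℝ) : ℂ) * Complex.I))
    (ContDiff.cexp ((Complex.ofRealCLM.contDiff.comp
      (contDiff_const.mul (contDiff_chirpPhase j₀ I))).mul contDiff_const))
    (chirpBase d n i₀ I) (hasCompactSupport_mulCS _ _ _)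

theorem chirpSymb_apply (i₀ : Fin l) (j₀ : Fin d) (I : Finset (Fin l)) (N : ℕ) (ξ : Freq l d n) :
    chirpSymb i₀ j₀ I N ξ = Complex.exp (((N * chirpPhase j₀ I ξ : ℝ) : ℂ) * Complex.I) *
      ((Real.exp (chirpWeight I ξ) : ℝ) * ∏ i, plateau i₀ (slot i ξ)) := rfl

theorem norm_le_of_chirpSymb_ne_zero {i₀ : Fin l} {j₀ : Fin d} {I : Finset (Fin l)} {N : ℕ}
    {ξ : Freq l d n} (h : chirpSymb i₀ j₀ I N ξ ≠ 0) : ‖ξ‖ ≤ 1 / 2 := by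
  rw [chirpSymb_apply] at h
  have h1 := right_ne_zero_of_mul (right_ne_zero_of_mul h)
  have h2 := (norm_le_sum_slot ξ).trans (Finset.sum_le_sum fun i _ =>
    norm_le_of_prod_slot_ne_zero (Φ := fun _ => plateau i₀)
      (fun _ _ h => norm_le_of_plateau_ne_zero i₀ h) h1 i)
  have h3 := two_mul_rad i₀
  simp only [Finset.sum_const, Finset.card_univ, Fintype.card_fin, nsmul_eq_mul] at h2
  linarith [norm_nonneg ξ]

theorem fderiv_eq_zero_of_forall_add {E : Type*} [NormedAddCommGroup E] [NormedSpace ℝ E]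
    {f : E → ℝ} {x v : E} (hf : DifferentiableAt ℝ f x) (h : ∀ t : ℝ, f (x + t • v) = f x) :
    fderiv ℝ f x v = 0 := by
  rw [← hf.lineDeriv_eq_fderiv, lineDeriv]
  simp_rw [h]
  exact deriv_const _ _

/-- The phase depends on the block `j₀` only. -/
theorem chirpPhase_add {j₀ : Fin d} {I : Finset (Fin l)} {ξ v : Freq l d n}
    (hv : ∀ b, b.2.1 = j₀ → v b = 0) : chirpPhase j₀ I (ξ + v) = chirpPhase j₀ I ξ := by
  have h : ∀ i, ∀ a : Fin d × Fin n, a.1 = j₀ → slot i (ξ + v) a = slot i ξ a := by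
    intro i a ha
    simp [slot, hv (i, a) ha]
  rw [chirpPhase, chirpPhase, blockSq_congr (y := ∑ i, slot i ξ) fun a ha => ?_,
    Finset.sum_congr rfl fun i _ => blockSq_congr (h i)]
  simp only [WithLp.ofLp_sum, Finset.sum_apply]
  exact Finset.sum_congr rfl fun i _ => h i a ha

variable {Θ : Fin d → 𝓢(Block l n, ℂ)} {hΘ : ∀ j ξ, 𝓕 (Θ j) ξ ≠ 0 → 1 / 2 ≤ ‖ξ‖ ∧ ‖ξ‖ ≤ 2}
  {ξ₀ : Freq l d n} {s : Fin d → ℝ} {u p : ℝ} {q : Fin l → ℝ}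

/-- The chirped symbols have bounded modulus and bounded support, and each derivative in the
parameter `j₀` costs a factor `N`. -/
theorem eLpNorm_lift_view_chirpSymb_le
    (hΘ : ∀ j ξ, 𝓕 (Θ j) ξ ≠ 0 → 1 / 2 ≤ ‖ξ‖ ∧ ‖ξ‖ ≤ 2) (ξ₀ : Freq l d n)
    (hs : ∀ j, 0 ≤ s j) (hu : 1 ≤ u) (i₀ : Fin l) (j₀ : Fin d) (I : Finset (Fin l)) :
    ∃ C : ℝ≥0, ∀ κ ∈ nearScales d, ∀ N : ℕ, 1 ≤ N →
      eLpNorm (lift s (view hΘ ξ₀ κ (chirpSymb i₀ j₀ I N))) (ENNReal.ofReal u) volume ≤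
        C * ENNReal.ofReal ((N : ℝ) ^ s j₀) := by
  have hu' : (1 : ℝ≥0∞) ≤ ENNReal.ofReal u := by
    rw [← ENNReal.ofReal_one]; exact ENNReal.ofReal_le_ofReal hu
  have key : ∀ κ : Fin d → ℤ, ∃ C : ℝ≥0, ∀ N : ℕ, 1 ≤ N →
      eLpNorm (lift s (view hΘ ξ₀ κ (chirpSymb i₀ j₀ I N))) (ENNReal.ofReal u) volume ≤
        C * ENNReal.ofReal ((N : ℝ) ^ s j₀) := by
    intro κ
    have hsm : ContDiff ℝ ∞ fun ξ : Freq l d n => chirpPhase j₀ I (dilC κ ξ - ξ₀) :=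
      (contDiff_chirpPhase j₀ I).comp ((dilC κ).contDiff.sub contDiff_const)
    obtain ⟨C, hC⟩ := (scaledFamily_chirp (j₀ := j₀) hu' hsm (fun a ha ξ =>
      fderiv_eq_zero_of_forall_add (hsm.differentiable (by simp) ξ) fun t => by
        rw [map_add, map_smul, add_sub_right_comm]
        refine chirpPhase_add fun b hb => ?_
        have hne : b ≠ a := fun h => ha (by rw [← h]; exact hb)
        simp [dilate, basisVec, hne])
      (F := fun N => view hΘ ξ₀ κ (chirpSymb i₀ j₀ I N)) (X := view hΘ ξ₀ κ (chirpBase d n i₀ I))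
      (hasCompactSupport_mulCS _ _ _) (fun N ξ => by
        rw [view_apply, view_apply, ← mul_assoc]; rfl)).lift hu' ENNReal.ofReal_ne_top hs
    exact ⟨C, fun N hN => by simpa using hC N hN⟩
  choose C hC using key
  refine ⟨∑ κ ∈ nearScales d, C κ, fun κ hκ N hN => (hC κ N hN).trans ?_⟩
  gcongr
  exact Finset.single_le_sum (f := C) (fun _ _ => zero_le) hκ

/-- Testing on chirped inputs, for the slots with `q_i ≥ 2`, with a symbol that undoes the chirps and
puts a chirp on the output. -/
theorem LocalBound.chirp_le (hloc : LocalBound hΘ ξ₀ s u p q) (hs : ∀ j, 0 ≤ s j) (hu : 1 ≤ u)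
    (hp : 0 < p) (i₀ : Fin l) (j₀ : Fin d) {I : Finset (Fin l)} (hI : ∀ i ∈ I, 2 ≤ q i) :
    n / p - n / 2 ≤ s j₀ + ∑ i ∈ I, (n / q i - n / 2) := by
  obtain ⟨g, ρ, γ, δ, hρ, hρ0, hg, hγ, hδ, hργ⟩ := exists_kernel (d := d) (n := n) (testRad_pos i₀)
  obtain ⟨C, hC⟩ := hloc
  obtain ⟨C', hC'⟩ := eLpNorm_lift_view_chirpSymb_le hΘ ξ₀ hs hu i₀ j₀ I
  let f : ℕ → Fin l → 𝓢(Phys d n, ℂ) := fun N i => if i ∈ I then chirped j₀ N hg else g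
  have hf : ∀ i, ∃ D : ℝ≥0, ∀ N : ℕ, 1 ≤ N → eLpNorm (f N i) (ENNReal.ofReal (q i)) volume ≤
      D * ENNReal.ofReal (if i ∈ I then (N : ℝ) ^ ((n : ℝ) / q i - n / 2) else 1) := by
    intro i
    by_cases hi : i ∈ I
    · simp only [f, if_pos hi]
      exact eLpNorm_chirped_le j₀ hg (hI i hi)
    · simp only [f, if_neg hi]
      refine ⟨(eLpNorm g (ENNReal.ofReal (q i)) volume).toNNReal, fun N _ => ?_⟩
      rw [ENNReal.coe_toNNReal (g.memLp _ volume).2.ne]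
      simp
  choose D hD using hf
  -- the product of the inputs as a nonnegative weight with finite moments
  have hmom : ∀ k : ℕ, Integrable fun y => ‖y‖ ^ k * ρ y ^ l := by
    intro k
    have h1 : Integrable fun y => ‖y‖ ^ k * ‖g y‖ := g.integrable_pow_mul volume k
    have h2 := h1.mul_bdd (g := fun y => ‖g y‖ ^ (l - 1))
      (c := SchwartzMap.seminorm ℝ 0 0 g ^ (l - 1))
      (g.continuous.norm.pow _).aestronglyMeasurable (Filter.Eventually.of_forall fun y => by
        rw [norm_pow, norm_norm]
        exact pow_le_pow_left₀ (norm_nonneg _) (SchwartzMap.norm_le_seminorm ℝ g y) _)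
    refine h2.congr (Filter.Eventually.of_forall fun y => ?_)
    have e : ‖g y‖ = ρ y := by rw [hρ, Complex.norm_real, Real.norm_of_nonneg (hρ0 y)]
    simp only [e]
    rw [mul_assoc, ← pow_succ', Nat.sub_add_cancel i₀.pos]
  obtain ⟨c, hc, δ', hδ', N₀, hlow⟩ := exists_le_norm_integral_chirpKernel j₀
    (G := fun y => ρ y ^ l) (γ := γ ^ l) (fun y => pow_nonneg (hρ0 y) l) (by simpa using hmom 0)
    (by simpa using hmom 1) (hmom 2) (pow_pos hγ l) hδ
    (fun y hy => pow_le_pow_left₀ hγ.le (hργ y (by linarith)) l)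
  have hT : ∀ N x, multiplierOp (chirpSymb i₀ j₀ I N) (f N) x =
      ∫ y, chirpKernel j₀ N (x - y) * ((ρ y ^ l : ℝ) : ℂ) := by
    intro N x
    rw [multiplierOp_eq_convolution (integrable_chirpKernel j₀ N) (h := fun _ => g) fun ξ => ?_]
    · refine integral_congr_ae (Filter.Eventually.of_forall fun y => ?_)
      simp [hρ]
    have e : ∏ i, 𝓕 (f N i) (slot i ξ) =
        (∏ i ∈ I, chirp j₀ N (slot i ξ)) * ∏ i, 𝓕 g (slot i ξ) := by
      have : ∀ i, 𝓕 (f N i) (slot i ξ) =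
          (if i ∈ I then chirp j₀ N (slot i ξ) else 1) * 𝓕 g (slot i ξ) := by
        intro i
        simp only [f]
        split_ifs
        · exact fourier_chirped j₀ N hg _
        · rw [one_mul]
      simp_rw [this]
      rw [Finset.prod_mul_distrib, Finset.prod_ite_mem, Finset.univ_inter]
    rw [e]
    by_cases h0 : ∏ i, 𝓕 g (slot i ξ) = 0
    · rw [h0, mul_zero, mul_zero, mul_zero]
    rw [← mul_assoc]
    congr 1
    rw [fourier_chirpKernel, ← exp_chirpPhase_mul_prod j₀ I N ξ, chirpSymb_apply,
      Finset.prod_eq_one (s := Finset.univ) fun i _ => ?_, mul_one]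
    exact plateau_eq_one i₀ ((hg _ fun h => h0 (Finset.prod_eq_zero (Finset.mem_univ i) h)).trans
      (testRad_le i₀))
  refine exponent_le_of_forall (N₀ := N₀)
    (c := ENNReal.ofReal c * volume (Metric.closedBall (0 : Phys d n) δ') ^ (1 / p))
    (C := C * C' * ∏ i, (D i : ℝ≥0∞)) ?_ ?_ fun N hN hN1 => ?_
  · refine mul_ne_zero ?_ ?_
    · rw [Ne, ENNReal.ofReal_eq_zero, not_le]; exact hc
    · exact (ENNReal.rpow_pos (Metric.measure_closedBall_pos _ _ hδ')
        measure_closedBall_lt_top.ne).ne'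
  · exact ENNReal.mul_ne_top (ENNReal.mul_ne_top ENNReal.coe_ne_top ENNReal.coe_ne_top)
      (ENNReal.prod_ne_top fun i _ => ENNReal.coe_ne_top)
  · have hN0 : (0 : ℝ) < N := by exact_mod_cast hN1
    have h1 := le_eLpNorm_of_expanded_ball (h := multiplierOp (chirpSymb i₀ j₀ I N) (f N)) j₀ hN1 hp
      fun z hz => by rw [hT]; exact hlow N hN hN1 z hz
    have h2 := hC (chirpSymb i₀ j₀ I N) (fun ξ hξ => norm_le_of_chirpSymb_ne_zero hξ) _
      (ENNReal.mul_lt_top ENNReal.coe_lt_top ENNReal.ofReal_lt_top)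
      (fun κ hκ => hC' κ hκ N hN1) (f N)
    have h3 : ∏ i, eLpNorm (f N i) (ENNReal.ofReal (q i)) volume ≤ (∏ i, (D i : ℝ≥0∞)) *
        ENNReal.ofReal ((N : ℝ) ^ (∑ i ∈ I, ((n : ℝ) / q i - n / 2))) := by
      refine (Finset.prod_le_prod' fun i _ => hD i N hN1).trans (le_of_eq ?_)
      rw [Finset.prod_mul_distrib, ← ENNReal.ofReal_prod_of_nonneg (fun i _ => by positivity),
        Finset.prod_ite_mem, Finset.univ_inter, Real.rpow_sum_of_pos hN0]
    have h4 := h1.trans (h2.trans (mul_le_mul_right h3 _))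
    have e1 : ENNReal.ofReal ((N : ℝ) ^ ((n : ℝ) / p - n / 2)) =
        ENNReal.ofReal ((N : ℝ) ^ (-((n : ℝ) / 2))) * ENNReal.ofReal ((N : ℝ) ^ ((n : ℝ) / p)) := by
      rw [← ENNReal.ofReal_mul (by positivity), ← Real.rpow_add hN0]; ring_nf
    have e2 : ENNReal.ofReal ((N : ℝ) ^ (s j₀ + ∑ i ∈ I, ((n : ℝ) / q i - n / 2))) =
        ENNReal.ofReal ((N : ℝ) ^ s j₀) *
          ENNReal.ofReal ((N : ℝ) ^ (∑ i ∈ I, ((n : ℝ) / q i - n / 2))) := by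
      rw [← ENNReal.ofReal_mul (by positivity), ← Real.rpow_add hN0]
    rw [ENNReal.ofReal_mul hc.le] at h4
    rw [e1, e2]
    calc _ = _ := by ring
      _ ≤ _ := h4
      _ = _ := by ring

end ChirpTest

end MultiParam

/-! ### The necessary conditions -/

theorem theorem1p3 (l d n : ℕ) (hl : 1 ≤ l) (hd : 1 ≤ d) (hn : 1 ≤ n)
    (q : Fin l → ℝ) (p u u' : ℝ) (s : Fin d → ℝ)
    (hq : ∀ i, 1 < q i) (hp : 1 / p = ∑ i, 1 / q i)
    (hu : 1 < u) (huu' : 1 / u + 1 / u' = 1) (hs : ∀ j, 0 < s j)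
    (Θ : Fin d → 𝓢(MultiParam.Block l n, ℂ))
    (hΘ : ∀ j ξ, 𝓕 (Θ j) ξ ≠ 0 → 1 / 2 ≤ ‖ξ‖ ∧ ‖ξ‖ ≤ 2)
    (hbound : ∃ C : ℝ≥0, ∀ m : MultiParam.Freq l d n → ℂ, MemLp m ∞ volume →
      MultiParam.hormanderNorm u s Θ m < ∞ →
      ∀ f : Fin l → 𝓢(MultiParam.Phys d n, ℂ),
        eLpNorm (MultiParam.multiplierOp m f) (ENNReal.ofReal p) volume ≤
          C * MultiParam.hormanderNorm u s Θ m *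
            ∏ i, eLpNorm (f i) (ENNReal.ofReal (q i)) volume) :
    (∀ j, ∀ I : Finset (Fin l),
      max (1 / p - 1 / 2 - ∑ i ∈ I, (1 / q i - 1 / 2))
        (1 / p - 1 / u' - ∑ i ∈ I, (1 / q i - 1 / u)) ≤ s j / n) ∧
    (∀ j, max (l / u) (1 / p - 1 / u') < s j / n) := by
  obtain ⟨C, hC⟩ := hbound
  have hloc : MultiParam.LocalBound hΘ (MultiParam.basePoint hl hn) s u p q :=
    ⟨C, fun m hm B hB hmB f => MultiParam.eLpNorm_multiplierOp_le hΘ hC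
      (MultiParam.norm_param_basePoint hl hn) m hm hB hmB f⟩
  let i₀ : Fin l := ⟨0, hl⟩
  have hs0 : ∀ j, 0 ≤ s j := fun j => (hs j).le
  have hn0 : (0 : ℝ) < n := by exact_mod_cast hn
  have hl1 : (1 : ℝ) ≤ l := by exact_mod_cast hl
  have hu0 : 0 < u := by linarith
  have hq0 : ∀ i, 0 < q i := fun i => zero_lt_one.trans (hq i)
  have hp0 : 0 < p := by
    rw [← one_div_pos, hp]
    exact Finset.sum_pos (fun i _ => one_div_pos.2 (hq0 i)) ⟨i₀, Finset.mem_univ _⟩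
  have hu' : 1 / u' = 1 - 1 / u := by linarith
  have hlu : ∀ j, l / u < s j / n := fun j => by
    rw [lt_div_iff₀ hn0, div_mul_eq_mul_div]
    exact hloc.card_mul_lt hs0 hu hn hp0 hp hq i₀ j
  have h1u : 1 / u ≤ l / u := by gcongr
  refine ⟨fun j I => max_le ?_ ?_, fun j => max_lt (hlu j) ?_⟩
  -- the summands with `q i < 2` are positive and may be left out
  · have h1 := hloc.chirp_le hs0 hu.le hp0 i₀ j (I := I.filter fun i => 2 ≤ q i)
      fun i hi => (Finset.mem_filter.1 hi).2
    have h2 : ∑ i ∈ I with 2 ≤ q i, (1 / q i - 1 / 2) ≤ ∑ i ∈ I, (1 / q i - 1 / 2) := by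
      refine Finset.sum_le_sum_of_subset_of_nonneg (Finset.filter_subset _ _) fun i hi hi' => ?_
      have h3 : q i ≤ 2 := by
        by_contra hlt
        exact hi' (Finset.mem_filter.2 ⟨hi, (not_le.1 hlt).le⟩)
      rw [sub_nonneg]
      exact one_div_le_one_div_of_le (hq0 i) h3
    have h3 : ∑ i ∈ I with 2 ≤ q i, ((n : ℝ) / q i - n / 2) =
        n * ∑ i ∈ I with 2 ≤ q i, (1 / q i - 1 / 2) := by
      rw [Finset.mul_sum]
      exact Finset.sum_congr rfl fun i _ => by ring
    have h4 : (n : ℝ) * (1 / p - 1 / 2) = n / p - n / 2 := by ring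
    rw [le_div_iff₀ hn0]
    nlinarith
  -- for the full index set the bound is weaker than `l / u ≤ s j / n`; otherwise an index outside `I`
  -- carries the kernel
  · by_cases hI : I = Finset.univ
    · subst hI
      have h1 : ∑ i : Fin l, (1 / q i - 1 / u) = 1 / p - l / u := by
        rw [Finset.sum_sub_distrib, ← hp]
        simp [div_eq_mul_inv]
      have h2 : 1 / u < 1 := by rw [div_lt_one hu0]; exact hu
      have h3 := hlu j
      rw [h1, hu']
      linarith
    · obtain ⟨i₁, hi₁⟩ : ∃ i, i ∉ I := by
        by_contra h
        push Not at h
        exact hI (Finset.eq_univ_iff_forall.2 h)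
      have h1 := hloc.exponent_le hs0 hu.le hp0 hq j hi₁
      have h2 : ∑ i ∈ I, (n : ℝ) / q i = n * ∑ i ∈ I, 1 / q i := by
        rw [Finset.mul_sum]
        exact Finset.sum_congr rfl fun i _ => by ring
      have h3 : ∑ i ∈ I, (1 / q i - 1 / u) = ∑ i ∈ I, 1 / q i - I.card / u := by
        rw [Finset.sum_sub_distrib]
        simp [div_eq_mul_inv]
      rw [h3, hu', le_div_iff₀ hn0]
      have h4 : (1 / p - (1 - 1 / u) - (∑ i ∈ I, 1 / q i - I.card / u)) * n =
          n / p - n + (I.card + 1) * n / u - n * ∑ i ∈ I, 1 / q i := by ring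
      rw [h4]
      linarith
  · rw [hu']
    -- for `p ≥ 1` the bound is at most `1 / u ≤ l / u`
    rcases lt_or_ge p 1 with h | h
    · have h1 := hloc.lt_of_lt_one hs0 hu.le hn hp0 h i₀ j
      rw [lt_div_iff₀ hn0]
      have h2 : (1 / p - (1 - 1 / u)) * n = n / p - n + n / u := by ring
      rw [h2]
      exact h1
    · have h1 : 1 / p ≤ 1 := by rw [div_le_one hp0]; exact h
      have h2 := hlu j
      linarith
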